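/- Let $\mathcal H$ be a complex infinite-dimensional separable Hilbert space with a Hilbert basis $\{|n\rangle\}_{n\in\mathbb Z}$, and let $U(\mathcal H)$ be the Banach Lie group of unitary operators (norm topology), with Lie algebra $\mathfrak u(\mathcal H)$ the bounded skew-hermitian operators. Let $L_1(\mathcal H)$, $L_2(\mathcal H)$ be the trace-class and Hilbert–Schmidt operators, $\mathfrak u_i(\mathcal H)\subset L_i(\mathcal H)$ the skew-hermitian ones, and $\mathfrak b_2^+(\mathcal H)$ the set of $a\in L_2(\mathcal H)$ with $\langle m|a|n\rangle=0$ for $m<n$ and $\langle n|a|n\rangle\in\mathbb R$ for all $n$. Then $L_2(\mathcal H)=\mathfrak u_2(\mathcal H)\oplus\mathfrak b_2^+(\mathcal H)$; let $p_{\mathfrak u_2}$, $p_{\mathfrak b_2^+}$ be the corresponding projections. The real Banach space $L_1(\mathcal H)/\mathfrak u_1(\mathcal H)$ is paired with $\mathfrak u(\mathcal H)$ by $([x],b)\mapsto\operatorname{Im}\operatorname{Tr}(xb)$. Definitions. A Banach bundle $\mathbb F$ over a Banach manifold $M$ is *in duality* with $TM$ if there are nondegenerate continuous bilinear pairings $\mathbb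 F_p\times T_pM\to\mathbb R$ depending smoothly on $p$; then $\mathbb F_p$ is regarded as a subset of $T_p^*M$ and sections of $\mathbb F$ as $1$-forms. A smooth section $\pi$ of $\Lambda^2\mathbb F^*$ (continuous skew-symmetric bilinear forms on the fibres) is a *Poisson tensor* if for closed smooth local sections $\alpha,\beta,\gamma$ of $\mathbb F$ over an open set, $d(\pi(\alpha,\beta))$ is a smooth local section of $\mathbb F$ and $\pi(\alpha,d(\pi(\beta,\gamma)))+\pi(\beta,d(\pi(\gamma,\alpha)))+\pi(\gamma,d(\pi(\alpha,\beta)))=0$; $(M,\mathbb F,\pi)$ is then a *Banach sub-Poisson manifold*. A smooth map $\varphi:M_1\to M_2$ is a *Poisson map* if for every $p$ the transpose of $T_p\varphi$ restricts to a continuous map $(\mathbb F_2)_{\varphi(p)}\to(\mathbb F_1)_p$ and $(\pi_1)_p(T_p\varphi^*\alpha,T_p\varphi^*\beta)=(\pi_2)_{\varphi(p)}(\alpha,\beta)$. A *Banach Poisson–Lie group* is a Banach Lie group $G$ with a Banach sub-Poisson structure $(G,\mathbb F,\pi)$ such that the multiplication $G\times G\to G$ is a Poisson map, where $G\times G$ carries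 the bundle with fibres $\mathbb F_g\oplus\mathbb F_h$ and the tensor $\pi(\alpha_1+\alpha_2,\beta_1+\beta_2)=\pi(\alpha_1,\beta_1)+\pi(\alpha_2,\beta_2)$. **Theorem.** Let $R_g$ denote right translation by $g$ in $U(\mathcal H)$. Let $\mathbb F$ be the bundle over $U(\mathcal H)$ with fibres $$\mathbb F_g=R_{g^{-1}}^*\bigl(L_1(\mathcal H)/\mathfrak u_1(\mathcal H)\bigr),$$ trivialised by right translations, i.e. $R_{g^{-1}}^*[x]$ acts on $v\in T_gU(\mathcal H)$ by $\operatorname{Im}\operatorname{Tr}(x\,vg^{-1})$. For $g\in U(\mathcal H)$ the formula $$\Pi_r(g)([x_1],[x_2])=\operatorname{Im}\operatorname{Tr}\bigl(g^{-1}p_{\mathfrak b_2^+}(x_1)g\;p_{\mathfrak u_2}(g^{-1}p_{\mathfrak b_2^+}(x_2)g)\bigr),\qquad x_1,x_2\in L_1(\mathcal H),$$ defines a continuous bilinear form on $\mathbb F_e=L_1(\mathcal H)/\mathfrak u_1(\mathcal H)$. Put $\pi(g)=R_g^{**}\Pi_r(g)$, i.e. $\pi(g)(\alpha,\beta)=\Pi_r(g)(R_g^*\alpha,R_g^*\beta)$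 for $\alpha,\beta\in\mathbb F_g$. Then $(U(\mathcal H),\mathbb F,\pi)$ is a Banach Poisson–Lie group. For smooth functions $f,h$ (defined on an open subset of $U(\mathcal H)$) and a point $g$ of their domain with $df_g,dh_g\in\mathbb F_g$, the functionals $df_g\circ R_g$ and $dh_g\circ R_g$ belong to $\mathbb F_e$ and the Poisson bracket $\{f,h\}=\pi(df,dh)$ is $$\{f,h\}(g)=\Pi_r(g)(df_g\circ R_g,\,dh_g\circ R_g).$$ -/

import Mathlib

set_option linter.unusedSectionVars false

open scoped Manifold ContDiff InnerProductSpace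

noncomputable section

/-! ### The unitary group of a unital C*-algebra as a Banach Lie group -/

section UnitaryLieGroup

variable {A : Type*} [CStarAlgebra A]

/-- The real Banach space of skew-adjoint elements (with the norm of the algebra), i.e. the Lie
algebra of the unitary group. -/
def SkewAdj (A : Type*) [CStarAlgebra A] : Type _ := skewAdjoint.submodule ℝ A

instance : NormedAddCommGroup (SkewAdj A) :=
  inferInstanceAs (NormedAddCommGroup (skewAdjoint.submodule ℝ A))

instance : NormedSpace ℝ (SkewAdj A) :=
  inferInstanceAs (NormedSpace ℝ (skewAdjoint.submodule ℝ A))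

instance : CompleteSpace (SkewAdj A) := by
  have : IsClosed ((skewAdjoint.submodule ℝ A : Submodule ℝ A) : Set A) := by
    have : ((skewAdjoint.submodule ℝ A : Submodule ℝ A) : Set A) = {x : A | star x = -x} := rfl
    rw [this]
    exact isClosed_eq continuous_star continuous_neg
  exact this.completeSpace_coe

/-- The inclusion of the skew-adjoint elements into the algebra. -/
def SkewAdj.val : SkewAdj A →L[ℝ] A := (skewAdjoint.submodule ℝ A).subtypeL

instance : CoeOut (SkewAdj A) A := ⟨fun X => SkewAdj.val X⟩

lemma SkewAdj.val_injective : Function.Injective (SkewAdj.val (A := A)) := Subtype.val_injective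

lemma SkewAdj.star_coe (X : SkewAdj A) : star (X : A) = -(X : A) := X.2

/-- The real-linear continuous projection `x ↦ (x - x*) / 2` onto the skew-adjoint elements. -/
def skewPart (A : Type*) [CStarAlgebra A] : A →L[ℝ] SkewAdj A :=
  ContinuousLinearMap.codRestrict
    ((1 / 2 : ℝ) • (ContinuousLinearMap.id ℝ A - ((starL' ℝ : A ≃L[ℝ] A) : A →L[ℝ] A)))
    (skewAdjoint.submodule ℝ A) fun x => by
      change star ((1 / 2 : ℝ) • (x - star x)) = -((1 / 2 : ℝ) • (x - star x))
      simp [← smul_neg]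

lemma skewPart_coe_of_star {x : A} (hx : star x = -x) : (skewPart A x : A) = x := by
  change (1 / 2 : ℝ) • (x - star x) = x
  rw [hx, sub_neg_eq_add, ← two_smul ℝ x, smul_smul]
  norm_num

/-- `1 + t X` is invertible for `X` skew-adjoint and `t` real. -/
lemma isUnit_one_add_smul (X : SkewAdj A) (t : ℝ) : IsUnit (1 + t • (X : A)) := by
  by_cases ht : t = 0
  · simp [ht]
  have hsa : IsSelfAdjoint (Complex.I • (X : A)) := by
    change star _ = _
    rw [star_smul, SkewAdj.star_coe]
    simp
  have hz : (-(Complex.I * ((t⁻¹ : ℝ) : ℂ))) ∉ spectrum ℂ (Complex.I • (X : A)) := by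
    intro h
    have := congrArg Complex.im (hsa.mem_spectrum_eq_re h)
    simp [ht] at this
  rw [spectrum.notMem_iff] at hz
  have hc : (Complex.I * (t : ℂ)) ≠ 0 := by simp [ht]
  have := hz.smul (Units.mk0 _ hc)
  convert this using 1
  rw [Units.smul_mk0, Algebra.algebraMap_eq_smul_one, smul_sub, smul_smul, smul_smul]
  have h1 : Complex.I * (t : ℂ) * -(Complex.I * ((t⁻¹ : ℝ) : ℂ)) = 1 := by
    have : (t : ℂ) ≠ 0 := by exact_mod_cast ht
    push_cast
    field_simp
    simp
  have h2 : Complex.I * (t : ℂ) * Complex.I = -(t : ℂ) := by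
    linear_combination (t : ℂ) * Complex.I_mul_I
  rw [h1, h2, one_smul, neg_smul, sub_neg_eq_add]
  rfl

/-- The Cayley transform `X ↦ (1 + X/2)(1 - X/2)⁻¹`, normalised so that its derivative at `0` is
the identity. -/
def cayley (x : A) : A := (1 + (1 / 2 : ℝ) • x) * Ring.inverse (1 + (-(1 / 2) : ℝ) • x)

/-- The inverse Cayley transform `a ↦ 2(a - 1)(a + 1)⁻¹`. -/
def cayleyInv (a : A) : A := (2 : ℝ) • ((a - 1) * Ring.inverse (a + 1))

lemma cayley_mem (X : SkewAdj A) : cayley (X : A) ∈ unitary A := by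
  have hp := isUnit_one_add_smul X (1 / 2)
  have hm := isUnit_one_add_smul X (-(1 / 2))
  obtain ⟨p, hp⟩ := hp
  obtain ⟨m, hm⟩ := hm
  have hpm : Commute (p : A) (m : A) := by
    rw [hp, hm]
    refine (Commute.one_left _).add_left (Commute.add_right (Commute.one_right _) ?_)
    exact ((Commute.refl (X : A)).smul_left _).smul_right _
  have hsp : star (p : A) = m := by
    rw [hp, hm, star_add, star_one, star_smul, SkewAdj.star_coe]
    simp
  have hsm : star (m : A) = p := by rw [← hsp, star_star]
  have hsi : star ((m⁻¹ : Aˣ) : A) = ((p⁻¹ : Aˣ) : A) := by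
    have : star m = p := Units.ext hsm
    rw [← this, ← star_inv]
    rfl
  have hc : cayley (X : A) = p * ((m⁻¹ : Aˣ) : A) := by
    rw [cayley, ← hp, ← hm, Ring.inverse_unit]
  have hu : Commute p m := Units.ext hpm
  rw [Unitary.mem_iff, hc, star_mul, hsi, hsp]
  have e1 : p⁻¹ * m * (p * m⁻¹) = 1 := by
    rw [mul_assoc, ← mul_assoc m p, ← hu.eq]; group
  have e2 : p * m⁻¹ * (p⁻¹ * m) = 1 := by
    rw [mul_assoc, ← mul_assoc m⁻¹, (hu.inv_inv.eq).symm]; group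
  exact ⟨by simpa only [Units.val_mul, Units.val_one] using congrArg Units.val e1,
    by simpa only [Units.val_mul, Units.val_one] using congrArg Units.val e2⟩

lemma cayley_add_one (X : SkewAdj A) {m : Aˣ} (hm : (m : A) = 1 + (-(1 / 2) : ℝ) • (X : A)) :
    cayley (X : A) + 1 = (2 : ℝ) • ((m⁻¹ : Aˣ) : A) := by
  rw [cayley, ← hm, Ring.inverse_unit, ← Units.mul_left_inj m, add_mul, mul_assoc, smul_mul_assoc,
    Units.inv_mul, mul_one, one_mul, hm, neg_smul, two_smul]
  abel

lemma isUnit_cayley_add_one (X : SkewAdj A) : IsUnit (cayley (X : A) + 1) := by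
  obtain ⟨m, hm⟩ := isUnit_one_add_smul X (-(1 / 2))
  rw [cayley_add_one X hm]
  exact (m⁻¹).isUnit.smul (Units.mk0 (2 : ℝ) two_ne_zero)

lemma ringInverse_two_smul_inv (m : Aˣ) :
    Ring.inverse ((2 : ℝ) • ((m⁻¹ : Aˣ) : A)) = (1 / 2 : ℝ) • (m : A) := by
  let n : Aˣ := ⟨(2 : ℝ) • ((m⁻¹ : Aˣ) : A), (1 / 2 : ℝ) • (m : A),
    by rw [smul_mul_smul_comm]; simp, by rw [smul_mul_smul_comm]; simp⟩
  exact Ring.inverse_unit n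

lemma cayleyInv_cayley (X : SkewAdj A) : cayleyInv (cayley (X : A)) = X := by
  obtain ⟨m, hm⟩ := isUnit_one_add_smul X (-(1 / 2))
  have hs : cayley (X : A) - 1 = (X : A) * ((m⁻¹ : Aˣ) : A) := by
    rw [cayley, ← hm, Ring.inverse_unit, ← Units.mul_left_inj m, sub_mul, mul_assoc,
      Units.inv_mul, mul_one, one_mul, mul_assoc, Units.inv_mul, mul_one, hm, neg_smul,
      add_sub_add_left_eq_sub, sub_neg_eq_add, ← add_smul]
    norm_num
  rw [cayleyInv, cayley_add_one X hm, ringInverse_two_smul_inv, hs, mul_smul_comm, smul_smul,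
    mul_assoc]
  simp

lemma cayleyInv_star (g : unitary A) (hg : IsUnit ((g : A) + 1)) :
    star (cayleyInv (g : A)) = -cayleyInv (g : A) := by
  obtain ⟨p, hp⟩ := hg
  have hsi : star ((p⁻¹ : Aˣ) : A) * (star (g : A) + 1) = 1 := by
    rw [← star_one (R := A), ← star_add, ← star_mul]
    rw [star_one, ← hp]
    simp
  have hg1 : star (g : A) * g = 1 := Unitary.star_mul_self_of_mem g.2
  have hgp : Commute ((g : A) - 1) ((p⁻¹ : Aˣ) : A) := by
    apply Commute.units_inv_right
    rw [hp]
    exact ((Commute.refl (g : A)).sub_left (Commute.one_left _)).add_right (Commute.one_right _)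
  have hsi' : star ((p⁻¹ : Aˣ) : A) = (p⁻¹ : Aˣ) * (g : A) := by
    have h2 : star (g : A) + 1 = star (g : A) * p := by
      rw [hp, mul_add, hg1, mul_one, add_comm]
    have h3 : (g : A) * star (g : A) = 1 := Unitary.mul_star_self_of_mem g.2
    rw [h2] at hsi
    have h4 : star (g : A) * p * ((p⁻¹ : Aˣ) * (g : A)) = 1 := by
      rw [mul_assoc, ← mul_assoc (p : A)]
      simp [hg1]
    exact left_inv_eq_right_inv hsi h4
  rw [cayleyInv, ← hp, Ring.inverse_unit, star_smul, star_mul, hsi', star_sub, star_one,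
    hgp.eq, mul_assoc, mul_sub, ← smul_neg, ← mul_neg]
  rw [Unitary.mul_star_self_of_mem g.2]
  simp

lemma cayley_cayleyInv (g : A) (hg : IsUnit (g + 1)) : cayley (cayleyInv g) = g := by
  obtain ⟨p, hp⟩ := hg
  have hm : (1 : A) + (-(1 / 2) : ℝ) • cayleyInv g = (2 : ℝ) • ((p⁻¹ : Aˣ) : A) := by
    rw [cayleyInv, ← hp, Ring.inverse_unit, smul_smul, ← Units.mul_left_inj p, add_mul, one_mul,
      smul_mul_assoc, smul_mul_assoc, mul_assoc, Units.inv_mul, mul_one, hp, two_smul]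
    norm_num
    rw [← one_add_one_eq_two (R := A)]
    abel
  have hpl : (1 : A) + (1 / 2 : ℝ) • cayleyInv g = (2 : ℝ) • (g * ((p⁻¹ : Aˣ) : A)) := by
    rw [cayleyInv, ← hp, Ring.inverse_unit, smul_smul, ← Units.mul_left_inj p, add_mul, one_mul,
      smul_mul_assoc, smul_mul_assoc, mul_assoc, mul_assoc, Units.inv_mul, mul_one, mul_one, hp,
      two_smul]
    norm_num
  rw [cayley, hm, hpl, ringInverse_two_smul_inv, smul_mul_smul_comm, mul_assoc]
  simp

lemma contDiff_cayley : ContDiff ℝ ∞ fun X : SkewAdj A => cayley (X : A) := by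
  have hco : ContDiff ℝ ∞ fun X : SkewAdj A => (X : A) :=
    (SkewAdj.val (A := A)).contDiff
  have h1 (t : ℝ) : ContDiff ℝ ∞ fun X : SkewAdj A => 1 + t • (X : A) :=
    contDiff_const.add (contDiff_const.smul hco)
  refine (h1 (1 / 2)).mul ?_
  rw [contDiff_iff_contDiffAt]
  intro X
  obtain ⟨m, hm⟩ := isUnit_one_add_smul X (-(1 / 2))
  have h := contDiffAt_ringInverse ℝ (n := ∞) m
  rw [hm] at h
  exact ContDiffAt.comp X h (h1 (-(1 / 2))).contDiffAt

lemma contDiffAt_cayleyInv {a : A} (ha : IsUnit (a + 1)) : ContDiffAt ℝ ∞ cayleyInv a := by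
  obtain ⟨m, hm⟩ := ha
  have h := contDiffAt_ringInverse ℝ (n := ∞) m
  rw [hm] at h
  exact ((contDiffAt_id.sub contDiffAt_const).mul
    (ContDiffAt.comp a h (contDiffAt_id.add contDiffAt_const))).const_smul (2 : ℝ)

/-- The left-translated Cayley chart `g ↦ 2(u⁻¹g - 1)(u⁻¹g + 1)⁻¹` of the unitary group at `u`;
its inverse is `X ↦ u (1 + X/2)(1 - X/2)⁻¹`, defined on all skew-adjoint elements. -/
def unitaryChart (u : unitary A) : OpenPartialHomeomorph (unitary A) (SkewAdj A) where
  toFun g := skewPart A (cayleyInv ((u⁻¹ * g : unitary A) : A))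
  invFun X := u * ⟨cayley (X : A), cayley_mem X⟩
  source := {g | IsUnit (((u⁻¹ * g : unitary A) : A) + 1)}
  target := Set.univ
  map_source' _ _ := Set.mem_univ _
  map_target' X _ := by
    change IsUnit (((u⁻¹ * (u * ⟨cayley (X : A), cayley_mem X⟩) : unitary A) : A) + 1)
    rw [inv_mul_cancel_left]
    exact isUnit_cayley_add_one X
  left_inv' g hg := by
    have h1 := cayleyInv_star _ hg
    have h2 : (skewPart A (cayleyInv ((u⁻¹ * g : unitary A) : A)) : A)
      = cayleyInv ((u⁻¹ * g : unitary A) : A) := skewPart_coe_of_star h1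
    have : (⟨cayley (skewPart A (cayleyInv ((u⁻¹ * g : unitary A) : A)) : A),
        cayley_mem _⟩ : unitary A) = u⁻¹ * g := by
      apply Subtype.ext
      change cayley _ = _
      rw [h2, cayley_cayleyInv _ hg]
    rw [this]
    simp
  right_inv' X _ := by
    apply SkewAdj.val_injective
    rw [inv_mul_cancel_left]
    rw [skewPart_coe_of_star] <;> rw [cayleyInv_cayley]
    exact X.star_coe
  open_source := by
    refine Units.isOpen.preimage (f := fun g : unitary A => ((u⁻¹ * g : unitary A) : A) + 1) ?_
    fun_prop
  open_target := isOpen_univ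
  continuousOn_toFun := by
    intro g hg
    refine ContinuousAt.continuousWithinAt ?_
    refine (skewPart A).continuous.continuousAt.comp ?_
    exact ContinuousAt.comp (f := fun g : unitary A => ((u⁻¹ * g : unitary A) : A))
      (contDiffAt_cayleyInv hg).continuousAt (by fun_prop)
  continuousOn_invFun := by
    refine Continuous.continuousOn ?_
    refine continuous_const.mul ?_
    exact Continuous.subtype_mk contDiff_cayley.continuous _

/-- The unitary group, with the norm topology, is modelled on the skew-adjoint elements through
the left-translated Cayley charts. -/
instance unitaryChartedSpace : ChartedSpace (SkewAdj A) (unitary A) where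
  atlas := Set.range unitaryChart
  chartAt u := unitaryChart u
  mem_chart_source u := by
    change IsUnit _
    have : (1 : A) + 1 = (2 : ℝ) • (1 : A) := by rw [two_smul]
    simp only [inv_mul_cancel, OneMemClass.coe_one, this]
    exact isUnit_one.smul (Units.mk0 (2 : ℝ) two_ne_zero)
  chart_mem_atlas u := ⟨u, rfl⟩

lemma contDiff_unitaryChart_symm (u : unitary A) :
    ContDiff ℝ ∞ fun X : SkewAdj A => (((unitaryChart u).symm X : unitary A) : A) := by
  change ContDiff ℝ ∞ fun X : SkewAdj A => (u : A) * cayley (X : A)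
  exact contDiff_const.mul contDiff_cayley

lemma contDiffAt_unitaryChart (u : unitary A) {a : A} (ha : IsUnit (((u⁻¹ : unitary A) : A) * a + 1)) :
    ContDiffAt ℝ ∞ (fun a : A => skewPart A (cayleyInv (((u⁻¹ : unitary A) : A) * a))) a := by
  refine (skewPart A).contDiff.contDiffAt.comp a ?_
  exact ContDiffAt.comp (g := cayleyInv) (f := fun a : A => ((u⁻¹ : unitary A) : A) * a) a
    (contDiffAt_cayleyInv ha) (contDiffAt_const.mul contDiffAt_id)

instance : IsManifold 𝓘(ℝ, SkewAdj A) ∞ (unitary A) := by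
  apply isManifold_of_contDiffOn
  rintro _ _ ⟨u, rfl⟩ ⟨w, rfl⟩
  intro X hX
  refine ContDiffAt.contDiffWithinAt ?_
  have hX' : IsUnit (((w⁻¹ : unitary A) : A) * (((unitaryChart u).symm X : unitary A) : A) + 1) := by
    have := hX.1
    simp only [modelWithCornersSelf_coe_symm, Set.preimage_id_eq, id_eq,
      OpenPartialHomeomorph.trans_source, OpenPartialHomeomorph.symm_source, Set.mem_inter_iff,
      Set.mem_preimage] at this
    exact this.2
  exact ContDiffAt.comp (f := fun X : SkewAdj A => (((unitaryChart u).symm X : unitary A) : A)) X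
    (contDiffAt_unitaryChart w hX') (contDiff_unitaryChart_symm u).contDiffAt

/-- The inclusion of the unitary group into the algebra is smooth. -/
lemma contMDiff_unitary_coe :
    ContMDiff 𝓘(ℝ, SkewAdj A) 𝓘(ℝ, A) ∞ fun g : unitary A => (g : A) := by
  intro g
  rw [contMDiffAt_iff]
  refine ⟨continuous_subtype_val.continuousAt, ?_⟩
  exact (contDiff_unitaryChart_symm g).contDiffAt.contDiffWithinAt

/-- A map into the unitary group is smooth once it is smooth as a map into the algebra. -/
lemma contMDiff_unitary_of_coe {E M K : Type*} [NormedAddCommGroup E] [NormedSpace ℝ E]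
    [TopologicalSpace K] {I : ModelWithCorners ℝ E K} [TopologicalSpace M] [ChartedSpace K M]
    {f : M → unitary A} (hf : ContMDiff I 𝓘(ℝ, A) ∞ fun x => (f x : A)) :
    ContMDiff I 𝓘(ℝ, SkewAdj A) ∞ f := by
  intro x
  rw [contMDiffAt_iff_target]
  refine ⟨(Continuous.subtype_mk hf.continuous fun x => (f x).2).continuousAt, ?_⟩
  have hu : IsUnit ((((f x)⁻¹ : unitary A) : A) * ((f x : unitary A) : A) + 1) :=
    mem_chart_source (SkewAdj A) (f x)
  exact ContDiffAt.comp_contMDiffAt (f := fun y => (f y : A)) (contDiffAt_unitaryChart (f x) hu) (hf x)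

instance : LieGroup 𝓘(ℝ, SkewAdj A) ∞ (unitary A) where
  contMDiff_mul := by
    apply contMDiff_unitary_of_coe
    have h1 := (contMDiff_unitary_coe (A := A)).comp
      (contMDiff_fst (I := 𝓘(ℝ, SkewAdj A)) (J := 𝓘(ℝ, SkewAdj A)) (M := unitary A) (N := unitary A))
    have h2 := (contMDiff_unitary_coe (A := A)).comp
      (contMDiff_snd (I := 𝓘(ℝ, SkewAdj A)) (J := 𝓘(ℝ, SkewAdj A)) (M := unitary A) (N := unitary A))
    exact (contDiff_fst.mul contDiff_snd : ContDiff ℝ ∞ fun p : A × A => p.1 * p.2).comp_contMDiff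
      (h1.prodMk_space h2)
  contMDiff_inv := by
    apply contMDiff_unitary_of_coe
    exact ((starL' ℝ : A ≃L[ℝ] A) : A →L[ℝ] A).contDiff.comp_contMDiff contMDiff_unitary_coe

end UnitaryLieGroup

/-! ### Banach sub-Poisson manifolds and Banach Poisson–Lie groups

In this section `V` is a Banach bundle with model fibre `F` over a Banach manifold `M` modelled on
`E`. A bundle in duality with the tangent bundle is such a `V` together with a pairing
`B p : V p × T_p M → ℝ`; by nondegeneracy `B p` embeds `V p` in the cotangent space `T_p^* M`. -/

section SubPoisson

variable {E : Type*} [NormedAddCommGroup E] [NormedSpace ℝ E]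
  {K : Type*} [TopologicalSpace K] (I : ModelWithCorners ℝ E K)
  {M : Type*} [TopologicalSpace M] [ChartedSpace K M]
  (F : Type*) [NormedAddCommGroup F] [NormedSpace ℝ F]
  {V : M → Type*} [TopologicalSpace (Bundle.TotalSpace F V)]
  [∀ p, AddCommGroup (V p)] [∀ p, Module ℝ (V p)] [∀ p, TopologicalSpace (V p)]
  [FiberBundle F V] [VectorBundle ℝ F V]

/-- The bundle `V` is in duality with the tangent bundle through the pairings `B p`: these are
nondegenerate continuous bilinear maps `V p × T_p M → ℝ` depending smoothly on `p`. -/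
structure IsDualityPairing [IsManifold I ∞ M]
    (B : ∀ p : M, V p →L[ℝ] TangentSpace I p →L[ℝ] ℝ) : Prop where
  smooth : ContMDiff I (I.prod 𝓘(ℝ, F →L[ℝ] E →L[ℝ] ℝ)) ∞
    (fun p => Bundle.TotalSpace.mk' (F →L[ℝ] E →L[ℝ] ℝ) p (B p))
  nondegenerate_left : ∀ (p : M) (α : V p), (∀ v : TangentSpace I p, B p α v = 0) → α = 0
  nondegenerate_right : ∀ (p : M) (v : TangentSpace I p), (∀ α : V p, B p α v = 0) → v = 0

/-- `α` is a smooth local section over `U` of the bundle `V` (the values of `α` outside `U` play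
no role). -/
def IsSmoothSection (U : Set M) (α : ∀ p : M, V p) : Prop :=
  ContMDiffOn I (I.prod 𝓘(ℝ, F)) ∞ (fun p => Bundle.TotalSpace.mk' F p (α p)) U

/-- The local expression of a `1`-form `θ` in the chart at `p₀`, i.e. the pull-back of `θ` under
the inverse of that chart. -/
def localForm (θ : ∀ p : M, TangentSpace I p →L[ℝ] ℝ) (p₀ : M) (y : E) : E →L[ℝ] ℝ :=
  (θ ((extChartAt I p₀).symm y)).comp (mfderiv 𝓘(ℝ, E) I (extChartAt I p₀).symm y)

/-- The exterior derivative `dθ(v, w) = Dθ(v)(w) - Dθ(w)(v)` of the `1`-form `θ`, computed in the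
chart at `p₀`, vanishes at `p₀`. -/
def IsClosedFormAt (θ : ∀ p : M, TangentSpace I p →L[ℝ] ℝ) (p₀ : M) : Prop :=
  ∀ v w : E, fderiv ℝ (localForm I θ p₀) (extChartAt I p₀ p₀) v w =
    fderiv ℝ (localForm I θ p₀) (extChartAt I p₀ p₀) w v

/-- `α` is a closed smooth local section over `U` of the bundle `V` in duality with the tangent
bundle: the `1`-form `p ↦ B p (α p)` is closed on `U`. -/
structure IsClosedSection (B : ∀ p : M, V p →L[ℝ] TangentSpace I p →L[ℝ] ℝ)
    (U : Set M) (α : ∀ p : M, V p) : Prop where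
  smooth : IsSmoothSection I F U α
  closed : ∀ p ∈ U, IsClosedFormAt I (fun q => B q (α q)) p

/-- The differential of the function `f` is, over `U`, the smooth local section `δ` of `V`. -/
structure IsDifferentialSection (B : ∀ p : M, V p →L[ℝ] TangentSpace I p →L[ℝ] ℝ)
    (U : Set M) (f : M → ℝ) (δ : ∀ p : M, V p) : Prop where
  smooth : IsSmoothSection I F U δ
  eq_mfderiv : ∀ p ∈ U, ∀ v : TangentSpace I p, B p (δ p) v = mfderiv I 𝓘(ℝ, ℝ) f p v

/-- `π` is a Poisson tensor with respect to the bundle `V` in duality with the tangent bundle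
through `B`. -/
structure IsPoissonTensor (B : ∀ p : M, V p →L[ℝ] TangentSpace I p →L[ℝ] ℝ)
    (π : ∀ p : M, V p →L[ℝ] V p →L[ℝ] ℝ) : Prop where
  /-- `π` is a smooth section of the bundle of continuous bilinear forms on `V`. -/
  smooth : ContMDiff I (I.prod 𝓘(ℝ, F →L[ℝ] F →L[ℝ] ℝ)) ∞
    (fun p => Bundle.TotalSpace.mk' (F →L[ℝ] F →L[ℝ] ℝ) p (π p))
  skew : ∀ (p : M) (α β : V p), π p α β = -π p β α
  /-- For closed local sections `α`, `β`, the differential of `π(α, β)` is a local section. -/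
  differential : ∀ U : Set M, IsOpen U → ∀ α β : ∀ p : M, V p,
    IsClosedSection I F B U α → IsClosedSection I F B U β →
      ∃ δ : ∀ p : M, V p, IsDifferentialSection I F B U (fun p => π p (α p) (β p)) δ
  /-- The Jacobi identity; here `δβγ`, `δγα`, `δαβ` are the local sections of `V` given by the
  differentials of `π(β, γ)`, `π(γ, α)`, `π(α, β)`. -/
  jacobi : ∀ U : Set M, IsOpen U → ∀ α β γ δβγ δγα δαβ : ∀ p : M, V p,
    IsClosedSection I F B U α → IsClosedSection I F B U β → IsClosedSection I F B U γ →
    IsDifferentialSection I F B U (fun p => π p (β p) (γ p)) δβγ →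
    IsDifferentialSection I F B U (fun p => π p (γ p) (α p)) δγα →
    IsDifferentialSection I F B U (fun p => π p (α p) (β p)) δαβ →
      ∀ p ∈ U, π p (α p) (δβγ p) + π p (β p) (δγα p) + π p (γ p) (δαβ p) = 0

/-- `(M, V, π)` is a Banach sub-Poisson manifold, where `V` is in duality with the tangent bundle
through `B`. -/
structure IsBanachSubPoisson [CompleteSpace E] [CompleteSpace F] [I.Boundaryless]
    [IsManifold I ∞ M] [ContMDiffVectorBundle ∞ F V I]
    (B : ∀ p : M, V p →L[ℝ] TangentSpace I p →L[ℝ] ℝ)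
    (π : ∀ p : M, V p →L[ℝ] V p →L[ℝ] ℝ) : Prop where
  duality : IsDualityPairing I F B
  poisson : IsPoissonTensor I F B π

end SubPoisson

section PoissonMap

variable {E₁ : Type*} [NormedAddCommGroup E₁] [NormedSpace ℝ E₁]
  {K₁ : Type*} [TopologicalSpace K₁] (I₁ : ModelWithCorners ℝ E₁ K₁)
  {M₁ : Type*} [TopologicalSpace M₁] [ChartedSpace K₁ M₁]
  {V₁ : M₁ → Type*} [∀ p, AddCommGroup (V₁ p)] [∀ p, Module ℝ (V₁ p)]
  [∀ p, TopologicalSpace (V₁ p)]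
  {E₂ : Type*} [NormedAddCommGroup E₂] [NormedSpace ℝ E₂]
  {K₂ : Type*} [TopologicalSpace K₂] (I₂ : ModelWithCorners ℝ E₂ K₂)
  {M₂ : Type*} [TopologicalSpace M₂] [ChartedSpace K₂ M₂]
  {V₂ : M₂ → Type*} [∀ p, AddCommGroup (V₂ p)] [∀ p, Module ℝ (V₂ p)]
  [∀ p, TopologicalSpace (V₂ p)]

/-- The smooth map `φ` is a Poisson map: for every `p` the transpose of `T_p φ` restricts to a
continuous map `L` from the fibre at `φ p` to the fibre at `p`, and `L` relates the two tensors. -/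
structure IsPoissonMap (B₁ : ∀ p : M₁, V₁ p →L[ℝ] TangentSpace I₁ p →L[ℝ] ℝ)
    (π₁ : ∀ p : M₁, V₁ p →L[ℝ] V₁ p →L[ℝ] ℝ)
    (B₂ : ∀ p : M₂, V₂ p →L[ℝ] TangentSpace I₂ p →L[ℝ] ℝ)
    (π₂ : ∀ p : M₂, V₂ p →L[ℝ] V₂ p →L[ℝ] ℝ) (φ : M₁ → M₂) : Prop where
  smooth : ContMDiff I₁ I₂ ∞ φ
  poisson : ∀ p : M₁, ∃ L : V₂ (φ p) →L[ℝ] V₁ p,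
    (∀ (α : V₂ (φ p)) (v : TangentSpace I₁ p),
      B₁ p (L α) v = B₂ (φ p) α (mfderiv I₁ I₂ φ p v)) ∧
    ∀ α β : V₂ (φ p), π₁ p (L α) (L β) = π₂ (φ p) α β

/-- The pairing of the product sub-Poisson structure on `M₁ × M₂`, whose bundle has the fibre
`V₁ p × V₂ q` at `(p, q)`. -/
def prodPairing (B₁ : ∀ p : M₁, V₁ p →L[ℝ] TangentSpace I₁ p →L[ℝ] ℝ)
    (B₂ : ∀ p : M₂, V₂ p →L[ℝ] TangentSpace I₂ p →L[ℝ] ℝ) (z : M₁ × M₂) :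
    (V₁ z.1 × V₂ z.2) →L[ℝ] TangentSpace (I₁.prod I₂) z →L[ℝ] ℝ :=
  ((mfderiv (I₁.prod I₂) I₁ Prod.fst z).precomp ℝ).comp
      ((B₁ z.1).comp (ContinuousLinearMap.fst ℝ (V₁ z.1) (V₂ z.2))) +
    ((mfderiv (I₁.prod I₂) I₂ Prod.snd z).precomp ℝ).comp
      ((B₂ z.2).comp (ContinuousLinearMap.snd ℝ (V₁ z.1) (V₂ z.2)))

/-- The tensor of the product sub-Poisson structure on `M₁ × M₂`. -/
def prodTensor (π₁ : ∀ p : M₁, V₁ p →L[ℝ] V₁ p →L[ℝ] ℝ)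
    (π₂ : ∀ p : M₂, V₂ p →L[ℝ] V₂ p →L[ℝ] ℝ) (z : M₁ × M₂) :
    (V₁ z.1 × V₂ z.2) →L[ℝ] (V₁ z.1 × V₂ z.2) →L[ℝ] ℝ :=
  ((ContinuousLinearMap.fst ℝ (V₁ z.1) (V₂ z.2)).precomp ℝ).comp
      ((π₁ z.1).comp (ContinuousLinearMap.fst ℝ (V₁ z.1) (V₂ z.2))) +
    ((ContinuousLinearMap.snd ℝ (V₁ z.1) (V₂ z.2)).precomp ℝ).comp
      ((π₂ z.2).comp (ContinuousLinearMap.snd ℝ (V₁ z.1) (V₂ z.2)))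

lemma prodPairing_apply (B₁ : ∀ p : M₁, V₁ p →L[ℝ] TangentSpace I₁ p →L[ℝ] ℝ)
    (B₂ : ∀ p : M₂, V₂ p →L[ℝ] TangentSpace I₂ p →L[ℝ] ℝ) (z : M₁ × M₂)
    (α : V₁ z.1 × V₂ z.2) (v : TangentSpace (I₁.prod I₂) z) :
    prodPairing I₁ I₂ B₁ B₂ z α v =
      B₁ z.1 α.1 (mfderiv (I₁.prod I₂) I₁ Prod.fst z v) +
        B₂ z.2 α.2 (mfderiv (I₁.prod I₂) I₂ Prod.snd z v) := rfl

lemma prodTensor_apply (π₁ : ∀ p : M₁, V₁ p →L[ℝ] V₁ p →L[ℝ] ℝ)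
    (π₂ : ∀ p : M₂, V₂ p →L[ℝ] V₂ p →L[ℝ] ℝ) (z : M₁ × M₂) (α β : V₁ z.1 × V₂ z.2) :
    prodTensor π₁ π₂ z α β = π₁ z.1 α.1 β.1 + π₂ z.2 α.2 β.2 := rfl

end PoissonMap

section PoissonLie

/-- `(G, V, π)` is a Banach Poisson–Lie group: `G` is a Banach Lie group, `(G, V, π)` is a Banach
sub-Poisson manifold and the multiplication `G × G → G` is a Poisson map for the product
sub-Poisson structure on `G × G`. -/
structure IsBanachPoissonLieGroup {E : Type*} [NormedAddCommGroup E] [NormedSpace ℝ E]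
    [CompleteSpace E] {K : Type*} [TopologicalSpace K] (I : ModelWithCorners ℝ E K)
    [I.Boundaryless] {G : Type*} [Group G] [TopologicalSpace G] [ChartedSpace K G]
    [LieGroup I ∞ G]
    (F : Type*) [NormedAddCommGroup F] [NormedSpace ℝ F] [CompleteSpace F]
    {V : G → Type*} [TopologicalSpace (Bundle.TotalSpace F V)]
    [∀ g, AddCommGroup (V g)] [∀ g, Module ℝ (V g)] [∀ g, TopologicalSpace (V g)]
    [FiberBundle F V] [VectorBundle ℝ F V] [ContMDiffVectorBundle ∞ F V I]
    (B : ∀ g : G, V g →L[ℝ] TangentSpace I g →L[ℝ] ℝ)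
    (π : ∀ g : G, V g →L[ℝ] V g →L[ℝ] ℝ) : Prop where
  subPoisson : IsBanachSubPoisson I F B π
  mul : IsPoissonMap (I.prod I) I (prodPairing I I B B) (prodTensor π π) B π
    (fun z : G × G => z.1 * z.2)

end PoissonLie

/-! ### Trace-class operators -/

section TraceClass

variable (H : Type*) [NormedAddCommGroup H] [InnerProductSpace ℂ H] [CompleteSpace H]

variable {H} in
/-- The sums `∑ᵢ |⟨uᵢ, x vᵢ⟩|` over finite orthonormal families `u`, `v`. -/
def traceSums (x : H →L[ℂ] H) : Set ℝ :=
  {s | ∃ (n : ℕ) (u v : Fin n → H), Orthonormal ℂ u ∧ Orthonormal ℂ v ∧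
    s = ∑ i, ‖⟪u i, x (v i)⟫_ℂ‖}

variable {H}

lemma traceSums_nonempty (x : H →L[ℂ] H) : (traceSums x).Nonempty :=
  ⟨0, 0, Fin.elim0, Fin.elim0, ⟨fun i => i.elim0, fun i => i.elim0⟩,
    ⟨fun i => i.elim0, fun i => i.elim0⟩, by simp⟩

lemma traceSums_add_le {x y : H →L[ℂ] H} (hx : BddAbove (traceSums x))
    (hy : BddAbove (traceSums y)) {s : ℝ} (hs : s ∈ traceSums (x + y)) :
    s ≤ sSup (traceSums x) + sSup (traceSums y) := by
  obtain ⟨n, u, v, hu, hv, rfl⟩ := hs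
  calc ∑ i, ‖⟪u i, (x + y) (v i)⟫_ℂ‖
      ≤ ∑ i, (‖⟪u i, x (v i)⟫_ℂ‖ + ‖⟪u i, y (v i)⟫_ℂ‖) := by
        refine Finset.sum_le_sum fun i _ => ?_
        rw [add_apply, inner_add_right]
        exact norm_add_le _ _
    _ = ∑ i, ‖⟪u i, x (v i)⟫_ℂ‖ + ∑ i, ‖⟪u i, y (v i)⟫_ℂ‖ := Finset.sum_add_distrib
    _ ≤ _ := add_le_add (le_csSup hx ⟨n, u, v, hu, hv, rfl⟩) (le_csSup hy ⟨n, u, v, hu, hv, rfl⟩)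

lemma traceSums_smul (c : ℝ) (x : H →L[ℂ] H) :
    traceSums (c • x) = (fun s => |c| * s) '' traceSums x := by
  have key (n : ℕ) (u v : Fin n → H) : ∑ i, ‖⟪u i, (c • x) (v i)⟫_ℂ‖
      = |c| * ∑ i, ‖⟪u i, x (v i)⟫_ℂ‖ := by
    rw [Finset.mul_sum]
    refine Finset.sum_congr rfl fun i _ => ?_
    have : (c • x) (v i) = (c : ℂ) • x (v i) := rfl
    rw [this, inner_smul_right, norm_mul, Complex.norm_real, Real.norm_eq_abs]
  ext s
  constructor
  · rintro ⟨n, u, v, hu, hv, rfl⟩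
    exact ⟨_, ⟨n, u, v, hu, hv, rfl⟩, (key n u v).symm⟩
  · rintro ⟨_, ⟨n, u, v, hu, hv, rfl⟩, rfl⟩
    exact ⟨n, u, v, hu, hv, (key n u v).symm⟩

variable (H)

/-- The trace-class operators: those bounded operators `x` for which `∑ᵢ |⟨uᵢ, x vᵢ⟩|` is bounded
over all finite orthonormal families `u`, `v`. -/
def traceClass : Submodule ℝ (H →L[ℂ] H) where
  carrier := {x | BddAbove (traceSums x)}
  add_mem' hx hy := ⟨_, fun _ hs => traceSums_add_le hx hy hs⟩
  zero_mem' := ⟨0, by rintro _ ⟨n, u, v, hu, hv, rfl⟩; simp⟩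
  smul_mem' c x hx := by
    obtain ⟨C, hC⟩ := hx
    refine ⟨|c| * C, ?_⟩
    rw [traceSums_smul]
    rintro _ ⟨s, hs, rfl⟩
    exact mul_le_mul_of_nonneg_left (hC hs) (abs_nonneg c)

/-- The space `L₁(H)` of trace-class operators, as a real vector space. It carries the trace norm
(and not the operator norm). -/
def L1 : Type _ := traceClass H

instance : AddCommGroup (L1 H) := inferInstanceAs (AddCommGroup (traceClass H))

instance : Module ℝ (L1 H) := inferInstanceAs (Module ℝ (traceClass H))

variable {H}

/-- The bounded operator underlying a trace-class operator. -/
def L1.op : L1 H →ₗ[ℝ] (H →L[ℂ] H) := (traceClass H).subtype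

lemma L1.bddAbove (x : L1 H) : BddAbove (traceSums x.op) := x.2

lemma L1.op_injective : Function.Injective (L1.op (H := H)) := Subtype.val_injective

/-- The trace norm: the supremum of `∑ᵢ |⟨uᵢ, x vᵢ⟩|` over finite orthonormal families. -/
instance : Norm (L1 H) := ⟨fun x => sSup (traceSums x.op)⟩

lemma L1.norm_def (x : L1 H) : ‖x‖ = sSup (traceSums x.op) := rfl

lemma L1.sum_le (x : L1 H) {n : ℕ} {u v : Fin n → H} (hu : Orthonormal ℂ u)
    (hv : Orthonormal ℂ v) : ∑ i, ‖⟪u i, x.op (v i)⟫_ℂ‖ ≤ ‖x‖ :=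
  le_csSup x.bddAbove ⟨n, u, v, hu, hv, rfl⟩

lemma L1.norm_le_of {x : L1 H} {C : ℝ} (h : ∀ (n : ℕ) (u v : Fin n → H), Orthonormal ℂ u →
    Orthonormal ℂ v → ∑ i, ‖⟪u i, x.op (v i)⟫_ℂ‖ ≤ C) : ‖x‖ ≤ C :=
  csSup_le (traceSums_nonempty _) (by rintro _ ⟨n, u, v, hu, hv, rfl⟩; exact h n u v hu hv)

lemma L1.norm_nonneg' (x : L1 H) : 0 ≤ ‖x‖ := by
  refine le_trans ?_ (x.sum_le (n := 0) (u := Fin.elim0) (v := Fin.elim0)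
    ⟨fun i => i.elim0, fun i => i.elim0⟩ ⟨fun i => i.elim0, fun i => i.elim0⟩)
  simp

lemma L1.op_norm_le (x : L1 H) : ‖x.op‖ ≤ ‖x‖ := by
  refine ContinuousLinearMap.opNorm_le_bound _ x.norm_nonneg' fun v => ?_
  by_cases hv : v = 0
  · simp [hv]
  by_cases hxv : x.op v = 0
  · rw [hxv, norm_zero]
    exact mul_nonneg x.norm_nonneg' (norm_nonneg v)
  have horth (w : H) (hw : w ≠ 0) :
      Orthonormal ℂ (fun _ : Fin 1 => ((‖w‖⁻¹ : ℝ) : ℂ) • w) := by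
    refine ⟨fun i => ?_, fun i j hij => (hij (Subsingleton.elim i j)).elim⟩
    rw [norm_smul, Complex.norm_real, norm_inv, norm_norm, inv_mul_cancel₀ (norm_ne_zero_iff.2 hw)]
  have := x.sum_le (horth _ hxv) (horth _ hv)
  rw [Fin.sum_univ_one, map_smul, inner_smul_left, inner_smul_right, inner_self_eq_norm_sq_to_K,
    norm_mul, norm_mul] at this
  simp only [Complex.conj_ofReal, Complex.norm_real, norm_inv, norm_norm, norm_pow,
    RCLike.norm_ofReal, abs_norm] at this
  have h1 : 0 < ‖v‖ := norm_pos_iff.2 hv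
  have h2 : 0 < ‖x.op v‖ := norm_pos_iff.2 hxv
  have h3 : ‖x.op v‖⁻¹ * (‖v‖⁻¹ * ‖x.op v‖ ^ 2) = ‖x.op v‖ / ‖v‖ := by
    field_simp
  rw [h3, div_le_iff₀ h1] at this
  exact this

lemma L1.normCore : NormedSpace.Core ℝ (L1 H) where
  norm_nonneg := L1.norm_nonneg'
  norm_smul c x := by
    rw [L1.norm_def, L1.norm_def, map_smul, traceSums_smul, Real.norm_eq_abs,
      ← smul_eq_mul, ← Real.sSup_smul_of_nonneg (abs_nonneg c)]
    rfl
  norm_triangle x y := by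
    refine csSup_le (traceSums_nonempty _) fun s hs => ?_
    rw [map_add] at hs
    exact traceSums_add_le x.bddAbove y.bddAbove hs
  norm_eq_zero_iff x := by
    constructor
    · intro h
      have h0 : ‖x.op‖ ≤ 0 := h ▸ x.op_norm_le
      exact L1.op_injective (by rw [norm_le_zero_iff.1 h0, map_zero])
    · rintro rfl
      refine le_antisymm (L1.norm_le_of fun n u v _ _ => ?_) (L1.norm_nonneg' _)
      simp

instance : NormedAddCommGroup (L1 H) := NormedAddCommGroup.ofCore L1.normCore

instance : NormedSpace ℝ (L1 H) := NormedSpace.ofCore L1.normCore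

/-- The inclusion `L₁(H) → L_∞(H)` is continuous. -/
def L1.opL : L1 H →L[ℝ] (H →L[ℂ] H) :=
  LinearMap.mkContinuous L1.op 1 fun x => by simpa using x.op_norm_le

instance : CompleteSpace (L1 H) := by
  refine Metric.complete_of_cauchySeq_tendsto fun a ha => ?_
  have hop : CauchySeq fun n => (a n).op := by
    rw [Metric.cauchySeq_iff] at ha ⊢
    intro ε hε
    obtain ⟨N, hN⟩ := ha ε hε
    refine ⟨N, fun m hm n hn => lt_of_le_of_lt ?_ (hN m hm n hn)⟩
    rw [dist_eq_norm, dist_eq_norm, ← map_sub]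
    exact (a m - a n).op_norm_le
  obtain ⟨x, hx⟩ := cauchySeq_tendsto_of_complete hop
  have key : ∀ ε > 0, ∃ N, ∀ n ≥ N, ∀ s ∈ traceSums ((a n).op - x), s ≤ ε := by
    intro ε hε
    obtain ⟨N, hN⟩ := Metric.cauchySeq_iff.1 ha ε hε
    refine ⟨N, fun n hn => ?_⟩
    rintro _ ⟨k, u, v, hu, hv, rfl⟩
    have hlim : Filter.Tendsto (fun m => ∑ i, ‖⟪u i, ((a n).op - (a m).op) (v i)⟫_ℂ‖) Filter.atTop
        (nhds (∑ i, ‖⟪u i, ((a n).op - x) (v i)⟫_ℂ‖)) := by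
      refine tendsto_finsetSum _ fun i _ => Filter.Tendsto.norm ?_
      refine Filter.Tendsto.inner tendsto_const_nhds ?_
      have h0 : Filter.Tendsto (fun m => (a n).op - (a m).op) Filter.atTop
          (nhds ((a n).op - x)) := tendsto_const_nhds.sub hx
      exact ((continuous_id.clm_apply (continuous_const (y := v i))).tendsto _).comp h0
    refine le_of_tendsto hlim (Filter.eventually_atTop.2 ⟨N, fun m hm => ?_⟩)
    have h1 := (a n - a m).sum_le hu hv
    rw [map_sub] at h1
    have h2 := hN n hn m hm
    rw [dist_eq_norm] at h2
    exact h1.trans h2.le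
  have hmem : x ∈ traceClass H := by
    obtain ⟨N, hN⟩ := key 1 one_pos
    have h1 : (a N).op - x ∈ traceClass H := ⟨1, fun s hs => hN N le_rfl s hs⟩
    have h2 := (traceClass H).sub_mem (a N).2 h1
    have h3 : ((a N).1 : H →L[ℂ] H) - ((a N).op - x) = x := sub_sub_cancel _ _
    rwa [h3] at h2
  let X : L1 H := ⟨x, hmem⟩
  refine ⟨X, Metric.tendsto_atTop.2 fun ε hε => ?_⟩
  obtain ⟨N, hN⟩ := key (ε / 2) (half_pos hε)
  refine ⟨N, fun n hn => ?_⟩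
  rw [dist_eq_norm]
  refine lt_of_le_of_lt (csSup_le (traceSums_nonempty _) fun s hs => ?_) (half_lt_self hε)
  rw [map_sub] at hs
  exact hN n hn s hs

variable (H)

/-- The closed subspace `𝔲₁(H)` of skew-hermitian trace-class operators. -/
def u1 : Submodule ℝ (L1 H) where
  carrier := {x | star x.op = -x.op}
  add_mem' {x y} hx hy := by
    change star (L1.op (x + y)) = -L1.op (x + y)
    rw [map_add, star_add, show star x.op = _ from hx, show star y.op = _ from hy]
    abel
  zero_mem' := by
    change star (L1.op (0 : L1 H)) = -L1.op (0 : L1 H)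
    simp
  smul_mem' c x hx := by
    change star (L1.op (c • x)) = -L1.op (c • x)
    rw [map_smul, star_smul, show star x.op = _ from hx, star_trivial, smul_neg]

instance : IsClosed (u1 H : Set (L1 H)) :=
  isClosed_eq (continuous_star.comp (L1.opL (H := H)).continuous)
    (L1.opL (H := H)).continuous.neg

/-- The real Banach space `L₁(H) / 𝔲₁(H)`, with the quotient of the trace norm. -/
def L1ModU1 : Type _ := L1 H ⧸ u1 H

instance : NormedAddCommGroup (L1ModU1 H) := inferInstanceAs (NormedAddCommGroup (L1 H ⧸ u1 H))

instance : NormedSpace ℝ (L1ModU1 H) := inferInstanceAs (NormedSpace ℝ (L1 H ⧸ u1 H))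

instance : CompleteSpace (L1ModU1 H) := inferInstanceAs (CompleteSpace (L1 H ⧸ u1 H))

variable {H}

/-- The class `[x]` of a trace-class operator `x` modulo `𝔲₁(H)`. -/
def L1.cls : L1 H →ₗ[ℝ] L1ModU1 H := (u1 H).mkQ

end TraceClass

/-! ### Hilbert–Schmidt operators and the decomposition `L₂ = 𝔲₂ ⊕ 𝔟₂⁺` -/

section HilbertSchmidt

variable {H : Type*} [NormedAddCommGroup H] [InnerProductSpace ℂ H] [CompleteSpace H]
  (e : HilbertBasis ℤ ℂ H)

lemma hasSum_sq_inner (v : H) : HasSum (fun n => ‖⟪e n, v⟫_ℂ‖ ^ 2) (‖v‖ ^ 2) := by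
  have h := e.hasSum_inner_mul_inner v v
  rw [inner_self_eq_norm_sq_to_K] at h
  have h2 := Complex.hasSum_re h
  convert h2 using 1
  · ext n
    rw [← inner_conj_symm v (e n), ← Complex.normSq_eq_conj_mul_self, Complex.ofReal_re,
      Complex.normSq_eq_norm_sq]
  · norm_cast

lemma op_ext {x y : H →L[ℂ] H} (h : ∀ m n, ⟪e m, x (e n)⟫_ℂ = ⟪e m, y (e n)⟫_ℂ) : x = y := by
  have h1 : ∀ n, x (e n) = y (e n) := fun n => by
    apply e.repr.injective
    ext m
    rw [e.repr_apply_apply, e.repr_apply_apply, h]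
  refine ContinuousLinearMap.ext_on (s := Set.range e) ?_ (by rintro _ ⟨n, rfl⟩; exact h1 n)
  rw [Submodule.dense_iff_topologicalClosure_eq_top]
  exact e.dense_span

/-- The Hilbert–Schmidt operators: `∑ₙ ‖x |n⟩‖² < ∞`. -/
def hilbertSchmidt : Submodule ℝ (H →L[ℂ] H) where
  carrier := {x | Summable fun n => ‖x (e n)‖ ^ 2}
  add_mem' {x y} hx hy := by
    refine Summable.of_nonneg_of_le (fun n => by positivity) (fun n => ?_)
      ((hx.add hy).mul_left 2)
    rw [add_apply]
    have h1 := norm_add_le (x (e n)) (y (e n))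
    have h2 := norm_nonneg (x (e n) + y (e n))
    nlinarith [sq_nonneg (‖x (e n)‖ - ‖y (e n)‖)]
  zero_mem' := by simp [summable_zero]
  smul_mem' c x hx := by
    have : (fun n => ‖(c • x) (e n)‖ ^ 2) = fun n => |c| ^ 2 * ‖x (e n)‖ ^ 2 := by
      ext n
      rw [smul_apply, norm_smul, mul_pow, Real.norm_eq_abs]
    change Summable _
    rw [this]
    exact Summable.mul_left _ hx

lemma star_mem_hilbertSchmidt {x : H →L[ℂ] H} (hx : x ∈ hilbertSchmidt e) :
    star x ∈ hilbertSchmidt e := by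
  have h1 : Summable fun p : ℤ × ℤ => ‖⟪e p.2, x (e p.1)⟫_ℂ‖ ^ 2 := by
    rw [summable_prod_of_nonneg (fun _ => by positivity)]
    refine ⟨fun n => (hasSum_sq_inner e (x (e n))).summable, ?_⟩
    have : (fun n => ∑' m, ‖⟪e m, x (e n)⟫_ℂ‖ ^ 2) = fun n => ‖x (e n)‖ ^ 2 :=
      funext fun n => (hasSum_sq_inner e (x (e n))).tsum_eq
    rw [this]
    exact hx
  have h2 := h1.prod_symm
  rw [summable_prod_of_nonneg (fun _ => by positivity)] at h2
  have h3 : (fun n => ‖star x (e n)‖ ^ 2) =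
      fun n => ∑' m, ‖⟪e n, x (e m)⟫_ℂ‖ ^ 2 := by
    ext n
    rw [← (hasSum_sq_inner e (star x (e n))).tsum_eq]
    refine tsum_congr fun m => ?_
    rw [ContinuousLinearMap.star_eq_adjoint, ContinuousLinearMap.adjoint_inner_right,
      norm_inner_symm]
  change Summable _
  rw [h3]
  exact h2.2

lemma mul_left_mem_hilbertSchmidt (a : H →L[ℂ] H) {x : H →L[ℂ] H} (hx : x ∈ hilbertSchmidt e) :
    a * x ∈ hilbertSchmidt e := by
  refine Summable.of_nonneg_of_le (fun n => by positivity) (fun n => ?_)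
    (Summable.mul_left (‖a‖ ^ 2) hx)
  rw [← mul_pow]
  exact pow_le_pow_left₀ (norm_nonneg _) (a.le_opNorm _) 2

lemma mul_right_mem_hilbertSchmidt {x : H →L[ℂ] H} (hx : x ∈ hilbertSchmidt e) (a : H →L[ℂ] H) :
    x * a ∈ hilbertSchmidt e := by
  rw [← star_star (x * a), star_mul]
  exact star_mem_hilbertSchmidt e
    (mul_left_mem_hilbertSchmidt e (star a) (star_mem_hilbertSchmidt e hx))

/-- Trace-class operators are Hilbert–Schmidt. -/
lemma traceClass_le_hilbertSchmidt : traceClass H ≤ hilbertSchmidt e := by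
  classical
  intro x hx
  obtain ⟨C, hC⟩ := hx
  have hC' : ∀ {ι : Type} [Fintype ι] (u v : ι → H), Orthonormal ℂ u → Orthonormal ℂ v →
      ∑ i, ‖⟪u i, x (v i)⟫_ℂ‖ ≤ C := by
    intro ι _ u v hu hv
    let E := (Fintype.equivFin ι).symm
    refine le_of_eq_of_le ?_ (hC ⟨_, u ∘ E, v ∘ E, hu.comp _ E.injective, hv.comp _ E.injective, rfl⟩)
    exact (E.sum_comp fun i => ‖⟪u i, x (v i)⟫_ℂ‖).symm
  refine summable_of_sum_le (c := ‖x‖ * C) (fun n => by positivity) fun s => ?_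
  let W := Submodule.span ℂ (s.image e : Set H)
  let b := OrthonormalBasis.span e.orthonormal s
  let T : W →L[ℂ] H := x.comp W.subtypeL
  let S : W →ₗ[ℂ] W := (ContinuousLinearMap.adjoint T ∘L T : W →L[ℂ] W)
  have hS : S.IsSymmetric := (ContinuousLinearMap.isPositive_adjoint_comp_self T).isSymmetric
  have hSin (v w : W) : ⟪v, S w⟫_ℂ = ⟪x v, x w⟫_ℂ := by
    change ⟪v, ContinuousLinearMap.adjoint T (T w)⟫_ℂ = _
    rw [ContinuousLinearMap.adjoint_inner_right]
    rfl
  let f := hS.eigenvectorBasis rfl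
  have hsum : ∑ n ∈ s, ‖x (e n)‖ ^ 2 = ∑ i, ‖x (f i)‖ ^ 2 := by
    have h1 := S.trace_eq_sum_inner b
    have h2 := S.trace_eq_sum_inner f
    rw [h1] at h2
    simp only [hSin, inner_self_eq_norm_sq_to_K] at h2
    have h3 : ∑ i : s, ‖x (b i)‖ ^ 2 = ∑ i, ‖x (f i)‖ ^ 2 := by exact_mod_cast h2
    rw [← h3, ← Finset.sum_coe_sort]
    refine Finset.sum_congr rfl fun i _ => ?_
    rw [OrthonormalBasis.span_apply]
  rw [hsum]
  let J := {i // x (f i) ≠ 0}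
  have hv : Orthonormal ℂ (fun j : J => (f j.1 : H)) :=
    (f.orthonormal.comp_linearIsometry W.subtypeₗᵢ).comp _ Subtype.val_injective
  have hu : Orthonormal ℂ (fun j : J => ((‖x (f j.1)‖⁻¹ : ℝ) : ℂ) • x (f j.1)) := by
    refine ⟨fun j => ?_, fun j k hjk => ?_⟩
    · rw [norm_smul, Complex.norm_real, norm_inv, norm_norm,
        inv_mul_cancel₀ (norm_ne_zero_iff.2 j.2)]
    · change ⟪((‖x (f j.1)‖⁻¹ : ℝ) : ℂ) • x (f j.1), ((‖x (f k.1)‖⁻¹ : ℝ) : ℂ) • x (f k.1)⟫_ℂ = 0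
      rw [inner_smul_left, inner_smul_right, ← hSin, hS.apply_eigenvectorBasis rfl k.1,
        inner_smul_right]
      have : ⟪f j.1, f k.1⟫_ℂ = 0 := f.orthonormal.2 fun h => hjk (Subtype.ext h)
      change _ * (_ * (_ * ⟪f j.1, f k.1⟫_ℂ)) = 0
      rw [this]
      simp
  have h4 := hC' _ _ hu hv
  have h5 : ∑ j : J, ‖x (f j.1)‖ ≤ C := by
    refine le_of_eq_of_le (Finset.sum_congr rfl fun j _ => ?_) h4
    rw [inner_smul_left, inner_self_eq_norm_sq_to_K, norm_mul]
    simp only [Complex.conj_ofReal, Complex.norm_real, norm_inv, norm_norm, norm_pow,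
      RCLike.norm_ofReal, abs_norm]
    have : ‖x (f j.1)‖ ≠ 0 := norm_ne_zero_iff.2 j.2
    field_simp
  have h6 : ∑ i, ‖x (f i)‖ = ∑ j : J, ‖x (f j.1)‖ := by
    rw [← Finset.sum_subtype (Finset.univ.filter fun i => x (f i) ≠ 0) (by simp)
      (fun i => ‖x (f i)‖)]
    exact (Finset.sum_filter_of_ne fun i _ h => norm_ne_zero_iff.1 h).symm
  calc ∑ i, ‖x (f i)‖ ^ 2 ≤ ∑ i, ‖x‖ * ‖x (f i)‖ := by
        refine Finset.sum_le_sum fun i _ => ?_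
        have h7 : ‖x (f i)‖ ≤ ‖x‖ := by
          have := x.le_opNorm (f i)
          rwa [Submodule.norm_coe, f.orthonormal.1 i, mul_one] at this
        nlinarith [norm_nonneg (x (f i))]
    _ = ‖x‖ * ∑ j : J, ‖x (f j.1)‖ := by rw [← Finset.mul_sum, h6]
    _ ≤ ‖x‖ * C := mul_le_mul_of_nonneg_left h5 (norm_nonneg x)

/-- The skew-hermitian Hilbert–Schmidt operators `𝔲₂(H)`. -/
def u2 : Submodule ℝ (hilbertSchmidt e) where
  carrier := {x | star (x : H →L[ℂ] H) = -(x : H →L[ℂ] H)}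
  add_mem' {x y} hx hy := by
    change star ((x : H →L[ℂ] H) + (y : H →L[ℂ] H)) = -((x : H →L[ℂ] H) + (y : H →L[ℂ] H))
    rw [star_add, show star (x : H →L[ℂ] H) = _ from hx, show star (y : H →L[ℂ] H) = _ from hy,
      neg_add]
  zero_mem' := by
    change star (0 : H →L[ℂ] H) = -(0 : H →L[ℂ] H)
    simp
  smul_mem' c x hx := by
    change star (c • (x : H →L[ℂ] H)) = -(c • (x : H →L[ℂ] H))
    rw [star_smul, show star (x : H →L[ℂ] H) = _ from hx, star_trivial, smul_neg]

/-- The upper triangular Hilbert–Schmidt operators with real diagonal, `𝔟₂⁺(H)`: the vector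
`x |n⟩` lies in the closed span of the `|m⟩`, `m ≥ n`, and `⟨n| x |n⟩` is real. -/
def b2 : Submodule ℝ (hilbertSchmidt e) where
  carrier := {x | (∀ m n, m < n → ⟪e m, (x : H →L[ℂ] H) (e n)⟫_ℂ = 0) ∧
    ∀ n, (⟪e n, (x : H →L[ℂ] H) (e n)⟫_ℂ).im = 0}
  add_mem' {x y} hx hy := by
    refine ⟨fun m n h => ?_, fun n => ?_⟩
    · rw [Submodule.coe_add, add_apply, inner_add_right, hx.1 m n h, hy.1 m n h, add_zero]
    · rw [Submodule.coe_add, add_apply, inner_add_right, Complex.add_im, hx.2, hy.2, add_zero]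
  zero_mem' := by simp
  smul_mem' c x hx := by
    have key (m n) : ⟪e m, ((c • x : hilbertSchmidt e) : H →L[ℂ] H) (e n)⟫_ℂ
        = (c : ℂ) * ⟪e m, (x : H →L[ℂ] H) (e n)⟫_ℂ := by
      rw [← inner_smul_right]
      rfl
    refine ⟨fun m n h => ?_, fun n => ?_⟩
    · rw [key, hx.1 m n h, mul_zero]
    · rw [key, Complex.im_ofReal_mul, hx.2, mul_zero]

/-- A square-summable sequence of columns defines a bounded operator. -/
lemma exists_op_of_columns {w : ℤ → H} (hw : Summable fun n => ‖w n‖ ^ 2) :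
    ∃ x : H →L[ℂ] H, ∀ n, x (e n) = w n := by
  have hCS (v : H) : (Summable fun n => ‖⟪e n, v⟫_ℂ‖ * ‖w n‖) ∧
      ∑' n, ‖⟪e n, v⟫_ℂ‖ * ‖w n‖ ≤ ‖v‖ * √(∑' n, ‖w n‖ ^ 2) := by
    have h := Real.summable_and_inner_le_Lp_mul_Lq_tsum_of_nonneg Real.HolderConjugate.two_two
      (f := fun n => ‖⟪e n, v⟫_ℂ‖) (g := fun n => ‖w n‖) (fun _ => norm_nonneg _)
      (fun _ => norm_nonneg _) (by simpa using (hasSum_sq_inner e v).summable) (by simpa using hw)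
    refine ⟨h.1, h.2.trans_eq ?_⟩
    simp only [Real.rpow_two, ← Real.sqrt_eq_rpow, (hasSum_sq_inner e v).tsum_eq,
      Real.sqrt_sq (norm_nonneg v)]
  have hsum (v : H) : Summable fun n => ‖⟪e n, v⟫_ℂ • w n‖ := by
    simpa only [norm_smul] using (hCS v).1
  let L : H →ₗ[ℂ] H :=
    { toFun := fun v => ∑' n, ⟪e n, v⟫_ℂ • w n
      map_add' := fun v v' => by
        rw [← (hsum v).of_norm.tsum_add (hsum v').of_norm]
        exact tsum_congr fun n => by rw [inner_add_right, add_smul]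
      map_smul' := fun c v => by
        rw [RingHom.id_apply, ← (hsum v).of_norm.tsum_const_smul]
        exact tsum_congr fun n => by rw [inner_smul_right, mul_smul] }
  refine ⟨L.mkContinuous (√(∑' n, ‖w n‖ ^ 2)) fun v => ?_, fun n => ?_⟩
  · refine (norm_tsum_le_tsum_norm (hsum v)).trans ?_
    simp only [norm_smul]
    rw [mul_comm]
    exact (hCS v).2
  · change ∑' m, ⟪e m, e n⟫_ℂ • w m = w n
    rw [tsum_eq_single n]
    · rw [inner_self_eq_norm_sq_to_K, e.orthonormal.1]
      simp
    · intro m hm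
      rw [e.orthonormal.2 hm, zero_smul]

lemma exists_triangular (x : hilbertSchmidt e) : ∃ y ∈ b2 e, x - y ∈ u2 e := by
  let K (n : ℤ) : Submodule ℂ H := (Submodule.span ℂ (e '' {m | n < m})).topologicalClosure
  have hK (n) : IsClosed (K n : Set H) := Submodule.isClosed_topologicalClosure _
  have hcK (n) : CompleteSpace (K n) := (hK n).completeSpace_coe
  have hP1 (m n : ℤ) (h : n < m) (v : H) : ⟪e m, (K n).starProjection v⟫_ℂ = ⟪e m, v⟫_ℂ := by
    have hm : e m ∈ K n :=
      Submodule.le_topologicalClosure _ (Submodule.subset_span ⟨m, h, rfl⟩)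
    rw [← Submodule.inner_starProjection_left_eq_right,
      Submodule.starProjection_eq_self_iff.2 hm]
  have hP2 (m n : ℤ) (h : m ≤ n) (v : H) : ⟪e m, (K n).starProjection v⟫_ℂ = 0 := by
    have hle : K n ≤ (ℂ ∙ e m)ᗮ := by
      refine Submodule.topologicalClosure_minimal _ ?_ (Submodule.isClosed_orthogonal _)
      rw [Submodule.span_le]
      rintro _ ⟨k, hk, rfl⟩
      rw [SetLike.mem_coe, Submodule.mem_orthogonal_singleton_iff_inner_right]
      exact e.orthonormal.2 (ne_of_lt (lt_of_le_of_lt h hk))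
    exact Submodule.mem_orthogonal_singleton_iff_inner_right.1
      (hle (Submodule.starProjection_apply_mem _ v))
  let X : H →L[ℂ] H := x
  let d (n : ℤ) : ℂ := ((⟪e n, X (e n)⟫_ℂ).re : ℂ)
  let w (n : ℤ) : H := (K n).starProjection ((X + star X) (e n)) + d n • e n
  have hw : Summable fun n => ‖w n‖ ^ 2 := by
    have h1 : Summable fun n => ‖(X + star X) (e n)‖ ^ 2 :=
      (hilbertSchmidt e).add_mem x.2 (star_mem_hilbertSchmidt e x.2)
    have h2 : Summable fun n => ‖X (e n)‖ ^ 2 := x.2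
    refine Summable.of_nonneg_of_le (fun n => by positivity) (fun n => ?_) ((h1.add h2).mul_left 2)
    have h3 : ‖(K n).starProjection ((X + star X) (e n))‖ ≤ ‖(X + star X) (e n)‖ :=
      Submodule.norm_starProjection_apply_le _ _
    have h4 : ‖d n • e n‖ ≤ ‖X (e n)‖ := by
      rw [norm_smul, e.orthonormal.1, mul_one, Complex.norm_real]
      refine (Complex.abs_re_le_norm _).trans ((norm_inner_le_norm _ _).trans ?_)
      rw [e.orthonormal.1, one_mul]
    have h5 : ‖w n‖ ≤ ‖(X + star X) (e n)‖ + ‖X (e n)‖ := (norm_add_le _ _).trans (add_le_add h3 h4)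
    nlinarith [sq_nonneg (‖(X + star X) (e n)‖ - ‖X (e n)‖), norm_nonneg (w n)]
  obtain ⟨Y, hY⟩ := exists_op_of_columns e hw
  have hYmem : Y ∈ hilbertSchmidt e := by
    change Summable _
    simpa only [hY] using hw
  have hlt (m n : ℤ) (h : m < n) : ⟪e m, Y (e n)⟫_ℂ = 0 := by
    rw [hY, inner_add_right, hP2 m n h.le, inner_smul_right, e.orthonormal.2 h.ne]
    simp
  have heq (n : ℤ) : ⟪e n, Y (e n)⟫_ℂ = d n := by
    rw [hY, inner_add_right, hP2 n n le_rfl, inner_smul_right, inner_self_eq_norm_sq_to_K,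
      e.orthonormal.1]
    simp
  have hstar (m n : ℤ) (Z : H →L[ℂ] H) :
      ⟪e m, star Z (e n)⟫_ℂ = (starRingEnd ℂ) ⟪e n, Z (e m)⟫_ℂ := by
    rw [ContinuousLinearMap.star_eq_adjoint, ContinuousLinearMap.adjoint_inner_right,
      inner_conj_symm]
  have hgt (m n : ℤ) (h : n < m) :
      ⟪e m, Y (e n)⟫_ℂ = ⟪e m, X (e n)⟫_ℂ + (starRingEnd ℂ) ⟪e n, X (e m)⟫_ℂ := by
    rw [hY, inner_add_right, hP1 m n h, inner_smul_right, e.orthonormal.2 h.ne', add_apply,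
      inner_add_right, hstar]
    simp
  refine ⟨⟨Y, hYmem⟩, ⟨hlt, fun n => ?_⟩, ?_⟩
  · change (⟪e n, Y (e n)⟫_ℂ).im = 0
    rw [heq]
    simp [d]
  · change star (X - Y) = -(X - Y)
    apply op_ext e
    intro m n
    rw [hstar, sub_apply, neg_apply, sub_apply, inner_sub_right, inner_neg_right, inner_sub_right,
      map_sub]
    rcases lt_trichotomy m n with h | h | h
    · rw [hlt m n h, hgt n m h, map_add, Complex.conj_conj]
      ring
    · subst h
      rw [heq]
      change (starRingEnd ℂ) ⟪e m, X (e m)⟫_ℂ - (starRingEnd ℂ) ((⟪e m, X (e m)⟫_ℂ).re : ℂ) =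
        -(⟪e m, X (e m)⟫_ℂ - ((⟪e m, X (e m)⟫_ℂ).re : ℂ))
      generalize ⟪e m, X (e m)⟫_ℂ = z
      apply Complex.ext <;> simp
    · rw [hlt n m h, hgt m n h, map_zero]
      ring

/-- `L₂(H) = 𝔲₂(H) ⊕ 𝔟₂⁺(H)`. -/
theorem isCompl_u2_b2 : IsCompl (u2 e) (b2 e) := by
  constructor
  · rw [Submodule.disjoint_def]
    intro x hu hb
    apply Subtype.ext
    apply op_ext e
    intro m n
    have hskew (m n) : ⟪e m, (x : H →L[ℂ] H) (e n)⟫_ℂ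
        = -(starRingEnd ℂ) ⟪e n, (x : H →L[ℂ] H) (e m)⟫_ℂ := by
      rw [inner_conj_symm, ← ContinuousLinearMap.adjoint_inner_right,
        ← ContinuousLinearMap.star_eq_adjoint, show star (x : H →L[ℂ] H) = _ from hu]
      simp
    have h0 : ⟪e m, (x : H →L[ℂ] H) (e n)⟫_ℂ = 0 := by
      rcases lt_trichotomy m n with h | h | h
      · exact hb.1 m n h
      · subst h
        have h1 := congrArg Complex.re (hskew m m)
        rw [Complex.neg_re, Complex.conj_re] at h1
        exact Complex.ext (by simp only [Complex.zero_re]; linarith) (hb.2 m)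
      · rw [hskew, hb.1 n m h]
        simp
    rw [h0]
    simp
  · rw [codisjoint_iff, eq_top_iff]
    intro x _
    obtain ⟨y, hy, hxy⟩ := exists_triangular e x
    exact Submodule.mem_sup.2 ⟨x - y, hxy, y, hy, sub_add_cancel x y⟩

/-- The projection `p_{𝔲₂}` of `L₂(H) = 𝔲₂(H) ⊕ 𝔟₂⁺(H)` onto `𝔲₂(H)`. -/
def projU2 : hilbertSchmidt e →ₗ[ℝ] hilbertSchmidt e :=
  (u2 e).projection (b2 e) (isCompl_u2_b2 e)

/-- The projection `p_{𝔟₂⁺}` of `L₂(H) = 𝔲₂(H) ⊕ 𝔟₂⁺(H)` onto `𝔟₂⁺(H)`. -/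
def projB2 : hilbertSchmidt e →ₗ[ℝ] hilbertSchmidt e :=
  (b2 e).projection (u2 e) (isCompl_u2_b2 e).symm

/-- A trace-class operator, seen as a Hilbert–Schmidt operator. -/
def L1.toL2 (x : L1 H) : hilbertSchmidt e := ⟨x.op, traceClass_le_hilbertSchmidt e x.2⟩

/-- The conjugate `g⁻¹ y g` of a Hilbert–Schmidt operator `y` by a unitary operator `g`. -/
def conjInv (g : unitary (H →L[ℂ] H)) (y : hilbertSchmidt e) : hilbertSchmidt e :=
  ⟨((g⁻¹ : unitary (H →L[ℂ] H)) : H →L[ℂ] H) * (y : H →L[ℂ] H) * (g : H →L[ℂ] H),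
    mul_right_mem_hilbertSchmidt e (mul_left_mem_hilbertSchmidt e _ y.2) _⟩

/-- The trace `∑ₙ ⟨n| y |n⟩` (an absolutely convergent series for trace-class `y`). -/
def opTrace (y : H →L[ℂ] H) : ℂ := ∑' n, ⟪e n, y (e n)⟫_ℂ

/-- `Im Tr (g⁻¹ p_{𝔟₂⁺}(x₁) g · p_{𝔲₂}(g⁻¹ p_{𝔟₂⁺}(x₂) g))`. -/
def poissonForm (g : unitary (H →L[ℂ] H)) (x₁ x₂ : L1 H) : ℝ :=
  (opTrace e ((conjInv e g (projB2 e (x₁.toL2 e)) : H →L[ℂ] H) *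
    (projU2 e (conjInv e g (projB2 e (x₂.toL2 e))) : H →L[ℂ] H))).im

end HilbertSchmidt

/-! ### The precotangent bundle of the unitary group of a Hilbert space -/

section Precotangent

variable (H : Type*) [NormedAddCommGroup H] [InnerProductSpace ℂ H] [CompleteSpace H]

/-- The Banach Lie group `U(H)` of unitary operators, with the norm topology. -/
abbrev UnitaryOp : Type _ := unitary (H →L[ℂ] H)

/-- The model with corners of the Banach Lie group `U(H)`, modelled on the skew-hermitian bounded
operators. -/
abbrev modelU : ModelWithCorners ℝ (SkewAdj (H →L[ℂ] H)) (SkewAdj (H →L[ℂ] H)) :=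
  𝓘(ℝ, SkewAdj (H →L[ℂ] H))

/-- The precotangent bundle of `U(H)`, trivialised by right translations: the element `ξ` of the
fibre `L₁(H) / 𝔲₁(H)` at `g` stands for the cotangent vector `R_{g⁻¹}^* ξ` at `g`. The pairing with
tangent vectors which expresses this is `(ξ, v) ↦ ⟨ξ, T R_{g⁻¹} v⟩`. -/
abbrev Precotangent : UnitaryOp H → Type _ := Bundle.Trivial (UnitaryOp H) (L1ModU1 H)

variable {H}

/-- The tangent map at `g` of the right translation `R_{g⁻¹} : h ↦ h g⁻¹`; its values are
regarded as bounded operators. -/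
def tangentRightInv (g : UnitaryOp H) : TangentSpace (modelU H) g →L[ℝ] (H →L[ℂ] H) :=
  mfderiv (modelU H) 𝓘(ℝ, H →L[ℂ] H) (fun h : UnitaryOp H => ((h * g⁻¹ : UnitaryOp H) : H →L[ℂ] H)) g

/-- The tangent map at the unit of the right translation `R_g : h ↦ h g`. -/
def tangentRight (g : UnitaryOp H) :
    TangentSpace (modelU H) (1 : UnitaryOp H) →L[ℝ] TangentSpace (modelU H) g :=
  mfderiv (modelU H) (modelU H) (fun h : UnitaryOp H => h * g) 1

/-- The pull-back `R_g^*` from the fibre of the precotangent bundle at `g` to the one at the unit.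
In the trivialisation by right translations it is the identity. -/
def rightPullback (g : UnitaryOp H) : Precotangent H g →L[ℝ] Precotangent H 1 :=
  ContinuousLinearMap.id ℝ (L1ModU1 H)

/-- The tensor `π(g) = R_g^{**} P(g)`, i.e. `π(g)(α, β) = P(g)(R_g^* α, R_g^* β)`. -/
def rightTensor (P : UnitaryOp H → Precotangent H 1 →L[ℝ] Precotangent H 1 →L[ℝ] ℝ)
    (g : UnitaryOp H) : Precotangent H g →L[ℝ] Precotangent H g →L[ℝ] ℝ :=
  (P g).bilinearComp (rightPullback g) (rightPullback g)

end Precotangent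

end

/-!
The form `⟨x, y⟩ = Im Tr (x y)` is symmetric, invariant under unitary conjugation and pairs the two
summands of `L₂ = 𝔲₂ ⊕ 𝔟₂⁺`, each of which is an isotropic Lie subalgebra (`HS.IsSkew.form_eq_zero`,
`HS.IsTri.form_eq_zero`). Everything follows from this Manin-triple structure, applied to
`x = g⁻¹ p_{𝔟₂⁺}(x₁) g` and `y = g⁻¹ p_{𝔟₂⁺}(x₂) g`, with `Π_r(g)([x₁], [x₂]) = ⟨x, p_{𝔲₂} y⟩`.

* *Well-definedness.* The projections are bounded in the Hilbert–Schmidt norm (`HS.norm_pbLinear_le`)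
  and `𝔲₁` lies in the kernel of `p_{𝔟₂⁺}`, so `Π_r(g)` is a continuous form on `L₁ / 𝔲₁`; it is
  `conjForm e (HS.conj e g)`. The identity `Tr (x a) = Tr (a x)` for trace-class `x` and bounded `a`
  is reduced to Hilbert–Schmidt operators by the factorisation of `x` through `|x|^{1/2}`.
* *Skew-symmetry.* `⟨x, y⟩ = 0`, because `𝔟₂⁺` is isotropic (`conjForm_skew`).
* *Multiplicativity.* `Π_r(g h) = Π_r(g) + Ad^*_g Π_r(h)` (`conjForm_mul`), because `Ad_h` preserves
  `𝔲₂`. As the derivative of the multiplication has the same form in the right trivialisation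
  (`skewAd_mfderiv_mul`), the multiplication is a Poisson map.
* *Differentials.* The tensor assigns to the covector `[x₂]` at `g` the tangent vector `p_{𝔲₂} y`,
  left-trivialised (`sharp`). For closed sections `α`, `β` of `𝔽` the differential of `π(α, β)` is
  given by `D α · β♯ - D β · α♯ + [p_{𝔟₂⁺} α, p_{𝔟₂⁺} β]`, again a section of `𝔽`
  (`leftDeriv_conjForm_of_closed`): closedness, expressed in the Cayley chart
  (`IsClosedFormAt.sectionForm_eq`), absorbs the terms which involve brackets with `β♯` and `α♯`.
* *Jacobi identity.* Substituting this formula and using closedness once more, only values of the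
  triple product `⟨[x, y], z⟩` remain. They cancel, since it vanishes on three elements of `𝔲₂` and on
  three elements of `𝔟₂⁺` (`HS.sum_form_bracket_pu`, `sum_skewPairing_sectionBracket`).
-/

noncomputable section

/-! ### Trace-class operators form an ideal -/

section TraceIdeal

variable {H : Type*} [NormedAddCommGroup H] [InnerProductSpace ℂ H] [CompleteSpace H]

lemma Orthonormal.unitary_apply {ι : Type*} {v : ι → H} (hv : Orthonormal ℂ v)
    (g : unitary (H →L[ℂ] H)) : Orthonormal ℂ fun i => (g : H →L[ℂ] H) (v i) := by
  classical
  rw [orthonormal_iff_ite] at hv ⊢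
  intro i j
  rw [ContinuousLinearMap.inner_map_map_of_mem_unitary g.2, hv]

lemma inner_star_apply (x : H →L[ℂ] H) (v w : H) : ⟪v, star x w⟫_ℂ = ⟪x v, w⟫_ℂ := by
  rw [ContinuousLinearMap.star_eq_adjoint, ContinuousLinearMap.adjoint_inner_right]

lemma inner_star_apply_left (x : H →L[ℂ] H) (v w : H) : ⟪star x v, w⟫_ℂ = ⟪v, x w⟫_ℂ := by
  rw [ContinuousLinearMap.star_eq_adjoint, ContinuousLinearMap.adjoint_inner_left]

lemma L1.sum_finset_le (x : L1 H) {ι : Type*} {u v : ι → H} (hu : Orthonormal ℂ u)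
    (hv : Orthonormal ℂ v) (s : Finset ι) : ∑ i ∈ s, ‖⟪u i, x.op (v i)⟫_ℂ‖ ≤ ‖x‖ := by
  let E := s.equivFin.symm
  have h := x.sum_le (hu.comp _ (Subtype.val_injective.comp E.injective))
    (hv.comp _ (Subtype.val_injective.comp E.injective))
  refine le_of_eq_of_le ?_ h
  rw [← Finset.sum_coe_sort]
  exact (E.sum_comp fun i : s => ‖⟪u i, x.op (v i)⟫_ℂ‖).symm

/-- For unitary `a` the bound holds without the factor `2`, and every bounded operator is a
combination of four unitaries with coefficients at most half its norm. -/
lemma L1.sum_mul_le (x : L1 H) (a : H →L[ℂ] H) {n : ℕ} {u v : Fin n → H}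
    (hu : Orthonormal ℂ u) (hv : Orthonormal ℂ v) :
    ∑ i, ‖⟪u i, (x.op * a) (v i)⟫_ℂ‖ ≤ 2 * ‖x‖ * ‖a‖ := by
  obtain ⟨U, c, ha, hc⟩ := CStarAlgebra.exists_sum_four_unitary a
  have key (i : Fin n) : ‖⟪u i, (x.op * a) (v i)⟫_ℂ‖ ≤
      ∑ k, ‖a‖ / 2 * ‖⟪u i, x.op ((U k : H →L[ℂ] H) (v i))⟫_ℂ‖ := by
    have : (x.op * a) (v i) = ∑ k, c k • x.op ((U k : H →L[ℂ] H) (v i)) := by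
      conv_lhs => rw [ha]
      simp
    rw [this, inner_sum]
    refine (norm_sum_le _ _).trans (Finset.sum_le_sum fun k _ => ?_)
    rw [inner_smul_right, norm_mul]
    exact mul_le_mul_of_nonneg_right (hc k) (norm_nonneg _)
  calc _ ≤ ∑ i, ∑ k, ‖a‖ / 2 * ‖⟪u i, x.op ((U k : H →L[ℂ] H) (v i))⟫_ℂ‖ :=
        Finset.sum_le_sum fun i _ => key i
    _ = ∑ k, ‖a‖ / 2 * ∑ i, ‖⟪u i, x.op ((U k : H →L[ℂ] H) (v i))⟫_ℂ‖ := by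
        rw [Finset.sum_comm]
        simp only [Finset.mul_sum]
    _ ≤ ∑ k : Fin 4, ‖a‖ / 2 * ‖x‖ := Finset.sum_le_sum fun k _ =>
        mul_le_mul_of_nonneg_left (x.sum_le hu (hv.unitary_apply (U k))) (by positivity)
    _ = 2 * ‖x‖ * ‖a‖ := by
        rw [Finset.sum_const, Finset.card_univ, Fintype.card_fin, nsmul_eq_mul]
        push_cast
        ring

/-- The product `x a` of a trace-class operator and a bounded operator. -/
def L1.mulRight (x : L1 H) (a : H →L[ℂ] H) : L1 H :=
  ⟨x.op * a, 2 * ‖x‖ * ‖a‖, by rintro _ ⟨n, u, v, hu, hv, rfl⟩; exact x.sum_mul_le a hu hv⟩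

@[simp] lemma L1.op_mulRight (x : L1 H) (a : H →L[ℂ] H) : (x.mulRight a).op = x.op * a := rfl

lemma L1.norm_mulRight_le (x : L1 H) (a : H →L[ℂ] H) : ‖x.mulRight a‖ ≤ 2 * ‖x‖ * ‖a‖ :=
  L1.norm_le_of fun _ _ _ hu hv => x.sum_mul_le a hu hv

lemma L1.sum_star_le (x : L1 H) {n : ℕ} {u v : Fin n → H}
    (hu : Orthonormal ℂ u) (hv : Orthonormal ℂ v) :
    ∑ i, ‖⟪u i, star x.op (v i)⟫_ℂ‖ ≤ ‖x‖ := by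
  refine le_of_eq_of_le (Finset.sum_congr rfl fun i _ => ?_) (x.sum_le hv hu)
  rw [inner_star_apply, norm_inner_symm]

/-- The adjoint of a trace-class operator. -/
def L1.adj (x : L1 H) : L1 H :=
  ⟨star x.op, ‖x‖, by rintro _ ⟨n, u, v, hu, hv, rfl⟩; exact x.sum_star_le hu hv⟩

@[simp] lemma L1.op_adj (x : L1 H) : x.adj.op = star x.op := rfl

lemma L1.norm_adj_le (x : L1 H) : ‖x.adj‖ ≤ ‖x‖ :=
  L1.norm_le_of fun _ _ _ hu hv => x.sum_star_le hu hv

/-- The product `a x` of a bounded operator and a trace-class operator. -/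
def L1.mulLeft (a : H →L[ℂ] H) (x : L1 H) : L1 H := (x.adj.mulRight (star a)).adj

@[simp] lemma L1.op_mulLeft (a : H →L[ℂ] H) (x : L1 H) : (L1.mulLeft a x).op = a * x.op := by
  simp [L1.mulLeft]

lemma L1.norm_mulLeft_le (a : H →L[ℂ] H) (x : L1 H) : ‖L1.mulLeft a x‖ ≤ 2 * ‖x‖ * ‖a‖ := by
  refine (L1.norm_adj_le _).trans ((L1.norm_mulRight_le _ _).trans ?_)
  rw [norm_star]
  gcongr
  exact x.norm_adj_le

end TraceIdeal

/-! ### The trace -/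

section Trace

variable {H : Type*} [NormedAddCommGroup H] [InnerProductSpace ℂ H] [CompleteSpace H]
  (e : HilbertBasis ℤ ℂ H)

lemma L1.summable_trace (x : L1 H) : Summable fun n => ‖⟪e n, x.op (e n)⟫_ℂ‖ :=
  summable_of_sum_le (fun _ => norm_nonneg _) (x.sum_finset_le e.orthonormal e.orthonormal)

lemma L1.norm_opTrace_le (x : L1 H) : ‖opTrace e x.op‖ ≤ ‖x‖ :=
  (norm_tsum_le_tsum_norm (x.summable_trace e)).trans
    (Real.tsum_le_of_sum_le (fun _ => norm_nonneg _)
      (x.sum_finset_le e.orthonormal e.orthonormal))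

/-- The trace as a continuous linear functional on the trace-class operators. -/
def traceL : L1 H →L[ℝ] ℂ :=
  LinearMap.mkContinuous
    { toFun := fun x => opTrace e x.op
      map_add' := fun x y => by
        simp only [opTrace, map_add, add_apply, inner_add_right]
        exact (x.summable_trace e).of_norm.tsum_add (y.summable_trace e).of_norm
      map_smul' := fun c x => by
        have h (n : ℤ) : ⟪e n, (c • x).op (e n)⟫_ℂ = (c : ℂ) * ⟪e n, x.op (e n)⟫_ℂ := by
          rw [← inner_smul_right]
          rfl
        simp only [opTrace, h, tsum_mul_left, RingHom.id_apply]
        rfl } 1 fun x => by simpa using x.norm_opTrace_le e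

lemma opTrace_star (y : H →L[ℂ] H) : opTrace e (star y) = (starRingEnd ℂ) (opTrace e y) := by
  simp only [opTrace]
  rw [Complex.conj_tsum]
  exact tsum_congr fun n => by rw [inner_star_apply, inner_conj_symm]

/-- The squares of the matrix entries of a Hilbert–Schmidt operator are summable. -/
lemma hasSum_sq_entries {x : H →L[ℂ] H} (hx : x ∈ hilbertSchmidt e) :
    HasSum (fun p : ℤ × ℤ => ‖⟪e p.2, x (e p.1)⟫_ℂ‖ ^ 2) (∑' n, ‖x (e n)‖ ^ 2) := by
  have hs : Summable fun p : ℤ × ℤ => ‖⟪e p.2, x (e p.1)⟫_ℂ‖ ^ 2 := by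
    rw [summable_prod_of_nonneg (fun _ => by positivity)]
    refine ⟨fun n => (hasSum_sq_inner e (x (e n))).summable, ?_⟩
    have : (fun n => ∑' m, ‖⟪e m, x (e n)⟫_ℂ‖ ^ 2) = fun n => ‖x (e n)‖ ^ 2 :=
      funext fun n => (hasSum_sq_inner e (x (e n))).tsum_eq
    rw [this]
    exact hx
  have h := hs.hasSum
  rw [hs.tsum_prod' fun n => (hasSum_sq_inner e (x (e n))).summable] at h
  convert h using 1
  exact tsum_congr fun n => (hasSum_sq_inner e (x (e n))).tsum_eq.symm

lemma summable_entries_mul {x y : H →L[ℂ] H} (hx : x ∈ hilbertSchmidt e)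
    (hy : y ∈ hilbertSchmidt e) :
    Summable fun p : ℤ × ℤ => ⟪e p.1, x (e p.2)⟫_ℂ * ⟪e p.2, y (e p.1)⟫_ℂ := by
  refine Summable.of_norm (Summable.of_nonneg_of_le (fun _ => norm_nonneg _) (fun p => ?_)
    ((hasSum_sq_entries e hx).summable.prod_symm.add (hasSum_sq_entries e hy).summable))
  rw [norm_mul]
  simp only [Prod.fst_swap, Prod.snd_swap]
  nlinarith [sq_nonneg (‖⟪e p.1, x (e p.2)⟫_ℂ‖ - ‖⟪e p.2, y (e p.1)⟫_ℂ‖),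
    sq_nonneg (‖⟪e p.1, x (e p.2)⟫_ℂ‖ + ‖⟪e p.2, y (e p.1)⟫_ℂ‖)]

lemma hasSum_entries_mul (x y : H →L[ℂ] H) (m n : ℤ) :
    HasSum (fun k => ⟪e m, x (e k)⟫_ℂ * ⟪e k, y (e n)⟫_ℂ) ⟪e m, (x * y) (e n)⟫_ℂ := by
  have h := e.hasSum_inner_mul_inner (star x (e m)) (y (e n))
  simp only [inner_star_apply_left] at h
  exact h

lemma opTrace_mul_eq (x y : H →L[ℂ] H) :
    opTrace e (x * y) = ∑' n, ∑' k, ⟪e n, x (e k)⟫_ℂ * ⟪e k, y (e n)⟫_ℂ :=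
  tsum_congr fun n => (hasSum_entries_mul e x y n n).tsum_eq.symm

lemma opTrace_mul_comm_of_mem {x y : H →L[ℂ] H} (hx : x ∈ hilbertSchmidt e)
    (hy : y ∈ hilbertSchmidt e) : opTrace e (x * y) = opTrace e (y * x) := by
  have h : Summable (Function.uncurry fun n k : ℤ => ⟪e n, x (e k)⟫_ℂ * ⟪e k, y (e n)⟫_ℂ) :=
    summable_entries_mul e hx hy
  rw [opTrace_mul_eq, opTrace_mul_eq, ← h.tsum_comm]
  exact tsum_congr fun n => tsum_congr fun k => mul_comm _ _

lemma mem_hilbertSchmidt_of_sq {s : H →L[ℂ] H} (hs : IsSelfAdjoint s) {C : ℝ}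
    (hC : ∀ F : Finset ℤ, ∑ n ∈ F, ‖⟪e n, (s * s) (e n)⟫_ℂ‖ ≤ C) : s ∈ hilbertSchmidt e := by
  refine summable_of_sum_le (c := C) (fun n => by positivity) fun F => ?_
  refine le_of_eq_of_le (Finset.sum_congr rfl fun n _ => ?_) (hC F)
  have : ⟪e n, (s * s) (e n)⟫_ℂ = ⟪s (e n), s (e n)⟫_ℂ := by
    conv_lhs => rw [← hs.star_eq]
    change ⟪e n, star s (star s (e n))⟫_ℂ = _
    rw [inner_star_apply, hs.star_eq]
  rw [this, inner_self_eq_norm_sq_to_K]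
  simp

/-- The modulus of a self-adjoint trace-class operator has absolutely summable diagonal: `|x|` is
the norm limit, as `ε → 0`, of the operators `x · x (|x| + ε)⁻¹`, whose second factors are
contractions. -/
lemma L1.sum_cfc_abs_le {x : L1 H} (hx : IsSelfAdjoint x.op) (F : Finset ℤ) :
    ∑ n ∈ F, ‖⟪e n, cfc (fun t : ℝ => |t|) x.op (e n)⟫_ℂ‖ ≤ 2 * ‖x‖ := by
  have hbound (ε : ℝ) (hε : 0 < ε) :
      ‖x.op * cfc (fun t : ℝ => t / (|t| + ε)) x.op - cfc (fun t : ℝ => |t|) x.op‖ ≤ ε ∧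
      ‖cfc (fun t : ℝ => t / (|t| + ε)) x.op‖ ≤ 1 := by
    have hpos (t : ℝ) : 0 < |t| + ε := by positivity
    have hc : Continuous fun t : ℝ => t / (|t| + ε) :=
      continuous_id.div (by fun_prop) fun t => (hpos t).ne'
    constructor
    · have h1 : x.op * cfc (fun t : ℝ => t / (|t| + ε)) x.op - cfc (fun t : ℝ => |t|) x.op
          = cfc (fun t : ℝ => t * (t / (|t| + ε)) - |t|) x.op := by
        rw [cfc_sub (fun t : ℝ => t * (t / (|t| + ε))) (fun t : ℝ => |t|) x.op
          (continuous_id.mul hc).continuousOn (by fun_prop),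
          cfc_mul (fun t : ℝ => t) (fun t : ℝ => t / (|t| + ε)) x.op (by fun_prop) hc.continuousOn,
          cfc_id' ℝ x.op]
      rw [h1]
      refine norm_cfc_le hε.le fun t _ => ?_
      have h2 : t * (t / (|t| + ε)) - |t| = -(ε * (|t| / (|t| + ε))) := by
        have := (hpos t).ne'
        field_simp
        rw [← sq_abs t]
        ring
      rw [h2, norm_neg, norm_mul, Real.norm_of_nonneg hε.le, Real.norm_of_nonneg (by positivity)]
      exact mul_le_of_le_one_right hε.le ((div_le_one (hpos t)).2 (by linarith))
    · refine norm_cfc_le zero_le_one fun t _ => ?_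
      rw [norm_div, Real.norm_eq_abs, Real.norm_of_nonneg (hpos t).le]
      exact (div_le_one (hpos t)).2 (by linarith)
  refine le_of_forall_pos_le_add fun δ hδ => ?_
  set ε : ℝ := δ / (F.card + 1) with hεdef
  have hε : 0 < ε := by positivity
  obtain ⟨h1, h2⟩ := hbound ε hε
  set a := cfc (fun t : ℝ => t / (|t| + ε)) x.op
  set y := cfc (fun t : ℝ => |t|) x.op
  have h3 (n : ℤ) : ‖⟪e n, y (e n)⟫_ℂ‖ ≤ ‖⟪e n, (x.mulRight a).op (e n)⟫_ℂ‖ + ε := by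
    have h4 : ⟪e n, y (e n)⟫_ℂ
        = ⟪e n, (x.mulRight a).op (e n)⟫_ℂ - ⟪e n, (x.op * a - y) (e n)⟫_ℂ := by
      rw [L1.op_mulRight, sub_apply, inner_sub_right, sub_sub_cancel]
    rw [h4]
    refine (norm_sub_le _ _).trans (add_le_add_right ?_ _)
    refine (norm_inner_le_norm _ _).trans ?_
    rw [e.orthonormal.1, one_mul]
    refine ((x.op * a - y).le_opNorm _).trans ?_
    rwa [e.orthonormal.1, mul_one]
  calc _ ≤ ∑ n ∈ F, (‖⟪e n, (x.mulRight a).op (e n)⟫_ℂ‖ + ε) := Finset.sum_le_sum fun n _ => h3 n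
    _ = ∑ n ∈ F, ‖⟪e n, (x.mulRight a).op (e n)⟫_ℂ‖ + F.card * ε := by
        rw [Finset.sum_add_distrib, Finset.sum_const, nsmul_eq_mul]
    _ ≤ 2 * ‖x‖ + δ := by
        refine add_le_add ?_ ?_
        · refine ((x.mulRight a).sum_finset_le e.orthonormal e.orthonormal F).trans ?_
          refine (x.norm_mulRight_le a).trans ?_
          exact mul_le_of_le_one_right (mul_nonneg zero_le_two (norm_nonneg _)) h2
        · rw [hεdef, mul_div_assoc', div_le_iff₀ (by positivity)]
          nlinarith

/-- A self-adjoint trace-class operator `x` is the product of the Hilbert–Schmidt operators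
`sgn(x) |x|^{1/2}` and `|x|^{1/2}`. -/
lemma L1.exists_factorization {x : L1 H} (hx : IsSelfAdjoint x.op) :
    ∃ s ∈ hilbertSchmidt e, ∃ t ∈ hilbertSchmidt e, x.op = s * t := by
  let s₀ : ℝ → ℝ := fun t => √t - √(-t)
  let t₀ : ℝ → ℝ := fun t => √t + √(-t)
  have hs : Continuous s₀ := by fun_prop
  have ht : Continuous t₀ := by fun_prop
  have hst (t : ℝ) : s₀ t * t₀ t = t ∧ s₀ t * s₀ t = |t| ∧ t₀ t * t₀ t = |t| := by
    rcases le_total 0 t with h | h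
    · have h0 : √(-t) = 0 := Real.sqrt_eq_zero_of_nonpos (by linarith)
      simp [s₀, t₀, h0, Real.mul_self_sqrt h, abs_of_nonneg h]
    · have h0 : √t = 0 := Real.sqrt_eq_zero_of_nonpos h
      simp [s₀, t₀, h0, Real.mul_self_sqrt (neg_nonneg.2 h), abs_of_nonpos h]
  have hsq (f : ℝ → ℝ) (hf : Continuous f) (hff : ∀ t, f t * f t = |t|) :
      cfc f x.op ∈ hilbertSchmidt e := by
    refine mem_hilbertSchmidt_of_sq e (C := 2 * ‖x‖) (cfc_predicate f x.op) fun F => ?_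
    rw [← cfc_mul f f x.op hf.continuousOn hf.continuousOn]
    simp only [hff]
    exact x.sum_cfc_abs_le e hx F
  refine ⟨_, hsq s₀ hs fun t => (hst t).2.1, _, hsq t₀ ht fun t => (hst t).2.2, ?_⟩
  rw [← cfc_mul s₀ t₀ x.op hs.continuousOn ht.continuousOn]
  simp only [(hst _).1]
  exact (cfc_id' ℝ x.op).symm

lemma L1.opTrace_mul_comm_of_isSelfAdjoint {x : L1 H} (hx : IsSelfAdjoint x.op) (a : H →L[ℂ] H) :
    opTrace e (x.op * a) = opTrace e (a * x.op) := by
  obtain ⟨s, hs, t, ht, h⟩ := x.exists_factorization e hx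
  rw [h, mul_assoc, opTrace_mul_comm_of_mem e hs (mul_right_mem_hilbertSchmidt e ht a), mul_assoc,
    opTrace_mul_comm_of_mem e ht (mul_left_mem_hilbertSchmidt e a hs), mul_assoc]

lemma opTrace_smul (c : ℂ) (y : H →L[ℂ] H) : opTrace e (c • y) = c * opTrace e y := by
  simp only [opTrace, ← tsum_mul_left]
  exact tsum_congr fun n => by rw [← inner_smul_right]; rfl

/-- `Tr (x a) = Tr (a x)` for `x` trace-class and `a` bounded. -/
lemma L1.opTrace_mul_comm (x : L1 H) (a : H →L[ℂ] H) :
    opTrace e (x.op * a) = opTrace e (a * x.op) := by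
  -- `x` is half the sum of `x + x*` and `x - x*`, and `i (x - x*)` is self-adjoint as well
  have hadd (y z : L1 H) : opTrace e (y.op + z.op) = opTrace e y.op + opTrace e z.op :=
    map_add (traceL e) y z
  have hsub (y z : L1 H) : opTrace e (y.op - z.op) = opTrace e y.op - opTrace e z.op :=
    map_sub (traceL e) y z
  let y : L1 H := L1.mulLeft (Complex.I • (1 : H →L[ℂ] H)) (x - x.adj)
  have hy : y.op = Complex.I • (x.op - star x.op) := by simp [y]
  have h1 := L1.opTrace_mul_comm_of_isSelfAdjoint e (x := x + x.adj)
    (by simp [IsSelfAdjoint, add_comm]) a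
  have h2 := L1.opTrace_mul_comm_of_isSelfAdjoint e (x := y)
    (by rw [hy]; simp [IsSelfAdjoint, ← smul_neg]) a
  rw [hy, smul_mul_assoc, mul_smul_comm, opTrace_smul, opTrace_smul] at h2
  have h3 := mul_left_cancel₀ Complex.I_ne_zero h2
  rw [map_add, L1.op_adj, add_mul, mul_add] at h1
  rw [sub_mul, mul_sub] at h3
  have e1 := hadd (x.mulRight a) (x.adj.mulRight a)
  have e2 := hadd (L1.mulLeft a x) (L1.mulLeft a x.adj)
  have e3 := hsub (x.mulRight a) (x.adj.mulRight a)
  have e4 := hsub (L1.mulLeft a x) (L1.mulLeft a x.adj)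
  simp only [L1.op_mulRight, L1.op_mulLeft, L1.op_adj] at e1 e2 e3 e4
  rw [e1, e2] at h1
  rw [e3, e4] at h3
  linear_combination (1 / 2 : ℂ) * h1 + (1 / 2 : ℂ) * h3

end Trace

/-! ### The normed space of Hilbert–Schmidt operators -/

section HSNorm

variable {H : Type*} [NormedAddCommGroup H] [InnerProductSpace ℂ H] [CompleteSpace H]
  (e : HilbertBasis ℤ ℂ H)

/-- The space `L₂(H)` of Hilbert–Schmidt operators, with the Hilbert–Schmidt norm (the submodule
`hilbertSchmidt e` carries the operator norm). -/
def HS : Type _ := hilbertSchmidt e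

instance : AddCommGroup (HS e) := inferInstanceAs (AddCommGroup (hilbertSchmidt e))

instance : Module ℝ (HS e) := inferInstanceAs (Module ℝ (hilbertSchmidt e))

variable {e}

/-- The bounded operator underlying a Hilbert–Schmidt operator. -/
def HS.op : HS e →ₗ[ℝ] (H →L[ℂ] H) := (hilbertSchmidt e).subtype

lemma HS.op_mem (x : HS e) : x.op ∈ hilbertSchmidt e := x.2

lemma HS.op_injective : Function.Injective (HS.op (e := e)) := Subtype.val_injective

variable (e) in
/-- The sequence of columns `x |n⟩` of a Hilbert–Schmidt operator. -/
def HS.columns : HS e →ₗ[ℝ] lp (fun _ : ℤ => H) 2 where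
  toFun x := ⟨fun n => x.op (e n), by
    change Memℓp (fun n => x.op (e n)) 2
    rw [memℓp_gen_iff (by norm_num)]
    simpa using! x.op_mem⟩
  map_add' x y := by
    ext n
    simp only [map_add]
    rfl
  map_smul' c x := by
    ext n
    simp only [map_smul]
    rfl

lemma HS.columns_injective : Function.Injective (HS.columns e) := by
  intro x y h
  apply HS.op_injective
  refine op_ext e fun m n => ?_
  have : x.op (e n) = y.op (e n) := congrFun (congrArg Subtype.val h) n
  rw [this]

instance : NormedAddCommGroup (HS e) :=
  NormedAddCommGroup.induced (HS e) (lp (fun _ : ℤ => H) 2) (HS.columns e) HS.columns_injective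

instance : NormedSpace ℝ (HS e) := NormedSpace.induced ℝ (HS e) (lp (fun _ : ℤ => H) 2) (HS.columns e)

lemma HS.norm_sq (x : HS e) : ‖x‖ ^ 2 = ∑' n, ‖x.op (e n)‖ ^ 2 := by
  have h := lp.norm_rpow_eq_tsum (p := 2) (by norm_num) (HS.columns e x)
  simp only [ENNReal.toReal_ofNat, Real.rpow_ofNat] at h
  exact h

lemma HS.hasSum_columns (x : HS e) : HasSum (fun n => ‖x.op (e n)‖ ^ 2) (‖x‖ ^ 2) := by
  have h : Summable fun n => ‖x.op (e n)‖ ^ 2 := x.op_mem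
  rw [HS.norm_sq]
  exact h.hasSum

lemma HS.hasSum_entries (x : HS e) :
    HasSum (fun p : ℤ × ℤ => ‖⟪e p.2, x.op (e p.1)⟫_ℂ‖ ^ 2) (‖x‖ ^ 2) := by
  rw [HS.norm_sq]
  exact hasSum_sq_entries e x.op_mem

/-- The adjoint of a Hilbert–Schmidt operator. -/
def HS.adj (x : HS e) : HS e := ⟨star x.op, star_mem_hilbertSchmidt e x.op_mem⟩

@[simp] lemma HS.op_adj (x : HS e) : x.adj.op = star x.op := rfl

lemma HS.norm_adj (x : HS e) : ‖x.adj‖ = ‖x‖ := by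
  have h1 := x.adj.hasSum_entries
  have h2 := (Equiv.prodComm ℤ ℤ).hasSum_iff.2 x.hasSum_entries
  have h3 : ((fun p : ℤ × ℤ => ‖⟪e p.2, x.op (e p.1)⟫_ℂ‖ ^ 2) ∘ Equiv.prodComm ℤ ℤ)
      = fun p : ℤ × ℤ => ‖⟪e p.2, x.adj.op (e p.1)⟫_ℂ‖ ^ 2 := by
    ext p
    simp only [Function.comp, Equiv.prodComm_apply, Prod.fst_swap, Prod.snd_swap, HS.op_adj]
    rw [inner_star_apply, norm_inner_symm]
  rw [h3] at h2
  exact (sq_eq_sq₀ (norm_nonneg _) (norm_nonneg _)).1 (h1.unique h2)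

/-- Bessel's inequality for Hilbert–Schmidt operators. -/
lemma HS.sum_norm_sq_le (x : HS e) {n : ℕ} {v : Fin n → H} (hv : Orthonormal ℂ v) :
    ∑ i, ‖x.op (v i)‖ ^ 2 ≤ ‖x‖ ^ 2 := by
  have h (i : Fin n) : HasSum (fun k => ‖⟪v i, star x.op (e k)⟫_ℂ‖ ^ 2) (‖x.op (v i)‖ ^ 2) := by
    convert hasSum_sq_inner e (x.op (v i)) using 2 with k
    rw [inner_star_apply, norm_inner_symm]
  have h2 := x.adj.hasSum_columns
  rw [HS.norm_adj] at h2
  exact hasSum_le (fun k => hv.sum_inner_products_le (star x.op (e k))) (hasSum_sum fun i _ => h i) h2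

lemma HS.norm_apply_sq_le (x : HS e) {v : H} (hv : ‖v‖ = 1) : ‖x.op v‖ ^ 2 ≤ ‖x‖ ^ 2 := by
  have h := x.sum_norm_sq_le (n := 1) (v := fun _ => v)
    ⟨fun _ => hv, fun i j hij => (hij (Subsingleton.elim i j)).elim⟩
  simpa using h

lemma HS.op_norm_le (x : HS e) : ‖x.op‖ ≤ ‖x‖ := by
  refine ContinuousLinearMap.opNorm_le_of_unit_norm (𝕜 := ℂ) (norm_nonneg x) fun v hv => ?_
  exact (sq_le_sq₀ (norm_nonneg _) (norm_nonneg _)).1 (x.norm_apply_sq_le hv)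

variable (e) in
/-- The inclusion of the Hilbert–Schmidt operators into the bounded operators. -/
def HS.opL : HS e →L[ℝ] (H →L[ℂ] H) :=
  LinearMap.mkContinuous HS.op 1 fun x => by simpa using x.op_norm_le

/-- The product `a x` of a bounded operator and a Hilbert–Schmidt operator. -/
def HS.lmul (a : H →L[ℂ] H) (x : HS e) : HS e :=
  ⟨a * x.op, mul_left_mem_hilbertSchmidt e a x.op_mem⟩

/-- The product `x a` of a Hilbert–Schmidt operator and a bounded operator. -/
def HS.rmul (a : H →L[ℂ] H) (x : HS e) : HS e :=
  ⟨x.op * a, mul_right_mem_hilbertSchmidt e x.op_mem a⟩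

@[simp] lemma HS.op_lmul (a : H →L[ℂ] H) (x : HS e) : (HS.lmul a x).op = a * x.op := rfl

@[simp] lemma HS.op_rmul (a : H →L[ℂ] H) (x : HS e) : (HS.rmul a x).op = x.op * a := rfl

lemma HS.norm_lmul_le (a : H →L[ℂ] H) (x : HS e) : ‖HS.lmul a x‖ ≤ ‖a‖ * ‖x‖ := by
  rw [← sq_le_sq₀ (norm_nonneg _) (by positivity), mul_pow]
  refine hasSum_le (fun n => ?_) (HS.lmul a x).hasSum_columns (x.hasSum_columns.mul_left (‖a‖ ^ 2))
  rw [← mul_pow]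
  exact pow_le_pow_left₀ (norm_nonneg _) (a.le_opNorm _) 2

lemma HS.norm_rmul_le (a : H →L[ℂ] H) (x : HS e) : ‖HS.rmul a x‖ ≤ ‖a‖ * ‖x‖ := by
  have h : HS.rmul a x = (HS.lmul (star a) x.adj).adj := HS.op_injective (by simp)
  rw [h, HS.norm_adj]
  refine (HS.norm_lmul_le _ _).trans ?_
  rw [norm_star, HS.norm_adj]

variable (e) in
/-- Left multiplication as a continuous bilinear map. -/
def HS.lmulL : (H →L[ℂ] H) →L[ℝ] HS e →L[ℝ] HS e :=
  LinearMap.mkContinuous₂ (LinearMap.mk₂ ℝ HS.lmul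
    (fun a b x => HS.op_injective (by simp [add_mul]))
    (fun c a x => HS.op_injective (by simp))
    (fun a x y => HS.op_injective (by simp [mul_add]))
    (fun c a x => HS.op_injective (by simp))) 1
    fun a x => by simpa using HS.norm_lmul_le a x

variable (e) in
/-- Right multiplication as a continuous bilinear map. -/
def HS.rmulL : (H →L[ℂ] H) →L[ℝ] HS e →L[ℝ] HS e :=
  LinearMap.mkContinuous₂ (LinearMap.mk₂ ℝ HS.rmul
    (fun a b x => HS.op_injective (by simp [mul_add]))
    (fun c a x => HS.op_injective (by simp))
    (fun a x y => HS.op_injective (by simp [add_mul]))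
    (fun c a x => HS.op_injective (by simp))) 1
    fun a x => by simpa using HS.norm_rmul_le a x

@[simp] lemma HS.lmulL_apply (a : H →L[ℂ] H) (x : HS e) : HS.lmulL e a x = HS.lmul a x := rfl

@[simp] lemma HS.rmulL_apply (a : H →L[ℂ] H) (x : HS e) : HS.rmulL e a x = HS.rmul a x := rfl

lemma HS.sum_mul_le (x y : HS e) {n : ℕ} {u v : Fin n → H}
    (hu : Orthonormal ℂ u) (hv : Orthonormal ℂ v) :
    ∑ i, ‖⟪u i, (x.op * y.op) (v i)⟫_ℂ‖ ≤ ‖x‖ * ‖y‖ := by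
  calc _ ≤ ∑ i, ‖x.adj.op (u i)‖ * ‖y.op (v i)‖ := by
        refine Finset.sum_le_sum fun i _ => ?_
        change ‖⟪u i, x.op (y.op (v i))⟫_ℂ‖ ≤ _
        rw [← inner_star_apply_left]
        exact norm_inner_le_norm _ _
    _ ≤ √(∑ i, ‖x.adj.op (u i)‖ ^ 2) * √(∑ i, ‖y.op (v i)‖ ^ 2) :=
        Real.sum_mul_le_sqrt_mul_sqrt _ _ _
    _ ≤ ‖x‖ * ‖y‖ := by
        gcongr
        · rw [← x.norm_adj]
          exact (Real.sqrt_le_left (norm_nonneg _)).2 (x.adj.sum_norm_sq_le hu)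
        · exact (Real.sqrt_le_left (norm_nonneg _)).2 (y.sum_norm_sq_le hv)

/-- The product of two Hilbert–Schmidt operators, as a trace-class operator. -/
def HS.mul (x y : HS e) : L1 H :=
  ⟨x.op * y.op, ‖x‖ * ‖y‖, by rintro _ ⟨n, u, v, hu, hv, rfl⟩; exact x.sum_mul_le y hu hv⟩

@[simp] lemma HS.op_mul (x y : HS e) : (x.mul y).op = x.op * y.op := rfl

lemma HS.norm_mul_le (x y : HS e) : ‖x.mul y‖ ≤ ‖x‖ * ‖y‖ :=
  L1.norm_le_of fun _ _ _ hu hv => x.sum_mul_le y hu hv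

variable (e) in
/-- The product `L₂(H) × L₂(H) → L₁(H)` as a continuous bilinear map. -/
def HS.mulL : HS e →L[ℝ] HS e →L[ℝ] L1 H :=
  LinearMap.mkContinuous₂ (LinearMap.mk₂ ℝ HS.mul
    (fun a b x => L1.op_injective (by simp [add_mul]))
    (fun c a x => L1.op_injective (by simp))
    (fun a x y => L1.op_injective (by simp [mul_add]))
    (fun c a x => L1.op_injective (by simp))) 1
    fun a x => by simpa using HS.norm_mul_le a x

variable (e) in
/-- The inclusion `L₁(H) → L₂(H)`; it is continuous because
`‖x‖₂² = Tr (x* x) ≤ ‖x* x‖₁ ≤ 2 ‖x‖ ‖x‖₁`. -/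
def HS.ofL1 : L1 H →L[ℝ] HS e :=
  LinearMap.mkContinuous
    (Submodule.inclusion (traceClass_le_hilbertSchmidt e) : traceClass H →ₗ[ℝ] hilbertSchmidt e) 2
    fun x => by
      set y : HS e := (Submodule.inclusion (traceClass_le_hilbertSchmidt e) x : hilbertSchmidt e)
      change ‖y‖ ≤ 2 * ‖x‖
      have hy : y.op = x.op := rfl
      have h1 : ‖y‖ ^ 2 ≤ (2 * ‖x‖) ^ 2 := by
        rw [HS.norm_sq]
        refine (Real.tsum_le_of_sum_le (fun n => by positivity) fun F => ?_).trans
          (?_ : ‖L1.mulLeft (star x.op) x‖ ≤ _)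
        · refine le_of_eq_of_le (Finset.sum_congr rfl fun n _ => ?_)
            ((L1.mulLeft (star x.op) x).sum_finset_le e.orthonormal e.orthonormal F)
          rw [L1.op_mulLeft, hy]
          change _ = ‖⟪e n, star x.op (x.op (e n))⟫_ℂ‖
          rw [inner_star_apply, inner_self_eq_norm_sq_to_K]
          simp
        · refine (L1.norm_mulLeft_le _ _).trans ?_
          rw [norm_star]
          nlinarith [x.op_norm_le, norm_nonneg x, norm_nonneg x.op]
      exact (sq_le_sq₀ (norm_nonneg _) (by positivity)).1 h1

@[simp] lemma HS.op_ofL1 (x : L1 H) : (HS.ofL1 e x).op = x.op := rfl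

end HSNorm

/-! ### The projections of `L₂ = 𝔲₂ ⊕ 𝔟₂⁺` -/

section Projections

variable {H : Type*} [NormedAddCommGroup H] [InnerProductSpace ℂ H] [CompleteSpace H]
  {e : HilbertBasis ℤ ℂ H}

/-- The Hilbert–Schmidt operator `x` is skew-hermitian. -/
def HS.IsSkew (x : HS e) : Prop := star x.op = -x.op

/-- The Hilbert–Schmidt operator `x` is triangular with real diagonal, i.e. lies in `𝔟₂⁺(H)`. -/
def HS.IsTri (x : HS e) : Prop :=
  (∀ m n, m < n → ⟪e m, x.op (e n)⟫_ℂ = 0) ∧ ∀ n, (⟪e n, x.op (e n)⟫_ℂ).im = 0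

lemma HS.IsSkew.neg_inner {x : HS e} (hx : x.IsSkew) (m n : ℤ) :
    ⟪e m, x.op (e n)⟫_ℂ = -(starRingEnd ℂ) ⟪e n, x.op (e m)⟫_ℂ := by
  rw [inner_conj_symm, ← inner_star_apply, hx]
  simp

lemma HS.isSkew_projU2 (x : HS e) : HS.IsSkew (e := e) (projU2 e x) :=
  Submodule.projection_apply_mem (isCompl_u2_b2 e) x

lemma HS.isTri_projB2 (x : HS e) : HS.IsTri (e := e) (projB2 e x) :=
  Submodule.projection_apply_mem (isCompl_u2_b2 e).symm x

variable (e) in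
/-- The projection `p_{𝔟₂⁺}` on the normed space of Hilbert–Schmidt operators. -/
def HS.pbLinear : HS e →ₗ[ℝ] HS e := projB2 e

lemma HS.norm_pbLinear_le (x : HS e) : ‖HS.pbLinear e x‖ ≤ 2 * ‖x‖ := by
  set y : HS e := HS.pbLinear e x with hy
  have hyt : y.IsTri := HS.isTri_projB2 x
  have hu : (x - y).IsSkew := by
    have h : x - y = (projU2 e x : HS e) :=
      (Submodule.projection_eq_self_sub_projection (isCompl_u2_b2 e).symm x).symm
    rw [h]
    exact HS.isSkew_projU2 x
  have key (m n : ℤ) : ‖⟪e m, y.op (e n)⟫_ℂ‖ ≤ ‖⟪e m, x.op (e n)⟫_ℂ‖ + ‖⟪e n, x.op (e m)⟫_ℂ‖ := by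
    have h1 := hu.neg_inner m n
    rw [map_sub, sub_apply, sub_apply, inner_sub_right, inner_sub_right, map_sub] at h1
    rcases lt_trichotomy m n with h | h | h
    · rw [hyt.1 m n h, norm_zero]
      positivity
    · subst h
      have h2 := congrArg Complex.re h1
      simp only [Complex.neg_re, Complex.sub_re, Complex.conj_re] at h2
      have h3 : ⟪e m, y.op (e m)⟫_ℂ = ((⟪e m, x.op (e m)⟫_ℂ).re : ℂ) :=
        Complex.ext (by rw [Complex.ofReal_re]; linarith) (by rw [Complex.ofReal_im, hyt.2])
      rw [h3, Complex.norm_real]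
      have := Complex.abs_re_le_norm ⟪e m, x.op (e m)⟫_ℂ
      rw [Real.norm_eq_abs]
      linarith [norm_nonneg ⟪e m, x.op (e m)⟫_ℂ]
    · rw [hyt.1 n m h, map_zero, sub_zero] at h1
      have h2 : ⟪e m, y.op (e n)⟫_ℂ = ⟪e m, x.op (e n)⟫_ℂ + (starRingEnd ℂ) ⟪e n, x.op (e m)⟫_ℂ := by
        linear_combination -h1
      rw [h2]
      refine (norm_add_le _ _).trans_eq ?_
      rw [RCLike.norm_conj]
  rw [← sq_le_sq₀ (norm_nonneg _) (by positivity)]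
  have h2 := ((Equiv.prodComm ℤ ℤ).hasSum_iff.2 x.hasSum_entries).add x.hasSum_entries
  refine (hasSum_le (fun p => ?_) y.hasSum_entries (h2.mul_left 2)).trans_eq
    (by ring : 2 * (‖x‖ ^ 2 + ‖x‖ ^ 2) = (2 * ‖x‖) ^ 2)
  simp only [Function.comp, Equiv.prodComm_apply, Prod.fst_swap, Prod.snd_swap]
  have h3 := key p.2 p.1
  have h4 := pow_le_pow_left₀ (norm_nonneg _) h3 2
  nlinarith [sq_nonneg (‖⟪e p.2, x.op (e p.1)⟫_ℂ‖ - ‖⟪e p.1, x.op (e p.2)⟫_ℂ‖)]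

variable (e) in
/-- The projection of `L₂(H)` onto `𝔟₂⁺(H)`, continuous for the Hilbert–Schmidt norm. -/
def HS.pb : HS e →L[ℝ] HS e :=
  LinearMap.mkContinuous (HS.pbLinear e) 2 HS.norm_pbLinear_le

variable (e) in
/-- The projection of `L₂(H)` onto `𝔲₂(H)`, continuous for the Hilbert–Schmidt norm. -/
def HS.pu : HS e →L[ℝ] HS e := ContinuousLinearMap.id ℝ (HS e) - HS.pb e

lemma HS.pu_eq (x : HS e) : HS.pu e x = projU2 e x :=
  (Submodule.projection_eq_self_sub_projection (isCompl_u2_b2 e).symm x).symm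

lemma HS.isTri_pb (x : HS e) : (HS.pb e x).IsTri := HS.isTri_projB2 x

lemma HS.isSkew_pu (x : HS e) : (HS.pu e x).IsSkew := by
  rw [HS.pu_eq]
  exact HS.isSkew_projU2 x

lemma HS.pu_add_pb (x : HS e) : HS.pu e x + HS.pb e x = x := sub_add_cancel _ _

lemma HS.IsSkew.pb_eq_zero {x : HS e} (hx : x.IsSkew) : HS.pb e x = 0 :=
  (Submodule.projection_apply_eq_zero_iff (isCompl_u2_b2 e).symm).2 hx

lemma HS.IsSkew.pu_eq {x : HS e} (hx : x.IsSkew) : HS.pu e x = x := by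
  have h := HS.pu_add_pb x
  rwa [hx.pb_eq_zero, add_zero] at h

end Projections

/-! ### The form `Im Tr (x y)` and the triple product `Im Tr ([x, y] z)` -/

section TraceForm

variable {H : Type*} [NormedAddCommGroup H] [InnerProductSpace ℂ H] [CompleteSpace H]
  {e : HilbertBasis ℤ ℂ H}

variable (e) in
/-- The bilinear form `Im Tr (x y)` on the Hilbert–Schmidt operators. -/
def HS.form : HS e →L[ℝ] HS e →L[ℝ] ℝ :=
  (ContinuousLinearMap.compL ℝ (HS e) (L1 H) ℝ (Complex.imCLM.comp (traceL e))).comp (HS.mulL e)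

lemma HS.form_apply (x y : HS e) : HS.form e x y = (opTrace e (x.op * y.op)).im := rfl

lemma HS.form_comm (x y : HS e) : HS.form e x y = HS.form e y x := by
  rw [HS.form_apply, opTrace_mul_comm_of_mem e x.op_mem y.op_mem, HS.form_apply]

lemma HS.IsSkew.form_eq_zero {x y : HS e} (hx : x.IsSkew) (hy : y.IsSkew) : HS.form e x y = 0 := by
  have h : star (x.op * y.op) = y.op * x.op := by
    rw [star_mul, show star x.op = _ from hx, show star y.op = _ from hy, neg_mul_neg]
  have h2 := opTrace_star e (x.op * y.op)
  rw [h, ← opTrace_mul_comm_of_mem e x.op_mem y.op_mem] at h2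
  exact Complex.conj_eq_iff_im.1 h2.symm

/-- The entries of a product of triangular operators: at most one summand of
`∑ₖ ⟨m|x|k⟩⟨k|y|n⟩` is nonzero for `m ≤ n`. -/
lemma HS.IsTri.inner_mul {x y : HS e} (hx : x.IsTri) (hy : y.IsTri) {m n : ℤ} (hmn : m ≤ n) :
    ⟪e m, (x.op * y.op) (e n)⟫_ℂ = ⟪e m, x.op (e n)⟫_ℂ * ⟪e n, y.op (e n)⟫_ℂ := by
  refine (hasSum_entries_mul e x.op y.op m n).unique (hasSum_single n fun k hk => ?_)
  rcases lt_or_gt_of_ne hk with h | h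
  · rw [hy.1 k n h, mul_zero]
  · rw [hx.1 m k (hmn.trans_lt h), zero_mul]

lemma HS.IsTri.form_eq_zero {x y : HS e} (hx : x.IsTri) (hy : y.IsTri) : HS.form e x y = 0 := by
  have h (n : ℤ) : (⟪e n, (x.op * y.op) (e n)⟫_ℂ).im = 0 := by
    rw [hx.inner_mul hy le_rfl, Complex.mul_im, hx.2, hy.2, mul_zero, zero_mul, add_zero]
  rw [HS.form_apply, ← HS.op_mul, opTrace,
    Complex.im_tsum ((x.mul y).summable_trace e).of_norm]
  simp only [HS.op_mul, h, tsum_zero]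

lemma HS.form_pu_right (x y : HS e) : HS.form e x (HS.pu e y) = HS.form e (HS.pb e x) y := by
  conv_lhs => rw [← HS.pu_add_pb x]
  conv_rhs => rw [← HS.pu_add_pb y]
  rw [map_add, add_apply, map_add, (HS.isSkew_pu x).form_eq_zero (HS.isSkew_pu y),
    (HS.isTri_pb x).form_eq_zero (HS.isTri_pb y), zero_add, add_zero]

/-- The commutator `x y - y x` of Hilbert–Schmidt operators, as a Hilbert–Schmidt operator. -/
def HS.bracket (x y : HS e) : HS e := HS.lmul x.op y - HS.rmul x.op y

@[simp] lemma HS.op_bracket (x y : HS e) : (x.bracket y).op = x.op * y.op - y.op * x.op := by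
  simp [HS.bracket]

lemma HS.IsSkew.bracket {x y : HS e} (hx : x.IsSkew) (hy : y.IsSkew) : (x.bracket y).IsSkew := by
  change star (x.bracket y).op = -(x.bracket y).op
  rw [HS.op_bracket, star_sub, star_mul, star_mul, show star x.op = _ from hx,
    show star y.op = _ from hy]
  noncomm_ring

lemma HS.IsTri.bracket {x y : HS e} (hx : x.IsTri) (hy : y.IsTri) : (x.bracket y).IsTri := by
  refine ⟨fun m n h => ?_, fun n => ?_⟩
  · rw [HS.op_bracket, sub_apply, inner_sub_right, hx.inner_mul hy h.le, hy.inner_mul hx h.le,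
      hx.1 m n h, hy.1 m n h]
    simp
  · rw [HS.op_bracket, sub_apply, inner_sub_right, hx.inner_mul hy le_rfl, hy.inner_mul hx le_rfl,
      mul_comm, sub_self, Complex.zero_im]

lemma HS.form_bracket_apply (x y z : HS e) : HS.form e (x.bracket y) z =
    (opTrace e (x.op * y.op * z.op)).im - (opTrace e (y.op * x.op * z.op)).im := by
  have h (a b : L1 H) : opTrace e (a.op - b.op) = opTrace e a.op - opTrace e b.op :=
    map_sub (traceL e) a b
  rw [HS.form_apply, HS.op_bracket, sub_mul, ← Complex.sub_im]
  exact congrArg Complex.im (h ((x.mul y).mulRight z.op) ((y.mul x).mulRight z.op))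

lemma HS.opTrace_mul_cycle (x y z : HS e) :
    opTrace e (x.op * y.op * z.op) = opTrace e (y.op * z.op * x.op) := by
  rw [mul_assoc]
  exact opTrace_mul_comm_of_mem e x.op_mem (HS.lmul y.op z).op_mem

lemma HS.form_bracket_cycle (x y z : HS e) :
    HS.form e (x.bracket y) z = HS.form e (y.bracket z) x := by
  rw [HS.form_bracket_apply, HS.form_bracket_apply, HS.opTrace_mul_cycle x y z,
    HS.opTrace_mul_cycle z y x]

lemma HS.add_bracket (x x' y : HS e) : (x + x').bracket y = x.bracket y + x'.bracket y :=
  HS.op_injective (by simp only [map_add, HS.op_bracket]; noncomm_ring)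

lemma HS.bracket_add (x y y' : HS e) : x.bracket (y + y') = x.bracket y + x.bracket y' :=
  HS.op_injective (by simp only [map_add, HS.op_bracket]; noncomm_ring)

/-- If the triple product of `x`, `y`, `z` vanishes, then the triple products with one argument
replaced by its `𝔲₂`-part and those with two arguments replaced have the same sum: expand, and use
that the triple product also vanishes on the three `𝔲₂`-parts and on the three `𝔟₂⁺`-parts. -/
lemma HS.sum_form_bracket_pu {x y z : HS e} (h : HS.form e (x.bracket y) z = 0) :
    HS.form e (y.bracket z) (HS.pu e x) + HS.form e (z.bracket x) (HS.pu e y) +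
        HS.form e (x.bracket y) (HS.pu e z) =
      HS.form e ((HS.pu e x).bracket y) (HS.pu e z) + HS.form e ((HS.pu e y).bracket z) (HS.pu e x) +
        HS.form e ((HS.pu e z).bracket x) (HS.pu e y) := by
  have hu : HS.form e ((HS.pu e x).bracket (HS.pu e y)) (HS.pu e z) = 0 :=
    ((HS.isSkew_pu x).bracket (HS.isSkew_pu y)).form_eq_zero (HS.isSkew_pu z)
  have hb : HS.form e ((HS.pb e x).bracket (HS.pb e y)) (HS.pb e z) = 0 :=
    ((HS.isTri_pb x).bracket (HS.isTri_pb y)).form_eq_zero (HS.isTri_pb z)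
  have hx := HS.pu_add_pb x
  have hy := HS.pu_add_pb y
  have hz := HS.pu_add_pb z
  set a := HS.pu e x
  set b := HS.pu e y
  set c := HS.pu e z
  set a' := HS.pb e x
  set b' := HS.pb e y
  set c' := HS.pb e z
  rw [HS.form_bracket_cycle y z a, HS.form_bracket_cycle z a y, HS.form_bracket_cycle z x b,
    HS.form_bracket_cycle b z a, HS.form_bracket_cycle z a b, HS.form_bracket_cycle c x b]
  rw [← hx, ← hy, ← hz] at h ⊢
  simp only [HS.add_bracket, HS.bracket_add, map_add, add_apply] at h ⊢
  linear_combination h - hb - hu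

end TraceForm

/-! ### The adjoint action and the pairing of `L₁ / 𝔲₁` with `𝔲` -/

section AdjointAction

variable {A : Type*} [CStarAlgebra A]

lemma Unitary.star_mul_cancel_left (g : unitary A) (x : A) : star (g : A) * ((g : A) * x) = x := by
  rw [← mul_assoc, Unitary.star_mul_self_of_mem g.2, one_mul]

lemma Unitary.mul_star_cancel_left (g : unitary A) (x : A) : (g : A) * (star (g : A) * x) = x := by
  rw [← mul_assoc, Unitary.mul_star_self_of_mem g.2, one_mul]

lemma star_conj_skew (a : A) {x : A} (hx : star x = -x) :
    star (a * x * star a) = -(a * x * star a) := by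
  rw [star_mul, star_mul, star_star, hx]
  noncomm_ring

/-- The map `v ↦ a v a*` on skew-adjoint elements, for an arbitrary element `a` of the algebra. For
unitary `a` this is the adjoint action. -/
def skewAd (a : A) : SkewAdj A →L[ℝ] SkewAdj A :=
  (skewPart A).comp
    (((ContinuousLinearMap.mul ℝ A).flip (star a)).comp ((ContinuousLinearMap.mul ℝ A a).comp SkewAdj.val))

lemma coe_skewAd (a : A) (v : SkewAdj A) : (skewAd a v : A) = a * v * star a :=
  skewPart_coe_of_star (star_conj_skew a v.star_coe)

end AdjointAction

section Pairing

variable {H : Type*} [NormedAddCommGroup H] [InnerProductSpace ℂ H] [CompleteSpace H]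
  (e : HilbertBasis ℤ ℂ H)

/-- The quotient map `L₁(H) → L₁(H) / 𝔲₁(H)` as a continuous linear map. -/
def L1.clsL : L1 H →L[ℝ] L1ModU1 H := (u1 H).mkQL

lemma L1ModU1.exists_rep (ξ : L1ModU1 H) : ∃ x : L1 H, x.cls = ξ := (u1 H).mkQ_surjective ξ

lemma L1.cls_eq_zero {x : L1 H} (hx : star x.op = -x.op) : x.cls = 0 :=
  (Submodule.Quotient.mk_eq_zero (u1 H)).2 hx

/-- A continuous linear map on `L₁(H)` vanishing on `𝔲₁(H)` descends to the quotient. -/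
def L1ModU1.lift {V : Type*} [NormedAddCommGroup V] [NormedSpace ℝ V] (f : L1 H →L[ℝ] V)
    (hf : ∀ x : L1 H, star x.op = -x.op → f x = 0) : L1ModU1 H →L[ℝ] V :=
  (u1 H).liftQL f fun x hx => hf x hx

/-- The product `(x, a) ↦ x a` of trace-class and bounded operators as a continuous bilinear map. -/
def L1.mulRightL : L1 H →L[ℝ] (H →L[ℂ] H) →L[ℝ] L1 H :=
  LinearMap.mkContinuous₂ (LinearMap.mk₂ ℝ L1.mulRight
    (fun a b x => L1.op_injective (by simp [add_mul]))
    (fun c a x => L1.op_injective (by simp))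
    (fun a x y => L1.op_injective (by simp [mul_add]))
    (fun c a x => L1.op_injective (by simp))) 2
    fun a x => by simpa using L1.norm_mulRight_le a x

/-- The product `(a, x) ↦ a x` of bounded and trace-class operators as a continuous bilinear map. -/
def L1.mulLeftL : (H →L[ℂ] H) →L[ℝ] L1 H →L[ℝ] L1 H :=
  LinearMap.mkContinuous₂ (LinearMap.mk₂ ℝ L1.mulLeft
    (fun a b x => L1.op_injective (by simp [add_mul]))
    (fun c a x => L1.op_injective (by simp))
    (fun a x y => L1.op_injective (by simp [mul_add]))
    (fun c a x => L1.op_injective (by simp))) 2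
    fun a x => by
      have h := L1.norm_mulLeft_le a x
      rw [mul_right_comm] at h
      simpa using h

lemma opTrace_im_eq_zero_of_skew {x : L1 H} (hx : star x.op = -x.op) {v : H →L[ℂ] H}
    (hv : star v = -v) : (opTrace e (x.op * v)).im = 0 := by
  have h : star (x.op * v) = v * x.op := by rw [star_mul, hx, hv, neg_mul_neg]
  have h2 := opTrace_star e (x.op * v)
  rw [h, ← x.opTrace_mul_comm e] at h2
  exact Complex.conj_eq_iff_im.1 h2.symm

/-- The pairing `([x], v) ↦ Im Tr (x v)` of `L₁(H) / 𝔲₁(H)` with `𝔲(H)`. -/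
def skewPairing : L1ModU1 H →L[ℝ] SkewAdj (H →L[ℂ] H) →L[ℝ] ℝ :=
  L1ModU1.lift
    ((SkewAdj.val.precomp ℝ).comp ((ContinuousLinearMap.compL ℝ (H →L[ℂ] H) (L1 H) ℝ
      (Complex.imCLM.comp (traceL e))).comp L1.mulRightL)) fun x hx => by
    ext v
    exact opTrace_im_eq_zero_of_skew e hx v.star_coe

lemma skewPairing_cls (x : L1 H) (v : SkewAdj (H →L[ℂ] H)) :
    skewPairing e x.cls v = (opTrace e (x.op * (v : H →L[ℂ] H))).im := rfl

/-- The map `[x] ↦ p_{𝔟₂⁺}(x)` from `L₁(H) / 𝔲₁(H)` to the Hilbert–Schmidt operators. -/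
def triPart : L1ModU1 H →L[ℝ] HS e :=
  L1ModU1.lift ((HS.pb e).comp (HS.ofL1 e)) fun x hx =>
    HS.IsSkew.pb_eq_zero (x := HS.ofL1 e x) hx

@[simp] lemma triPart_cls (x : L1 H) : triPart e x.cls = HS.pb e (HS.ofL1 e x) := rfl

lemma isTri_triPart (ξ : L1ModU1 H) : (triPart e ξ).IsTri := by
  obtain ⟨x, rfl⟩ := ξ.exists_rep
  exact HS.isTri_pb _

/-- The map `y ↦ a* y a` on the Hilbert–Schmidt operators. It is defined for every bounded `a`, and
is smooth in `a`; for unitary `a` it is conjugation by `a⁻¹`. -/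
def HS.conj (a : H →L[ℂ] H) : HS e →L[ℝ] HS e := (HS.rmulL e a).comp (HS.lmulL e (star a))

variable {e}

@[simp] lemma HS.op_conj (a : H →L[ℂ] H) (y : HS e) : (HS.conj e a y).op = star a * y.op * a := rfl

lemma HS.IsSkew.conj (a : H →L[ℂ] H) {y : HS e} (hy : y.IsSkew) : (HS.conj e a y).IsSkew := by
  have h := star_conj_skew (star a) (show star y.op = -y.op from hy)
  rwa [star_star] at h

lemma HS.conj_mul (a b : H →L[ℂ] H) (y : HS e) :
    HS.conj e (a * b) y = HS.conj e b (HS.conj e a y) :=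
  HS.op_injective (by simp [mul_assoc])

lemma HS.conj_star_conj (g : UnitaryOp H) (y : HS e) :
    HS.conj e (g : H →L[ℂ] H) (HS.conj e (star (g : H →L[ℂ] H)) y) = y := by
  rw [← HS.conj_mul, Unitary.star_mul_self_of_mem g.2]
  exact HS.op_injective (by simp)

lemma HS.form_conj (g : UnitaryOp H) (x y : HS e) :
    HS.form e (HS.conj e (g : H →L[ℂ] H) x) (HS.conj e (g : H →L[ℂ] H) y) = HS.form e x y := by
  have h : (HS.conj e (g : H →L[ℂ] H) x).op * (HS.conj e (g : H →L[ℂ] H) y).op =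
      star (g : H →L[ℂ] H) * ((x.mul y).mulRight (g : H →L[ℂ] H)).op := by
    simp only [HS.op_conj, L1.op_mulRight, HS.op_mul, mul_assoc, Unitary.mul_star_cancel_left]
  rw [HS.form_apply, h, ← L1.opTrace_mul_comm, L1.op_mulRight, mul_assoc,
    Unitary.mul_star_self_of_mem g.2, mul_one]
  rfl

lemma HS.conj_bracket (g : UnitaryOp H) (x y : HS e) :
    (HS.conj e (g : H →L[ℂ] H) x).bracket (HS.conj e (g : H →L[ℂ] H) y) =
      HS.conj e (g : H →L[ℂ] H) (x.bracket y) :=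
  HS.op_injective (by
    simp only [HS.op_conj, HS.op_bracket, mul_assoc, Unitary.mul_star_cancel_left, mul_sub, sub_mul])

/-- The commutator `y v - v y` of a Hilbert–Schmidt operator `y` with a bounded operator `v`. -/
def HS.comm (y : HS e) (v : H →L[ℂ] H) : HS e := HS.rmul v y - HS.lmul v y

@[simp] lemma HS.op_comm (y : HS e) (v : H →L[ℂ] H) : (y.comm v).op = y.op * v - v * y.op := by
  simp [HS.comm]

lemma HS.IsSkew.comm {y : HS e} (hy : y.IsSkew) {v : H →L[ℂ] H} (hv : star v = -v) :
    (y.comm v).IsSkew := by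
  change star (y.comm v).op = -(y.comm v).op
  rw [HS.op_comm, star_sub, star_mul, star_mul, hv, show star y.op = _ from hy]
  noncomm_ring

lemma HS.form_comm_left (x y : HS e) (v : H →L[ℂ] H) :
    HS.form e (x.comm v) y = -HS.form e x (y.comm v) := by
  have hsub (a b : L1 H) : opTrace e (a.op - b.op) = opTrace e a.op - opTrace e b.op :=
    map_sub (traceL e) a b
  have h1 : opTrace e ((x.comm v).op * y.op) =
      opTrace e (x.op * (v * y.op)) - opTrace e (v * x.op * y.op) := by
    rw [HS.op_comm, sub_mul, mul_assoc x.op]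
    exact hsub (x.mul (HS.lmul v y)) ((HS.lmul v x).mul y)
  have h2 : opTrace e (x.op * (y.comm v).op) =
      opTrace e (x.op * (y.op * v)) - opTrace e (x.op * (v * y.op)) := by
    rw [HS.op_comm, mul_sub]
    exact hsub (x.mul (HS.rmul v y)) (x.mul (HS.lmul v y))
  have h3 : opTrace e (v * x.op * y.op) = opTrace e (x.op * (y.op * v)) := by
    rw [mul_assoc, ← mul_assoc x.op]
    exact ((x.mul y).opTrace_mul_comm e v).symm
  rw [HS.form_apply, HS.form_apply, h1, h2, h3, ← Complex.neg_im, neg_sub]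

lemma HS.comm_op (x y : HS e) : x.comm y.op = x.bracket y :=
  HS.op_injective (by simp)

variable (e) in
/-- The skew-hermitian part of a Hilbert–Schmidt operator, as an element of `𝔲(H)`. -/
def HS.toSkew : HS e →L[ℝ] SkewAdj (H →L[ℂ] H) := (skewPart (H →L[ℂ] H)).comp (HS.opL e)

lemma HS.IsSkew.coe_toSkew {x : HS e} (hx : x.IsSkew) :
    (HS.toSkew e x : H →L[ℂ] H) = x.op := skewPart_coe_of_star hx

/-- On the Hilbert–Schmidt elements of `𝔲(H)` the pairing only involves the triangular parts. -/
lemma skewPairing_skewAd_toSkew (g : UnitaryOp H) (ξ : L1ModU1 H) {w : HS e} (hw : w.IsSkew) :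
    skewPairing e ξ (skewAd (g : H →L[ℂ] H) (HS.toSkew e w)) =
      HS.form e (HS.conj e (g : H →L[ℂ] H) (triPart e ξ)) w := by
  obtain ⟨x, rfl⟩ := ξ.exists_rep
  have hW : (HS.conj e (star (g : H →L[ℂ] H)) w).IsSkew := hw.conj _
  rw [skewPairing_cls, coe_skewAd, hw.coe_toSkew]
  conv_rhs => rw [← HS.conj_star_conj g w, HS.form_conj, triPart_cls, ← HS.form_pu_right, hW.pu_eq]
  rw [HS.form_apply, HS.op_conj, star_star]
  rfl

variable (e) in
/-- The bilinear form `([x₁], [x₂]) ↦ Im Tr (K p_{𝔟₂⁺}(x₁) · p_{𝔲₂} (K p_{𝔟₂⁺}(x₂)))` on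
`L₁(H) / 𝔲₁(H)`, for a bounded operator `K` on the Hilbert–Schmidt operators. -/
def conjForm (K : HS e →L[ℝ] HS e) : L1ModU1 H →L[ℝ] L1ModU1 H →L[ℝ] ℝ :=
  (HS.form e).bilinearComp (K.comp (triPart e)) ((HS.pu e).comp (K.comp (triPart e)))

lemma conjForm_apply (K : HS e →L[ℝ] HS e) (ξ η : L1ModU1 H) :
    conjForm e K ξ η = HS.form e (K (triPart e ξ)) (HS.pu e (K (triPart e η))) := rfl

lemma conjForm_cls (g : UnitaryOp H) (x₁ x₂ : L1 H) :
    conjForm e (HS.conj e (g : H →L[ℂ] H)) x₁.cls x₂.cls = poissonForm e g x₁ x₂ := by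
  rw [conjForm_apply, HS.pu_eq]
  rfl

/-- The `𝔲₂`-part of `g⁻¹ p_{𝔟₂⁺}(x) g`: the left-trivialised tangent vector which the Poisson tensor
assigns to the covector `[x]` at `g`. -/
def sharp (g : H →L[ℂ] H) (ξ : L1ModU1 H) : HS e := HS.pu e (HS.conj e g (triPart e ξ))

lemma isSkew_sharp (g : H →L[ℂ] H) (ξ : L1ModU1 H) : (sharp (e := e) g ξ).IsSkew := HS.isSkew_pu _

lemma conjForm_eq_skewPairing (g : UnitaryOp H) (ξ η : L1ModU1 H) :
    conjForm e (HS.conj e (g : H →L[ℂ] H)) ξ η =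
      skewPairing e ξ (skewAd (g : H →L[ℂ] H) (HS.toSkew e (sharp (g : H →L[ℂ] H) η))) := by
  rw [skewPairing_skewAd_toSkew g ξ (isSkew_sharp _ η)]
  rfl

/-- Conjugation by `g` preserves the form `Im Tr (x y)`, for which the triangular operators are
isotropic, so the conjugates of the two triangular parts are orthogonal. Their pairing is the sum of
its components along `𝔟₂⁺ × 𝔲₂` and `𝔲₂ × 𝔟₂⁺`, the values of the tensor at `(ξ, η)` and `(η, ξ)`. -/
lemma conjForm_skew (g : UnitaryOp H) (ξ η : L1ModU1 H) :
    conjForm e (HS.conj e (g : H →L[ℂ] H)) ξ η =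
      -conjForm e (HS.conj e (g : H →L[ℂ] H)) η ξ := by
  have h : HS.form e (HS.conj e (g : H →L[ℂ] H) (triPart e ξ))
      (HS.conj e (g : H →L[ℂ] H) (triPart e η)) = 0 := by
    rw [HS.form_conj, (isTri_triPart e ξ).form_eq_zero (isTri_triPart e η)]
  rw [conjForm_apply, conjForm_apply, HS.form_pu_right (HS.conj e _ (triPart e η)), HS.form_comm (HS.pb e _)]
  rw [← HS.pu_add_pb (HS.conj e (g : H →L[ℂ] H) (triPart e η)), map_add] at h
  linear_combination h

/-- The class of the commutator `x y - y x` of two Hilbert–Schmidt operators, which is trace-class.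
On triangular parts it gives the Lie bracket of the dual Lie algebra. -/
def triBracket (x y : HS e) : L1ModU1 H := (x.mul y - y.mul x).cls

lemma skewPairing_triBracket (g : UnitaryOp H) (x y : HS e) (v : SkewAdj (H →L[ℂ] H)) :
    skewPairing e (triBracket x y) (skewAd (g : H →L[ℂ] H) v) =
      HS.form e (HS.conj e (g : H →L[ℂ] H) x) ((HS.conj e (g : H →L[ℂ] H) y).comm v) := by
  set x' := HS.conj e (g : H →L[ℂ] H) x with hx'
  set y' := HS.conj e (g : H →L[ℂ] H) y with hy'
  have hsub (a b : L1 H) : opTrace e (a.op - b.op) = opTrace e a.op - opTrace e b.op :=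
    map_sub (traceL e) a b
  have hz : star (g : H →L[ℂ] H) * ((x.mul y - y.mul x).mulRight ((g : H →L[ℂ] H) * v)).op
      = (x'.mul (HS.rmul (v : H →L[ℂ] H) y')).op - ((y'.mul (HS.rmul (v : H →L[ℂ] H) x'))).op := by
    simp only [hx', hy', HS.op_conj, L1.op_mulRight, HS.op_mul, mul_assoc, HS.op_rmul,
      Unitary.mul_star_cancel_left, map_sub, mul_sub, sub_mul]
  have h1 : opTrace e ((x.mul y - y.mul x).op * ((g : H →L[ℂ] H) * v * star (g : H →L[ℂ] H))) =
      opTrace e (x'.mul (HS.rmul (v : H →L[ℂ] H) y')).op -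
        opTrace e ((y'.mul (HS.rmul (v : H →L[ℂ] H) x'))).op := by
    rw [← mul_assoc, ← hsub, ← hz, ← L1.opTrace_mul_comm]
    rfl
  have h2 : opTrace e (y'.mul (HS.rmul (v : H →L[ℂ] H) x')).op =
      opTrace e (x'.mul (HS.lmul (v : H →L[ℂ] H) y')).op := by
    have := opTrace_mul_comm_of_mem e y'.op_mem (HS.rmul (v : H →L[ℂ] H) x').op_mem
    rw [HS.op_mul, this, HS.op_rmul, HS.op_mul, HS.op_lmul, mul_assoc]
  rw [triBracket, skewPairing_cls, coe_skewAd, h1, h2, ← hsub, HS.form_apply, HS.op_comm, mul_sub]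
  rfl

/-- The derivative, in the direction `v`, of the Poisson tensor in the right trivialisation,
evaluated on `([x], [y])`. -/
lemma form_comm_add_form_comm (g : UnitaryOp H) (ξ η : L1ModU1 H) (v : SkewAdj (H →L[ℂ] H)) :
    HS.form e ((HS.conj e (g : H →L[ℂ] H) (triPart e ξ)).comm v) (sharp (g : H →L[ℂ] H) η) +
        HS.form e (HS.conj e (g : H →L[ℂ] H) (triPart e ξ))
          (HS.pu e ((HS.conj e (g : H →L[ℂ] H) (triPart e η)).comm v)) =
      skewPairing e (triBracket (triPart e ξ) (triPart e η)) (skewAd (g : H →L[ℂ] H) v) -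
        skewPairing e ξ (skewAd (g : H →L[ℂ] H)
          (HS.toSkew e ((sharp (g : H →L[ℂ] H) η : HS e).comm v))) +
        skewPairing e η (skewAd (g : H →L[ℂ] H)
          (HS.toSkew e ((sharp (g : H →L[ℂ] H) ξ : HS e).comm v))) := by
  have hv := v.star_coe
  rw [skewPairing_skewAd_toSkew g ξ ((isSkew_sharp _ η).comm hv),
    skewPairing_skewAd_toSkew g η ((isSkew_sharp _ ξ).comm hv), skewPairing_triBracket,
    HS.form_comm_left, HS.form_pu_right]
  unfold sharp
  set x := HS.conj e (g : H →L[ℂ] H) (triPart e ξ)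
  set y := HS.conj e (g : H →L[ℂ] H) (triPart e η)
  have h1 := HS.form_comm_left y (HS.pu e x) (v : H →L[ℂ] H)
  rw [HS.form_comm (y.comm v)] at h1
  have h2 : HS.form e x (y.comm v) = HS.form e (HS.pu e x) (y.comm v) + HS.form e (HS.pb e x) (y.comm v) := by
    rw [← add_apply, ← map_add, HS.pu_add_pb]
  linear_combination -h1 - h2

end Pairing

/-! ### The cocycle identity -/

section Cocycle

variable {H : Type*} [NormedAddCommGroup H] [InnerProductSpace ℂ H] [CompleteSpace H]
  {e : HilbertBasis ℤ ℂ H}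

/-- The coadjoint action `[x] ↦ [g⁻¹ x g]` on `L₁(H) / 𝔲₁(H)`. -/
def coadj (g : UnitaryOp H) : L1ModU1 H →L[ℝ] L1ModU1 H :=
  L1ModU1.lift (L1.clsL.comp ((L1.mulLeftL (star (g : H →L[ℂ] H))).comp
    (L1.mulRightL.flip (g : H →L[ℂ] H)))) fun x hx => by
    refine L1.cls_eq_zero ?_
    change star (L1.mulLeft (star (g : H →L[ℂ] H)) (x.mulRight (g : H →L[ℂ] H))).op =
      -(L1.mulLeft (star (g : H →L[ℂ] H)) (x.mulRight (g : H →L[ℂ] H))).op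
    have h := star_conj_skew (star (g : H →L[ℂ] H)) hx
    rwa [star_star, mul_assoc, ← L1.op_mulRight, ← L1.op_mulLeft] at h

lemma coadj_cls (g : UnitaryOp H) (x : L1 H) : coadj g x.cls =
    (L1.mulLeft (star (g : H →L[ℂ] H)) (x.mulRight (g : H →L[ℂ] H))).cls := rfl

lemma skewPairing_coadj (g : UnitaryOp H) (ξ : L1ModU1 H) (v : SkewAdj (H →L[ℂ] H)) :
    skewPairing e (coadj g ξ) v = skewPairing e ξ (skewAd (g : H →L[ℂ] H) v) := by
  obtain ⟨x, rfl⟩ := ξ.exists_rep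
  rw [coadj_cls, skewPairing_cls, skewPairing_cls, coe_skewAd, L1.op_mulLeft, mul_assoc,
    ← L1.op_mulRight, ← L1.opTrace_mul_comm]
  simp only [L1.op_mulRight, mul_assoc]

lemma triPart_coadj (g : UnitaryOp H) (ξ : L1ModU1 H) :
    triPart e (coadj g ξ) = HS.pb e (HS.conj e (g : H →L[ℂ] H) (triPart e ξ)) := by
  obtain ⟨x, rfl⟩ := ξ.exists_rep
  have h : HS.ofL1 e (L1.mulLeft (star (g : H →L[ℂ] H)) (x.mulRight (g : H →L[ℂ] H))) =
      HS.conj e (g : H →L[ℂ] H) (HS.ofL1 e x) :=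
    HS.op_injective (by simp [mul_assoc])
  rw [coadj_cls, triPart_cls, triPart_cls, h]
  conv_lhs => rw [← HS.pu_add_pb (HS.ofL1 e x), map_add, map_add,
    ((HS.isSkew_pu (HS.ofL1 e x)).conj (g : H →L[ℂ] H)).pb_eq_zero, zero_add]

/-- In the right trivialisation the Poisson tensor is a `1`-cocycle of the group: conjugation by `h`
preserves `𝔲₂`, which is isotropic, so the `𝔲₂`-parts of the two conjugates by `g` contribute only
the pairing of the second one with the `𝔟₂⁺`-part of the first, which is invariant under `h` and
equal to the value of the tensor at `g`. -/
lemma conjForm_mul (g h : UnitaryOp H) (ξ η : L1ModU1 H) :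
    conjForm e (HS.conj e ((g * h : UnitaryOp H) : H →L[ℂ] H)) ξ η =
      conjForm e (HS.conj e (g : H →L[ℂ] H)) ξ η +
        conjForm e (HS.conj e (h : H →L[ℂ] H)) (coadj g ξ) (coadj g η) := by
  simp only [conjForm_apply, triPart_coadj, Submonoid.coe_mul, HS.conj_mul]
  set x := HS.conj e (g : H →L[ℂ] H) (triPart e ξ)
  set y := HS.conj e (g : H →L[ℂ] H) (triPart e η)
  have hxu := (HS.isSkew_pu x).conj (h : H →L[ℂ] H)
  have hyu := (HS.isSkew_pu y).conj (h : H →L[ℂ] H)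
  have hy : HS.conj e (h : H →L[ℂ] H) y =
      HS.conj e (h : H →L[ℂ] H) (HS.pu e y) + HS.conj e (h : H →L[ℂ] H) (HS.pb e y) := by
    rw [← map_add, HS.pu_add_pb]
  have hx : HS.conj e (h : H →L[ℂ] H) x =
      HS.conj e (h : H →L[ℂ] H) (HS.pu e x) + HS.conj e (h : H →L[ℂ] H) (HS.pb e x) := by
    rw [← map_add, HS.pu_add_pb]
  have h0 : HS.form e x (HS.pu e y) = HS.form e (HS.conj e (h : H →L[ℂ] H) (HS.pb e x))
      (HS.conj e (h : H →L[ℂ] H) (HS.pu e y)) := by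
    rw [HS.form_conj]
    conv_lhs => rw [← HS.pu_add_pb x, map_add, add_apply,
      (HS.isSkew_pu x).form_eq_zero (HS.isSkew_pu y), zero_add]
  rw [h0, hx, hy]
  simp only [map_add, add_apply]
  rw [hyu.pu_eq, hxu.form_eq_zero hyu, hxu.form_eq_zero (HS.isSkew_pu _)]
  ring

end Cocycle

/-! ### Calculus on the unitary group -/

section UnitaryCalculus

variable {A : Type*} [CStarAlgebra A] {F : Type*} [NormedAddCommGroup F] [NormedSpace ℝ F]

lemma unitaryChart_self (p : unitary A) : unitaryChart p p = 0 := by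
  change skewPart A (cayleyInv ((p⁻¹ * p : unitary A) : A)) = 0
  simp [cayleyInv]

lemma unitaryChart_symm_zero (p : unitary A) : (unitaryChart p).symm 0 = p := by
  rw [← unitaryChart_self p]
  exact (unitaryChart p).left_inv (mem_chart_source (SkewAdj A) p)

lemma contDiff_coe_chart_symm (p : unitary A) :
    ContDiff ℝ ∞ fun X : SkewAdj A => (p : A) * cayley (X : A) :=
  contDiff_const.mul contDiff_cayley

lemma hasFDerivAt_cayley : HasFDerivAt (fun X : SkewAdj A => cayley (X : A))
    (SkewAdj.val : SkewAdj A →L[ℝ] A) 0 := by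
  -- differentiate the identity `cayley X * (1 - X / 2) = 1 + X / 2`
  have hd : DifferentiableAt ℝ (fun X : SkewAdj A => cayley (X : A)) 0 :=
    contDiff_cayley.differentiable (by simp) 0
  have h1 (t : ℝ) : HasFDerivAt (fun X : SkewAdj A => (1 : A) + t • (X : A))
      (t • (SkewAdj.val : SkewAdj A →L[ℝ] A)) 0 :=
    ((SkewAdj.val (A := A)).hasFDerivAt.const_smul t).const_add 1
  have h2 := hd.hasFDerivAt.mul' (h1 (-(1 / 2)))
  have h3 : (fun X : SkewAdj A => cayley (X : A)) * (fun X : SkewAdj A => (1 : A) + (-(1 / 2) : ℝ) • (X : A))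
      = fun X : SkewAdj A => (1 : A) + (1 / 2 : ℝ) • (X : A) := by
    ext X
    obtain ⟨m, hm⟩ := isUnit_one_add_smul X (-(1 / 2))
    simp only [Pi.mul_apply]
    rw [cayley, ← hm, Ring.inverse_unit, mul_assoc, Units.inv_mul, mul_one]
  rw [h3] at h2
  have h4 := h2.unique (h1 (1 / 2))
  convert hd.hasFDerivAt using 1
  ext v
  have h5 := congrArg (fun f : SkewAdj A →L[ℝ] A => f v) h4
  have hc0 : cayley ((0 : SkewAdj A) : A) = 1 := by simp [cayley]
  simp only [hc0] at h5
  simp only [SkewAdj.val.map_zero, smul_zero, add_zero, MulOpposite.op_one, one_smul, add_apply,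
    smul_apply] at h5
  rw [neg_smul, neg_add_eq_iff_eq_add, ← add_smul] at h5
  norm_num at h5
  exact h5.symm

lemma hasFDerivAt_coe_chart_symm (p : unitary A) :
    HasFDerivAt (fun X : SkewAdj A => (p : A) * cayley (X : A))
      ((ContinuousLinearMap.mul ℝ A (p : A)).comp SkewAdj.val) 0 :=
  (ContinuousLinearMap.mul ℝ A (p : A)).hasFDerivAt.comp 0 hasFDerivAt_cayley

/-- The derivative at `p` of a function on the unitary group, in the left trivialisation: `v` stands
for the tangent vector `p v` at `p`, as the Cayley chart at `p` is `X ↦ p (1 + X + ⋯)`. -/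
def leftDeriv (f : unitary A → F) (p : unitary A) : SkewAdj A →L[ℝ] F :=
  mfderiv 𝓘(ℝ, SkewAdj A) 𝓘(ℝ, F) f p

lemma MDifferentiableAt.hasMFDerivAt_leftDeriv {f : unitary A → F} {p : unitary A}
    (hf : MDifferentiableAt 𝓘(ℝ, SkewAdj A) 𝓘(ℝ, F) f p) :
    HasMFDerivAt 𝓘(ℝ, SkewAdj A) 𝓘(ℝ, F) f p (leftDeriv f p : SkewAdj A →L[ℝ] F) :=
  hf.hasMFDerivAt

lemma HasMFDerivAt.leftDeriv_eq {f : unitary A → F} {p : unitary A} {D : SkewAdj A →L[ℝ] F}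
    (hf : HasMFDerivAt 𝓘(ℝ, SkewAdj A) 𝓘(ℝ, F) f p D) : leftDeriv f p = D := hf.mfderiv

/-- The derivative of a function on the unitary group is the ordinary derivative at `0` of its
expression in the Cayley chart. -/
lemma HasMFDerivAt.comp_chart_symm {f : unitary A → F} {p : unitary A} {D : SkewAdj A →L[ℝ] F}
    (hf : HasMFDerivAt 𝓘(ℝ, SkewAdj A) 𝓘(ℝ, F) f p D) :
    HasFDerivAt (fun X : SkewAdj A => f ((unitaryChart p).symm X)) D 0 := by
  have h := hf.2
  have h0 : extChartAt 𝓘(ℝ, SkewAdj A) p p = 0 := unitaryChart_self p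
  rw [h0] at h
  have h1 : HasFDerivWithinAt (fun X : SkewAdj A => f ((unitaryChart p).symm X)) D
      (Set.range id) 0 := h
  rwa [Set.range_id, hasFDerivWithinAt_univ] at h1

lemma hasMFDerivAt_of_chart {f : unitary A → F} {p : unitary A} {f' : SkewAdj A →L[ℝ] F}
    (hc : ContinuousAt f p)
    (hf : HasFDerivAt (fun X : SkewAdj A => f ((unitaryChart p).symm X)) f' 0) :
    HasMFDerivAt 𝓘(ℝ, SkewAdj A) 𝓘(ℝ, F) f p f' := by
  refine ⟨hc, ?_⟩
  have h0 : extChartAt 𝓘(ℝ, SkewAdj A) p p = 0 := unitaryChart_self p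
  rw [h0]
  exact hf.hasFDerivWithinAt

lemma hasMFDerivAt_unitary_coe (p : unitary A) :
    HasMFDerivAt 𝓘(ℝ, SkewAdj A) 𝓘(ℝ, A) (fun g : unitary A => (g : A)) p
      ((ContinuousLinearMap.mul ℝ A (p : A)).comp SkewAdj.val : SkewAdj A →L[ℝ] A) :=
  hasMFDerivAt_of_chart (by fun_prop) (hasFDerivAt_coe_chart_symm p)

lemma contMDiff_chart_symm (p : unitary A) :
    ContMDiff 𝓘(ℝ, SkewAdj A) 𝓘(ℝ, SkewAdj A) ∞ fun X : SkewAdj A => (unitaryChart p).symm X :=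
  contMDiff_unitary_of_coe (contDiff_coe_chart_symm p).contMDiff

/-- A function on the unitary group, extended to a neighbourhood of the point `p` in the algebra by
means of the Cayley chart at `p`. -/
def chartExtension (p : unitary A) (f : unitary A → F) (a : A) : F :=
  f ((unitaryChart p).symm (skewPart A (cayleyInv (((p⁻¹ : unitary A) : A) * a))))

lemma chartExtension_coe {p q : unitary A} (f : unitary A → F) (hq : q ∈ (unitaryChart p).source) :
    chartExtension p f q = f q :=
  congrArg f ((unitaryChart p).left_inv hq)

lemma contDiffAt_chartExtension {p : unitary A} {f : unitary A → F}
    (hf : ContMDiffAt 𝓘(ℝ, SkewAdj A) 𝓘(ℝ, F) ∞ f p) : ContDiffAt ℝ ∞ (chartExtension p f) p := by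
  have hu : IsUnit (((p⁻¹ : unitary A) : A) * (p : A) + 1) := mem_chart_source (SkewAdj A) p
  have h1 := contDiffAt_unitaryChart p hu
  have h2 : skewPart A (cayleyInv (((p⁻¹ : unitary A) : A) * (p : A))) = 0 := unitaryChart_self p
  have h3 : ContMDiffAt 𝓘(ℝ, SkewAdj A) 𝓘(ℝ, F) ∞ (fun X : SkewAdj A => f ((unitaryChart p).symm X)) 0 := by
    refine ContMDiffAt.comp (0 : SkewAdj A) (g := f) (I' := 𝓘(ℝ, SkewAdj A)) ?_
      (contMDiff_chart_symm p).contMDiffAt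
    rwa [unitaryChart_symm_zero]
  refine ContDiffAt.comp (p : A)
    (g := fun X : SkewAdj A => f ((unitaryChart p).symm X)) ?_ h1
  rw [h2]
  exact h3.contDiffAt

lemma leftDeriv_eventually_eq {p : unitary A} {f : unitary A → F}
    (hf : ContMDiffAt 𝓘(ℝ, SkewAdj A) 𝓘(ℝ, F) ∞ f p) :
    ∀ᶠ q in nhds p, ∀ w : SkewAdj A,
      leftDeriv f q w =
        fderiv ℝ (chartExtension p f) (q : A) ((q : A) * (w : A)) := by
  have h1 : ∀ᶠ a in nhds (p : A), ContDiffAt ℝ 1 (chartExtension p f) a :=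
    ((contDiffAt_chartExtension hf).of_le (by simp)).eventually (by simp)
  have h2 : ∀ᶠ q : unitary A in nhds p, ContDiffAt ℝ 1 (chartExtension p f) (q : A) :=
    continuous_subtype_val.continuousAt.eventually h1
  have h3 : ∀ᶠ q in nhds p, q ∈ (unitaryChart p).source :=
    (unitaryChart p).open_source.mem_nhds (mem_chart_source (SkewAdj A) p)
  filter_upwards [h2, h3.eventually_nhds] with q hq1 hq2 w
  have hd := (hq1.differentiableAt one_ne_zero).hasFDerivAt.hasMFDerivAt.comp q
    (hasMFDerivAt_unitary_coe q)
  have he : f =ᶠ[nhds q] chartExtension p f ∘ fun g : unitary A => (g : A) := by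
    filter_upwards [hq2] with q' hq'
    exact (chartExtension_coe f hq').symm
  rw [HasMFDerivAt.leftDeriv_eq (hd.congr_of_eventuallyEq he)]
  rfl

/-- The derivative of a smooth function along a smooth (left-trivialised) vector field is smooth. -/
lemma ContMDiffOn.leftDeriv_apply {U : Set (unitary A)} (hU : IsOpen U) {f : unitary A → F}
    (hf : ContMDiffOn 𝓘(ℝ, SkewAdj A) 𝓘(ℝ, F) ∞ f U) {w : unitary A → SkewAdj A}
    (hw : ContMDiffOn 𝓘(ℝ, SkewAdj A) 𝓘(ℝ, SkewAdj A) ∞ w U) :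
    ContMDiffOn 𝓘(ℝ, SkewAdj A) 𝓘(ℝ, F) ∞
      (fun q => leftDeriv f q (w q)) U := by
  intro p hp
  have hfp := hf.contMDiffAt (hU.mem_nhds hp)
  have hwp := hw.contMDiffAt (hU.mem_nhds hp)
  refine ContMDiffAt.contMDiffWithinAt ?_
  have h1 : ContDiffAt ℝ ∞ (fderiv ℝ (chartExtension p f)) (p : A) :=
    (contDiffAt_chartExtension hfp).fderiv_right (by simp)
  have h2 : ContMDiffAt 𝓘(ℝ, SkewAdj A) 𝓘(ℝ, A →L[ℝ] F) ∞
      (fun q : unitary A => fderiv ℝ (chartExtension p f) (q : A)) p :=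
    ContDiffAt.comp_contMDiffAt (f := fun q : unitary A => (q : A)) h1
      contMDiff_unitary_coe.contMDiffAt
  have h3 : ContMDiffAt 𝓘(ℝ, SkewAdj A) 𝓘(ℝ, A) ∞
      (fun q : unitary A => (q : A) * (w q : A)) p := by
    have h4 := (SkewAdj.val (A := A)).contDiff.contDiffAt (n := ∞) (x := w p)|>.comp_contMDiffAt hwp
    exact (contDiff_fst.mul contDiff_snd : ContDiff ℝ ∞ fun p : A × A => p.1 * p.2).contDiffAt.comp_contMDiffAt
      (f := fun q : unitary A => ((q : A), (w q : A)))
      (contMDiff_unitary_coe.contMDiffAt.prodMk_space h4)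
  refine (h2.clm_apply h3).congr_of_eventuallyEq ?_
  filter_upwards [leftDeriv_eventually_eq hfp] with q hq
  exact hq (w q)

end UnitaryCalculus

/-! ### Closed sections -/

section ClosedSections

variable {A : Type*} [CStarAlgebra A] {F : Type*} [NormedAddCommGroup F] [NormedSpace ℝ F]

/-- The `1`-form on the unitary group which pairs the right-trivialised section `α` with tangent
vectors. -/
def sectionForm (b : F →L[ℝ] SkewAdj A →L[ℝ] ℝ) (α : unitary A → F) (q : unitary A) :
    TangentSpace 𝓘(ℝ, SkewAdj A) q →L[ℝ] ℝ :=
  ((b (α q)).comp (skewAd (q : A)) : SkewAdj A →L[ℝ] ℝ)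

lemma localForm_sectionForm (b : F →L[ℝ] SkewAdj A →L[ℝ] ℝ) (α : unitary A → F) (p : unitary A)
    (y w : SkewAdj A) :
    localForm 𝓘(ℝ, SkewAdj A) (sectionForm b α) p y w =
      b (α ((unitaryChart p).symm y))
        (skewPart A (fderiv ℝ (fun X : SkewAdj A => (p : A) * cayley (X : A)) y w *
          star ((p : A) * cayley (y : A)))) := by
  set q : unitary A := (unitaryChart p).symm y with hq
  have h1 := ((contMDiff_chart_symm p).mdifferentiable (by simp) y).hasMFDerivAt
  let M : SkewAdj A →L[ℝ] SkewAdj A :=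
    mfderiv 𝓘(ℝ, SkewAdj A) 𝓘(ℝ, SkewAdj A) (fun X : SkewAdj A => (unitaryChart p).symm X) y
  have h2 := (hasMFDerivAt_unitary_coe q).comp y h1
  have h3 : HasFDerivAt (fun X : SkewAdj A => (p : A) * cayley (X : A))
      (((ContinuousLinearMap.mul ℝ A (q : A)).comp SkewAdj.val).comp M) y := h2.hasFDerivAt
  rw [h3.fderiv]
  rfl

/-- For a closed section `α` with derivative `D` at `p`, in the left trivialisation of the tangent
bundle and the right trivialisation of the precotangent bundle,
`⟨D v, w⟩ - ⟨D w, v⟩ + ⟨α, [v, w]⟩ = 0` (all directions transported by `Ad p`). -/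
lemma IsClosedFormAt.sectionForm_eq {b : F →L[ℝ] SkewAdj A →L[ℝ] ℝ} {α : unitary A → F}
    {p : unitary A} (hα : MDifferentiableAt 𝓘(ℝ, SkewAdj A) 𝓘(ℝ, F) α p)
    (h : IsClosedFormAt 𝓘(ℝ, SkewAdj A) (sectionForm b α) p) (v w : SkewAdj A) :
    b (leftDeriv α p v) (skewAd (p : A) w) -
        b (leftDeriv α p w) (skewAd (p : A) v) +
      b (α p) (skewAd (p : A) (skewPart A ((v : A) * w - (w : A) * v))) = 0 := by
  set D : SkewAdj A →L[ℝ] F := leftDeriv α p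
  let Φ : SkewAdj A → A := fun X => (p : A) * cayley (X : A)
  have hΦ : ContDiff ℝ ∞ Φ := contDiff_coe_chart_symm p
  have hΦ0 : Φ 0 = p := by simp [Φ, cayley]
  have hΦd : HasFDerivAt Φ ((ContinuousLinearMap.mul ℝ A (p : A)).comp SkewAdj.val) 0 :=
    hasFDerivAt_coe_chart_symm p
  have hΦ2 : HasFDerivAt (fderiv ℝ Φ) (fderiv ℝ (fderiv ℝ Φ) 0) 0 :=
    ((hΦ.fderiv_right (m := ∞) (by simp)).differentiable (by simp) 0).hasFDerivAt
  have hsymm : IsSymmSndFDerivAt ℝ Φ 0 :=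
    (hΦ.contDiffAt (x := 0)).isSymmSndFDerivAt (by simp only [minSmoothness_of_isRCLikeNormedField]; exact WithTop.coe_le_coe.2 le_top)
  have hα' : HasFDerivAt (fun X : SkewAdj A => α ((unitaryChart p).symm X)) D 0 :=
    hα.hasMFDerivAt_leftDeriv.comp_chart_symm
  have hstar : HasFDerivAt (fun X => star (Φ X))
      (((starL' ℝ : A ≃L[ℝ] A) : A →L[ℝ] A).comp
        ((ContinuousLinearMap.mul ℝ A (p : A)).comp SkewAdj.val)) 0 :=
    ((starL' ℝ : A ≃L[ℝ] A) : A →L[ℝ] A).hasFDerivAt.comp 0 hΦd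
  -- the local expression is differentiable, so its derivative may be computed argument by argument
  have hloc : DifferentiableAt ℝ (localForm 𝓘(ℝ, SkewAdj A) (sectionForm b α) p) 0 := by
    have h1 : localForm 𝓘(ℝ, SkewAdj A) (sectionForm b α) p = fun y =>
        (b (α ((unitaryChart p).symm y))).comp ((skewPart A).comp
          (((ContinuousLinearMap.mul ℝ A).flip (star (Φ y))).comp (fderiv ℝ Φ y))) := by
      ext y w
      exact localForm_sectionForm b α p y w
    rw [h1]
    have h2 : DifferentiableAt ℝ (fun y => (ContinuousLinearMap.mul ℝ A).flip (star (Φ y))) 0 :=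
      (((ContinuousLinearMap.mul ℝ A).flip).hasFDerivAt.comp 0 hstar).differentiableAt
    have h3 : DifferentiableAt ℝ (fun y => b (α ((unitaryChart p).symm y))) 0 :=
      (b.hasFDerivAt.comp 0 hα').differentiableAt
    exact h3.clm_comp ((differentiableAt_const _).clm_comp (h2.clm_comp hΦ2.differentiableAt))
  have key (v w : SkewAdj A) : fderiv ℝ (localForm 𝓘(ℝ, SkewAdj A) (sectionForm b α) p) 0 v w =
      b (D v) (skewAd (p : A) w) + b (α p) (skewPart A (fderiv ℝ (fderiv ℝ Φ) 0 v w * star (p : A) -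
        (p : A) * (w * v) * star (p : A))) := by
    have h1 : HasFDerivAt (fun y => localForm 𝓘(ℝ, SkewAdj A) (sectionForm b α) p y w)
        ((fderiv ℝ (localForm 𝓘(ℝ, SkewAdj A) (sectionForm b α) p) 0).flip w) 0 :=
      hloc.hasFDerivAt.clm_apply (hasFDerivAt_const w 0) |>.congr_fderiv (by ext; simp)
    have h2 : HasFDerivAt (fun y => fderiv ℝ Φ y w) ((fderiv ℝ (fderiv ℝ Φ) 0).flip w) 0 :=
      hΦ2.clm_apply (hasFDerivAt_const w 0) |>.congr_fderiv (by ext; simp)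
    have h3 := (b.hasFDerivAt.comp 0 hα').clm_apply
      ((skewPart A).hasFDerivAt.comp 0 (h2.mul' hstar))
    have h4 := h1.unique (h3.congr_of_eventuallyEq (Filter.Eventually.of_forall fun y =>
      localForm_sectionForm b α p y w))
    have h5 := congrArg (fun f : SkewAdj A →L[ℝ] ℝ => f v) h4
    have hΦw : fderiv ℝ Φ 0 w = (p : A) * w := by rw [hΦd.fderiv]; rfl
    have hα0 : α ((unitaryChart p).symm 0) = α p := by rw [unitaryChart_symm_zero]
    have hAd : skewPart A ((p : A) * w * star (p : A)) = skewAd (p : A) w := rfl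
    refine h5.trans ?_
    simp only [add_apply, ContinuousLinearMap.comp_apply, Function.comp_apply, Pi.mul_apply, hα0,
      ContinuousLinearMap.flip_apply, smul_apply, hΦ0, hΦw, smul_eq_mul, MulOpposite.smul_eq_mul_unop,
      MulOpposite.unop_op, hAd, ContinuousLinearMap.mul_apply', ContinuousLinearEquiv.coe_coe,
      starL'_apply, star_mul, v.star_coe]
    rw [add_comm]
    congr 3
    noncomm_ring
  have h0 : extChartAt 𝓘(ℝ, SkewAdj A) p p = 0 := unitaryChart_self p
  have h1 := h v w
  rw [h0, key, key, hsymm.eq v w] at h1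
  have h2 : skewAd (p : A) (skewPart A ((v : A) * w - (w : A) * v)) =
      skewPart A (fderiv ℝ (fderiv ℝ Φ) 0 w v * star (p : A) - (p : A) * (w * v) * star (p : A)) -
      skewPart A (fderiv ℝ (fderiv ℝ Φ) 0 w v * star (p : A) - (p : A) * (v * w) * star (p : A)) := by
    have h3 : star ((v : A) * w - (w : A) * v) = -((v : A) * w - (w : A) * v) := by
      rw [star_sub, star_mul, star_mul, v.star_coe, w.star_coe]
      noncomm_ring
    rw [← map_sub]
    apply SkewAdj.val_injective
    rw [coe_skewAd, skewPart_coe_of_star h3, skewPart_coe_of_star]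
    · noncomm_ring
    · have := star_conj_skew (p : A) h3
      convert this using 2 <;> noncomm_ring
  rw [h2, map_sub]
  linear_combination h1

end ClosedSections

/-! ### The derivative of the Poisson tensor along sections -/

section TensorDerivative

variable {H : Type*} [NormedAddCommGroup H] [InnerProductSpace ℂ H] [CompleteSpace H]
  {e : HilbertBasis ℤ ℂ H}

variable (e) in
lemma contDiff_conj : ContDiff ℝ ∞ (HS.conj e) :=
  (HS.rmulL e).contDiff.clm_comp
    ((HS.lmulL e).contDiff.comp
      ((starL' ℝ : (H →L[ℂ] H) ≃L[ℝ] (H →L[ℂ] H)) : (H →L[ℂ] H) →L[ℝ] (H →L[ℂ] H)).contDiff)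

lemma contDiff_flip {X Y Z : Type*} [NormedAddCommGroup X] [NormedSpace ℝ X] [NormedAddCommGroup Y]
    [NormedSpace ℝ Y] [NormedAddCommGroup Z] [NormedSpace ℝ Z] :
    ContDiff ℝ ∞ fun B : X →L[ℝ] Y →L[ℝ] Z => B.flip :=
  LinearIsometryEquiv.contDiff (𝕜 := ℝ) (E := X →L[ℝ] Y →L[ℝ] Z) (F := Y →L[ℝ] X →L[ℝ] Z)
    (ContinuousLinearMap.flipₗᵢ ℝ X Y Z)

variable (e) in
lemma contDiff_conjForm : ContDiff ℝ ∞ (conjForm e) := by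
  have h1 : ContDiff ℝ ∞ fun K : HS e →L[ℝ] HS e => K.comp (triPart e) :=
    contDiff_id.clm_comp contDiff_const
  exact contDiff_flip.comp ((contDiff_flip.comp (contDiff_const.clm_comp h1)).clm_comp
    (contDiff_const.clm_comp h1))

variable (e) in
lemma contMDiff_conj : ContMDiff (modelU H) 𝓘(ℝ, HS e →L[ℝ] HS e) ∞
    fun g : UnitaryOp H => HS.conj e (g : H →L[ℂ] H) :=
  (contDiff_conj e).comp_contMDiff contMDiff_unitary_coe

variable (e) in
lemma contMDiff_conjForm : ContMDiff (modelU H) 𝓘(ℝ, L1ModU1 H →L[ℝ] L1ModU1 H →L[ℝ] ℝ) ∞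
    fun g : UnitaryOp H => conjForm e (HS.conj e (g : H →L[ℂ] H)) :=
  (contDiff_conjForm e).comp_contMDiff (contMDiff_conj e)

/-- The product rule for `g⁻¹ s(g) g` at `p`, along the curves `p (1 + t v + ⋯)`. -/
lemma hasFDerivAt_conj_chart (p : UnitaryOp H) {s : SkewAdj (H →L[ℂ] H) → HS e}
    {s' : SkewAdj (H →L[ℂ] H) →L[ℝ] HS e} (hs : HasFDerivAt s s' 0) :
    ∃ L : SkewAdj (H →L[ℂ] H) →L[ℝ] HS e,
      HasFDerivAt (fun X : SkewAdj (H →L[ℂ] H) =>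
        HS.conj e ((p : H →L[ℂ] H) * cayley (X : H →L[ℂ] H)) (s X)) L 0 ∧
      ∀ v : SkewAdj (H →L[ℂ] H), L v = (HS.conj e (p : H →L[ℂ] H) (s 0)).comm v + HS.conj e p (s' v) := by
  have hΦ := hasFDerivAt_coe_chart_symm p
  have hstar := ((starL' ℝ : (H →L[ℂ] H) ≃L[ℝ] (H →L[ℂ] H)) :
    (H →L[ℂ] H) →L[ℝ] (H →L[ℂ] H)).hasFDerivAt.comp 0 hΦ
  have h1 := ((HS.lmulL e).hasFDerivAt.comp 0 hstar).clm_apply hs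
  have h2 := ((HS.rmulL e).hasFDerivAt.comp 0 hΦ).clm_apply h1
  refine ⟨_, h2, fun v => HS.op_injective ?_⟩
  have hc : cayley ((0 : SkewAdj (H →L[ℂ] H)) : H →L[ℂ] H) = 1 := by simp [cayley]
  simp only [add_apply, ContinuousLinearMap.comp_apply, ContinuousLinearMap.flip_apply,
    Function.comp_apply, ContinuousLinearMap.mul_apply', ContinuousLinearEquiv.coe_coe, starL'_apply,
    hc, mul_one, HS.lmulL_apply, HS.rmulL_apply, map_add, HS.op_rmul, HS.op_lmul, HS.op_comm,
    HS.op_conj, star_mul, v.star_coe]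
  noncomm_ring

/-- The derivative of `π(α, β)`, for not necessarily closed sections. -/
lemma leftDeriv_conjForm {p : UnitaryOp H} {α β : UnitaryOp H → L1ModU1 H}
    {Dα Dβ : SkewAdj (H →L[ℂ] H) →L[ℝ] L1ModU1 H}
    (hα : HasMFDerivAt (modelU H) 𝓘(ℝ, L1ModU1 H) α p Dα)
    (hβ : HasMFDerivAt (modelU H) 𝓘(ℝ, L1ModU1 H) β p Dβ) (v : SkewAdj (H →L[ℂ] H)) :
    leftDeriv
      (fun q : UnitaryOp H => conjForm e (HS.conj e (q : H →L[ℂ] H)) (α q) (β q)) p v =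
      conjForm e (HS.conj e (p : H →L[ℂ] H)) (Dα v) (β p) +
      conjForm e (HS.conj e (p : H →L[ℂ] H)) (α p) (Dβ v) +
      (HS.form e ((HS.conj e (p : H →L[ℂ] H) (triPart e (α p))).comm v) (sharp (p : H →L[ℂ] H) (β p)) +
        HS.form e (HS.conj e (p : H →L[ℂ] H) (triPart e (α p)))
          (HS.pu e ((HS.conj e (p : H →L[ℂ] H) (triPart e (β p))).comm v))) := by
  have hd : MDifferentiableAt (modelU H) 𝓘(ℝ, ℝ)
      (fun q : UnitaryOp H => conjForm e (HS.conj e (q : H →L[ℂ] H)) (α q) (β q)) p :=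
    (((contMDiff_conjForm e).mdifferentiable (by simp) p).clm_apply hα.mdifferentiableAt).clm_apply
      hβ.mdifferentiableAt
  obtain ⟨L, hL, hLv⟩ := hasFDerivAt_conj_chart p ((triPart e).hasFDerivAt.comp 0 hα.comp_chart_symm)
  obtain ⟨M, hM, hMv⟩ := hasFDerivAt_conj_chart p ((triPart e).hasFDerivAt.comp 0 hβ.comp_chart_symm)
  have h1 := ((HS.form e).hasFDerivAt.comp 0 hL).clm_apply ((HS.pu e).hasFDerivAt.comp 0 hM)
  have h2 := hd.hasMFDerivAt_leftDeriv.comp_chart_symm.unique h1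
  have h3 := congrArg (fun f : SkewAdj (H →L[ℂ] H) →L[ℝ] ℝ => f v) h2
  refine h3.trans ?_
  have hc : cayley ((0 : SkewAdj (H →L[ℂ] H)) : H →L[ℂ] H) = 1 := by simp [cayley]
  simp only [add_apply, ContinuousLinearMap.comp_apply, ContinuousLinearMap.flip_apply,
    Function.comp_apply, hc, mul_one, hLv, hMv, unitaryChart_symm_zero, map_add, conjForm_apply,
    sharp]
  ring

end TensorDerivative

/-! ### The pairing with tangent vectors and the bracket of closed sections -/

section KoszulBracket

variable {H : Type*} [NormedAddCommGroup H] [InnerProductSpace ℂ H] [CompleteSpace H]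
  {e : HilbertBasis ℤ ℂ H}

/-- The bracket of two sections `α`, `β` (in the right trivialisation), for which
`d(π(α, β))` is the bracket as soon as `α` and `β` are closed: `D α · β♯ - D β · α♯ + [α, β]`. -/
def sectionBracket (e : HilbertBasis ℤ ℂ H) (α β : UnitaryOp H → L1ModU1 H) (q : UnitaryOp H) :
    L1ModU1 H :=
  leftDeriv α q
      (HS.toSkew e (sharp (q : H →L[ℂ] H) (β q))) -
    leftDeriv β q
      (HS.toSkew e (sharp (q : H →L[ℂ] H) (α q))) +
    triBracket (triPart e (α q)) (triPart e (β q))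

variable (e) in
lemma ContMDiffOn.toSkew_sharp {U : Set (UnitaryOp H)} {α : UnitaryOp H → L1ModU1 H}
    (hα : ContMDiffOn (modelU H) 𝓘(ℝ, L1ModU1 H) ∞ α U) :
    ContMDiffOn (modelU H) (modelU H) ∞
      (fun q : UnitaryOp H => HS.toSkew e (sharp (q : H →L[ℂ] H) (α q))) U :=
  ((HS.toSkew e).comp (HS.pu e)).contDiff.contMDiff.comp_contMDiffOn
    ((contMDiff_conj e).contMDiffOn.clm_apply ((triPart e).contDiff.contMDiff.comp_contMDiffOn hα))

lemma contDiff_triBracket : ContDiff ℝ ∞ fun z : HS e × HS e => triBracket z.1 z.2 := by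
  have h1 : ContDiff ℝ ∞ fun z : HS e × HS e => HS.mulL e z.1 z.2 :=
    ((HS.mulL e).contDiff.comp contDiff_fst).clm_apply contDiff_snd
  have h2 : ContDiff ℝ ∞ fun z : HS e × HS e => HS.mulL e z.2 z.1 :=
    ((HS.mulL e).contDiff.comp contDiff_snd).clm_apply contDiff_fst
  exact (L1.clsL (H := H)).contDiff.comp (h1.sub h2)

lemma contMDiffOn_sectionBracket {U : Set (UnitaryOp H)} (hU : IsOpen U)
    {α β : UnitaryOp H → L1ModU1 H} (hα : ContMDiffOn (modelU H) 𝓘(ℝ, L1ModU1 H) ∞ α U)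
    (hβ : ContMDiffOn (modelU H) 𝓘(ℝ, L1ModU1 H) ∞ β U) :
    ContMDiffOn (modelU H) 𝓘(ℝ, L1ModU1 H) ∞ (sectionBracket e α β) U := by
  have h1 := hα.leftDeriv_apply hU (hβ.toSkew_sharp e)
  have h2 := hβ.leftDeriv_apply hU (hα.toSkew_sharp e)
  have h4 : ContMDiffOn (modelU H) 𝓘(ℝ, HS e × HS e) ∞
      (fun q => (triPart e (α q), triPart e (β q))) U :=
    ((triPart e).contDiff.contMDiff.comp_contMDiffOn hα).prodMk_space
      ((triPart e).contDiff.contMDiff.comp_contMDiffOn hβ)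
  have h5 := (contDiff_triBracket (e := e)).contMDiff.comp_contMDiffOn h4
  have h6 := h1.sub h2
  have h7 := h6.add h5
  exact h7

lemma toSkew_comm_eq {w : HS e} (hw : w.IsSkew) (v : SkewAdj (H →L[ℂ] H)) :
    HS.toSkew e (w.comm v) = -skewPart (H →L[ℂ] H)
      ((v : H →L[ℂ] H) * (HS.toSkew e w : H →L[ℂ] H) - (HS.toSkew e w : H →L[ℂ] H) * v) := by
  rw [hw.coe_toSkew, ← map_neg, neg_sub, ← HS.op_comm]
  rfl

/-- For closed sections `α`, `β` the differential of `π(α, β)` is the section bracket. -/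
lemma leftDeriv_conjForm_of_closed {p : UnitaryOp H} {α β : UnitaryOp H → L1ModU1 H}
    (hα : MDifferentiableAt (modelU H) 𝓘(ℝ, L1ModU1 H) α p)
    (hβ : MDifferentiableAt (modelU H) 𝓘(ℝ, L1ModU1 H) β p)
    (hαc : IsClosedFormAt (modelU H) (sectionForm (skewPairing e) α) p)
    (hβc : IsClosedFormAt (modelU H) (sectionForm (skewPairing e) β) p)
    (v : SkewAdj (H →L[ℂ] H)) :
    leftDeriv
      (fun q : UnitaryOp H => conjForm e (HS.conj e (q : H →L[ℂ] H)) (α q) (β q)) p v =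
      skewPairing e (sectionBracket e α β p) (skewAd (p : H →L[ℂ] H) v) := by
  have h1 := leftDeriv_conjForm (e := e) hα.hasMFDerivAt_leftDeriv hβ.hasMFDerivAt_leftDeriv v
  have h2 := hαc.sectionForm_eq hα v (HS.toSkew e (sharp (p : H →L[ℂ] H) (β p)))
  have h3 := hβc.sectionForm_eq hβ v (HS.toSkew e (sharp (p : H →L[ℂ] H) (α p)))
  rw [form_comm_add_form_comm, conjForm_skew p (α p), conjForm_eq_skewPairing,
    conjForm_eq_skewPairing, toSkew_comm_eq (isSkew_sharp _ _), toSkew_comm_eq (isSkew_sharp _ _)] at h1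
  rw [h1, sectionBracket]
  simp only [map_add, map_sub, map_neg, add_apply, sub_apply] at h2 h3 ⊢
  linear_combination h2 - h3

/-- The Jacobi identity at a point, in terms of the section brackets. Closedness trades the
derivatives of the sections for triple products, and these cancel by `HS.sum_form_bracket_pu`. -/
lemma sum_skewPairing_sectionBracket {p : UnitaryOp H} {α β γ : UnitaryOp H → L1ModU1 H}
    (hα : MDifferentiableAt (modelU H) 𝓘(ℝ, L1ModU1 H) α p)
    (hβ : MDifferentiableAt (modelU H) 𝓘(ℝ, L1ModU1 H) β p)
    (hγ : MDifferentiableAt (modelU H) 𝓘(ℝ, L1ModU1 H) γ p)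
    (hαc : IsClosedFormAt (modelU H) (sectionForm (skewPairing e) α) p)
    (hβc : IsClosedFormAt (modelU H) (sectionForm (skewPairing e) β) p)
    (hγc : IsClosedFormAt (modelU H) (sectionForm (skewPairing e) γ) p) :
    skewPairing e (sectionBracket e β γ p)
        (skewAd (p : H →L[ℂ] H) (HS.toSkew e (sharp (p : H →L[ℂ] H) (α p)))) +
      skewPairing e (sectionBracket e γ α p)
        (skewAd (p : H →L[ℂ] H) (HS.toSkew e (sharp (p : H →L[ℂ] H) (β p)))) +
      skewPairing e (sectionBracket e α β p)
        (skewAd (p : H →L[ℂ] H) (HS.toSkew e (sharp (p : H →L[ℂ] H) (γ p)))) = 0 := by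
  have ha := isSkew_sharp (e := e) (p : H →L[ℂ] H) (α p)
  have hb := isSkew_sharp (e := e) (p : H →L[ℂ] H) (β p)
  have hc := isSkew_sharp (e := e) (p : H →L[ℂ] H) (γ p)
  have hT : HS.form e ((HS.conj e (p : H →L[ℂ] H) (triPart e (α p))).bracket
      (HS.conj e (p : H →L[ℂ] H) (triPart e (β p)))) (HS.conj e (p : H →L[ℂ] H) (triPart e (γ p))) = 0 := by
    rw [HS.conj_bracket, HS.form_conj]
    exact ((isTri_triPart e _).bracket (isTri_triPart e _)).form_eq_zero (isTri_triPart e _)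
  have key {ξ : UnitaryOp H → L1ModU1 H} (hξ : MDifferentiableAt (modelU H) 𝓘(ℝ, L1ModU1 H) ξ p)
      (hξc : IsClosedFormAt (modelU H) (sectionForm (skewPairing e) ξ) p) {x y : HS e}
      (hx : x.IsSkew) (hy : y.IsSkew) :
      skewPairing e (leftDeriv ξ p (HS.toSkew e x)) (skewAd (p : H →L[ℂ] H) (HS.toSkew e y)) -
        skewPairing e (leftDeriv ξ p (HS.toSkew e y)) (skewAd (p : H →L[ℂ] H) (HS.toSkew e x)) +
        HS.form e (HS.conj e (p : H →L[ℂ] H) (triPart e (ξ p))) (x.bracket y) = 0 := by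
    rw [← skewPairing_skewAd_toSkew p (ξ p) (hx.bracket hy)]
    have h := hξc.sectionForm_eq hξ (HS.toSkew e x) (HS.toSkew e y)
    rw [hx.coe_toSkew, hy.coe_toSkew, ← HS.op_bracket] at h
    exact h
  have k1 := key hα hαc hb hc
  have k2 := key hβ hβc hc ha
  have k3 := key hγ hγc ha hb
  simp only [sectionBracket, map_add, map_sub, add_apply, sub_apply, skewPairing_triBracket,
    ha.coe_toSkew, hb.coe_toSkew, hc.coe_toSkew, HS.comm_op]
  set x := HS.conj e (p : H →L[ℂ] H) (triPart e (α p))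
  set y := HS.conj e (p : H →L[ℂ] H) (triPart e (β p))
  set z := HS.conj e (p : H →L[ℂ] H) (triPart e (γ p))
  set a : HS e := sharp (p : H →L[ℂ] H) (α p)
  set b : HS e := sharp (p : H →L[ℂ] H) (β p)
  set c : HS e := sharp (p : H →L[ℂ] H) (γ p)
  have c1 (x y z : HS e) : HS.form e x (y.bracket z) = HS.form e (x.bracket y) z := by
    rw [HS.form_comm, HS.form_bracket_cycle x y z]
  rw [c1] at k1 k2 k3
  have hsum : HS.form e (y.bracket z) a + HS.form e (z.bracket x) b + HS.form e (x.bracket y) c =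
      HS.form e (a.bracket y) c + HS.form e (b.bracket z) a + HS.form e (c.bracket x) b :=
    HS.sum_form_bracket_pu hT
  rw [HS.form_bracket_cycle a y c, HS.form_bracket_cycle b z a, HS.form_bracket_cycle c x b] at hsum
  rw [c1 y z a, c1 z x b, c1 x y c]
  linear_combination k1 + k2 + k3 + hsum

end KoszulBracket

/-! ### Smooth sections of bundles built from a trivial bundle -/

section TrivialBundle

variable {E : Type*} [NormedAddCommGroup E] [NormedSpace ℝ E]
  {M : Type*} [TopologicalSpace M] [ChartedSpace E M]
  {F : Type*} [NormedAddCommGroup F] [NormedSpace ℝ F]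

lemma contMDiffOn_trivial_section {U : Set M} {α : M → F} :
    ContMDiffOn 𝓘(ℝ, E) (𝓘(ℝ, E).prod 𝓘(ℝ, F)) ∞
        (fun p => Bundle.TotalSpace.mk' F (E := Bundle.Trivial M F) p (α p)) U ↔
      ContMDiffOn 𝓘(ℝ, E) 𝓘(ℝ, F) ∞ α U :=
  forall₂_congr fun _ _ => Bundle.contMDiffWithinAt_section

lemma contMDiff_trivial_bilinear_section {β : M → F →L[ℝ] F →L[ℝ] ℝ}
    (hβ : ContMDiff 𝓘(ℝ, E) 𝓘(ℝ, F →L[ℝ] F →L[ℝ] ℝ) ∞ β) :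
    ContMDiff 𝓘(ℝ, E) (𝓘(ℝ, E).prod 𝓘(ℝ, F →L[ℝ] F →L[ℝ] ℝ)) ∞
      (fun p => Bundle.TotalSpace.mk' (F →L[ℝ] F →L[ℝ] ℝ)
        (E := fun p => Bundle.Trivial M F p →L[ℝ] Bundle.Trivial M F p →L[ℝ] ℝ) p (β p)) := by
  intro p₀
  rw [contMDiffAt_hom_bundle]
  refine ⟨contMDiffAt_id, (hβ p₀).congr_of_eventuallyEq (Filter.Eventually.of_forall fun p => ?_)⟩
  refine ContinuousLinearMap.ext fun ξ => ContinuousLinearMap.ext fun η => ?_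
  refine (inCoordinates_apply_eq₂ (E₃ := Bundle.Trivial M ℝ)
    (Set.mem_univ p) (Set.mem_univ p) (Set.mem_univ p)).trans ?_
  simp

/-- A smooth family of bilinear forms pulls back along the derivative of a smooth map into a
normed space to a smooth pairing of a trivial bundle with the tangent bundle. -/
lemma contMDiff_trivial_pairing_section [IsManifold 𝓘(ℝ, E) ∞ M]
    {W : Type*} [NormedAddCommGroup W] [NormedSpace ℝ W]
    {f : M → W} (hf : ContMDiff 𝓘(ℝ, E) 𝓘(ℝ, W) ∞ f) {β : M → F →L[ℝ] W →L[ℝ] ℝ}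
    (hβ : ContMDiff 𝓘(ℝ, E) 𝓘(ℝ, F →L[ℝ] W →L[ℝ] ℝ) ∞ β)
    {B : ∀ p : M, Bundle.Trivial M F p →L[ℝ] TangentSpace 𝓘(ℝ, E) p →L[ℝ] ℝ}
    (hB : ∀ p ξ v, B p ξ v = β p ξ (mfderiv 𝓘(ℝ, E) 𝓘(ℝ, W) f p v)) :
    ContMDiff 𝓘(ℝ, E) (𝓘(ℝ, E).prod 𝓘(ℝ, F →L[ℝ] E →L[ℝ] ℝ)) ∞
      (fun p => Bundle.TotalSpace.mk' (F →L[ℝ] E →L[ℝ] ℝ)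
        (E := fun p => Bundle.Trivial M F p →L[ℝ] TangentSpace 𝓘(ℝ, E) p →L[ℝ] ℝ) p (B p)) := by
  intro p₀
  rw [contMDiffAt_hom_bundle]
  refine ⟨contMDiffAt_id, ?_⟩
  have hD : ContMDiffAt 𝓘(ℝ, E) 𝓘(ℝ, E →L[ℝ] W) ∞ _ p₀ := (hf p₀).mfderiv_const (m := ∞) (by simp)
  have h2 := contDiff_flip.comp_contMDiffAt
    ((contDiff_flip.comp_contMDiffAt (hβ p₀)).clm_comp hD)
  refine h2.congr_of_eventuallyEq ?_
  have hs : (trivializationAt E (TangentSpace 𝓘(ℝ, E) : M → Type _) p₀).baseSet ∈ nhds p₀ :=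
    (trivializationAt E _ p₀).open_baseSet.mem_nhds (FiberBundle.mem_baseSet_trivializationAt' p₀)
  filter_upwards [hs] with p hp
  refine ContinuousLinearMap.ext fun ξ => ContinuousLinearMap.ext fun v => ?_
  refine (inCoordinates_apply_eq₂ (E₃ := Bundle.Trivial M ℝ)
    (Set.mem_univ p) hp (Set.mem_univ p)).trans ?_
  have h3 : inTangentCoordinates 𝓘(ℝ, E) 𝓘(ℝ, W) id f (mfderiv 𝓘(ℝ, E) 𝓘(ℝ, W) f) p₀ p v =
      mfderiv 𝓘(ℝ, E) 𝓘(ℝ, W) f p ((trivializationAt E (TangentSpace 𝓘(ℝ, E)) p₀).symm p v) := by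
    refine (DFunLike.congr_fun (TangentBundle.continuousLinearMapAt_model_space (f p₀) (f p)) _).trans ?_
    exact congrArg (mfderiv 𝓘(ℝ, E) 𝓘(ℝ, W) f p)
      ((trivializationAt E (TangentSpace 𝓘(ℝ, E)) p₀).symmL_apply (R := ℝ) hp v)
  simp only [Bundle.Trivial.fiberBundle_trivializationAt', Bundle.Trivial.trivialization_symm_apply,
    Bundle.Trivial.linearMapAt_trivialization, LinearMap.id_apply, hB]
  exact congrArg (β p ξ) h3.symm
end TrivialBundle

/-! ### The precotangent bundle in duality with the tangent bundle -/

section Duality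

variable {H : Type*} [NormedAddCommGroup H] [InnerProductSpace ℂ H] [CompleteSpace H]
  {e : HilbertBasis ℤ ℂ H}

lemma skewPairing_left_nondegenerate {ξ : L1ModU1 H} (h : ∀ v, skewPairing e ξ v = 0) : ξ = 0 := by
  obtain ⟨x, rfl⟩ := ξ.exists_rep
  -- test against `v = i (x + x*)`: twice the pairing is `Tr ((x + x*)²)`
  set y : HS e := HS.ofL1 e (x + x.adj) with hy
  have hyop : y.op = x.op + star x.op := by simp [hy]
  have hys : star y.op = y.op := by rw [hyop, star_add, star_star, add_comm]
  have hskew : star (Complex.I • y.op) = -(Complex.I • y.op) := by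
    rw [star_smul, hys]
    simp
  have h1 := h (skewPart (H →L[ℂ] H) (Complex.I • y.op))
  rw [skewPairing_cls, skewPart_coe_of_star hskew, mul_smul_comm, opTrace_smul, Complex.I_mul_im] at h1
  have h2 : opTrace e (y.op * y.op) =
      opTrace e (x.op * y.op) + (starRingEnd ℂ) (opTrace e (x.op * y.op)) := by
    rw [← opTrace_star, star_mul, hys, ← x.op_adj, ← L1.opTrace_mul_comm]
    conv_lhs => rw [hyop, add_mul]
    exact map_add (traceL e) (x.mulRight y.op) (x.adj.mulRight y.op)
  have h3 : opTrace e (y.op * y.op) = 0 := by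
    rw [h2, Complex.add_conj, h1]
    simp
  have h4 : ((‖y‖ ^ 2 : ℝ) : ℂ) = 0 := by
    rw [← h3, HS.norm_sq, Complex.ofReal_tsum]
    refine tsum_congr fun n => ?_
    change _ = ⟪e n, y.op (y.op (e n))⟫_ℂ
    rw [← hys, inner_star_apply, hys, inner_self_eq_norm_sq_to_K]
    simp
  have h5 : y = 0 := by
    rw [← norm_eq_zero]
    exact pow_eq_zero_iff two_ne_zero |>.1 (by exact_mod_cast h4)
  refine L1.cls_eq_zero ?_
  rw [h5, map_zero] at hyop
  exact eq_neg_of_add_eq_zero_right hyop.symm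

variable (e) in
/-- The orthogonal projection `|n⟩⟨n|`, as a Hilbert–Schmidt operator. -/
def HS.basisProj (n : ℤ) : HS e :=
  ⟨InnerProductSpace.rankOne ℂ (e n) (e n), summable_of_ne_finset_zero (s := {n}) fun m hm => by
    have h : ⟪e n, e m⟫_ℂ = 0 := e.orthonormal.2 fun h => hm (by simp [h])
    simp [h]⟩

lemma HS.op_basisProj (n : ℤ) (v : H) : (HS.basisProj e n).op v = ⟪e n, v⟫_ℂ • e n := rfl

lemma opTrace_basisProj_mul (n : ℤ) (a : H →L[ℂ] H) :
    opTrace e ((HS.basisProj e n).op * a) = ⟪e n, a (e n)⟫_ℂ := by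
  have h (m : ℤ) : ⟪e m, ((HS.basisProj e n).op * a) (e m)⟫_ℂ = ⟪e n, a (e m)⟫_ℂ * ⟪e m, e n⟫_ℂ := by
    change ⟪e m, (HS.basisProj e n).op (a (e m))⟫_ℂ = _
    rw [HS.op_basisProj, inner_smul_right]
  rw [opTrace, tsum_eq_single n fun m hm => by rw [h, e.orthonormal.2 hm, mul_zero], h,
    inner_self_eq_norm_sq_to_K, e.orthonormal.1]
  simp

lemma HS.basisProj_mul_self (n : ℤ) :
    (HS.basisProj e n).op * (HS.basisProj e n).op = (HS.basisProj e n).op := by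
  ext v
  change (HS.basisProj e n).op ((HS.basisProj e n).op v) = _
  rw [HS.op_basisProj, HS.op_basisProj, inner_smul_right, inner_self_eq_norm_sq_to_K, e.orthonormal.1]
  simp

lemma skewPairing_right_nondegenerate {v : SkewAdj (H →L[ℂ] H)}
    (h : ∀ ξ, skewPairing e ξ v = 0) : v = 0 := by
  apply SkewAdj.val_injective
  refine op_ext e fun m n => ?_
  -- test against `x = i |n⟩⟨n| v`: the pairing is `-‖v |n⟩‖²`
  let x : L1 H := ((HS.basisProj e n).mul (HS.basisProj e n)).mulRight (Complex.I • (v : H →L[ℂ] H))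
  have h1 := h x.cls
  rw [skewPairing_cls] at h1
  simp only [x, L1.op_mulRight, HS.op_mul, HS.basisProj_mul_self, mul_assoc] at h1
  have h2 : ⟪e n, ((v : H →L[ℂ] H) * v) (e n)⟫_ℂ = -((‖(v : H →L[ℂ] H) (e n)‖ ^ 2 : ℝ) : ℂ) := by
    change ⟪e n, (v : H →L[ℂ] H) ((v : H →L[ℂ] H) (e n))⟫_ℂ = _
    rw [← inner_star_apply_left, v.star_coe, neg_apply, inner_neg_left, inner_self_eq_norm_sq_to_K]
    simp
  rw [opTrace_basisProj_mul, smul_mul_assoc, smul_apply, inner_smul_right, h2] at h1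
  have h3 : (v : H →L[ℂ] H) (e n) = 0 := by
    rw [Complex.I_mul_im, Complex.neg_re, Complex.ofReal_re, neg_eq_zero] at h1
    exact norm_eq_zero.1 (pow_eq_zero_iff two_ne_zero |>.1 h1)
  rw [h3]
  simp

variable (e) in
/-- The pairing of the precotangent bundle with the tangent bundle: the right-trivialised covector
`[x]` at `g` acts on the left-trivialised tangent vector `v`, i.e. on `g v`, by `Im Tr (x g v g⁻¹)`. -/
def dualPairing (g : UnitaryOp H) :
    Precotangent H g →L[ℝ] TangentSpace (modelU H) g →L[ℝ] ℝ :=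
  (((skewAd (g : H →L[ℂ] H)).precomp ℝ).comp (skewPairing e) :
    L1ModU1 H →L[ℝ] SkewAdj (H →L[ℂ] H) →L[ℝ] ℝ)

lemma dualPairing_apply (g : UnitaryOp H) (ξ : L1ModU1 H) (v : SkewAdj (H →L[ℂ] H)) :
    dualPairing e g ξ v = skewPairing e ξ (skewAd (g : H →L[ℂ] H) v) := rfl

lemma tangentRightInv_apply (g : UnitaryOp H) (v : SkewAdj (H →L[ℂ] H)) :
    tangentRightInv g v = (skewAd (g : H →L[ℂ] H) v : H →L[ℂ] H) := by
  have h1 := ((ContinuousLinearMap.mul ℝ (H →L[ℂ] H)).flip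
    (star (g : H →L[ℂ] H))).hasFDerivAt.hasMFDerivAt.comp g (hasMFDerivAt_unitary_coe g)
  have h2 : tangentRightInv g = _ := h1.mfderiv
  rw [h2, coe_skewAd]
  rfl

/-- In the right trivialisation right translations act trivially on tangent vectors. -/
lemma skewAd_tangentRight (g : UnitaryOp H) (v : SkewAdj (H →L[ℂ] H)) :
    skewAd (g : H →L[ℂ] H) (tangentRight g v : SkewAdj (H →L[ℂ] H)) = v := by
  have h1 := ((ContinuousLinearMap.mul ℝ (H →L[ℂ] H)).flip
    (g : H →L[ℂ] H)).hasFDerivAt.hasMFDerivAt.comp 1 (hasMFDerivAt_unitary_coe (1 : UnitaryOp H))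
  have hd : MDifferentiableAt (modelU H) (modelU H) (fun h : UnitaryOp H => h * g) 1 :=
    (contMDiff_mul_right (I := modelU H) (n := ∞) (a := g)).mdifferentiable (by simp) 1
  have h2 := (hasMFDerivAt_unitary_coe ((1 : UnitaryOp H) * g)).comp 1 hd.hasMFDerivAt
  have h3 := hasMFDerivAt_unique h1 h2
  have h4 : (((1 : UnitaryOp H) : H →L[ℂ] H) * (v : H →L[ℂ] H)) * (g : H →L[ℂ] H) =
      (((1 : UnitaryOp H) * g : UnitaryOp H) : H →L[ℂ] H) *
        (SkewAdj.val (tangentRight g v : SkewAdj (H →L[ℂ] H))) :=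
    congrArg (fun f : SkewAdj (H →L[ℂ] H) →L[ℝ] (H →L[ℂ] H) => f v) h3
  rw [one_mul, OneMemClass.coe_one, one_mul] at h4
  apply SkewAdj.val_injective
  refine (coe_skewAd (g : H →L[ℂ] H) (tangentRight g v : SkewAdj (H →L[ℂ] H))).trans ?_
  rw [← h4, mul_assoc, Unitary.mul_star_self_of_mem g.2, mul_one]

lemma skewAd_star_skewAd (g : UnitaryOp H) (v : SkewAdj (H →L[ℂ] H)) :
    skewAd (g : H →L[ℂ] H) (skewAd (star (g : H →L[ℂ] H)) v) = v := by
  apply SkewAdj.val_injective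
  simp only [coe_skewAd, star_star, mul_assoc, Unitary.mul_star_cancel_left,
    Unitary.mul_star_self_of_mem g.2, mul_one]

lemma skewAd_injective (g : UnitaryOp H) {v : SkewAdj (H →L[ℂ] H)}
    (h : skewAd (g : H →L[ℂ] H) v = 0) : v = 0 := by
  have h1 : (g : H →L[ℂ] H) * (v : H →L[ℂ] H) * star (g : H →L[ℂ] H) = 0 := by
    rw [← coe_skewAd, h, map_zero]
  have h2 := congrArg (fun a : H →L[ℂ] H => star (g : H →L[ℂ] H) * (a * (g : H →L[ℂ] H))) h1
  simp only [mul_assoc, Unitary.star_mul_cancel_left, Unitary.star_mul_self_of_mem g.2, mul_one,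
    zero_mul, mul_zero] at h2
  exact SkewAdj.val_injective (h2.trans (map_zero _).symm)

lemma isSmoothSection_iff {U : Set (UnitaryOp H)} {α : UnitaryOp H → L1ModU1 H} :
    IsSmoothSection (V := Precotangent H) (modelU H) (L1ModU1 H) U α ↔
      ContMDiffOn (modelU H) 𝓘(ℝ, L1ModU1 H) ∞ α U :=
  contMDiffOn_trivial_section (F := L1ModU1 H)

lemma contMDiff_rightTensor :
    ContMDiff (modelU H) ((modelU H).prod 𝓘(ℝ, L1ModU1 H →L[ℝ] L1ModU1 H →L[ℝ] ℝ)) ∞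
      (fun g : UnitaryOp H => Bundle.TotalSpace.mk' (L1ModU1 H →L[ℝ] L1ModU1 H →L[ℝ] ℝ)
        (E := fun g => Precotangent H g →L[ℝ] Precotangent H g →L[ℝ] ℝ) g
        (rightTensor (fun g => conjForm e (HS.conj e (g : H →L[ℂ] H))) g)) :=
  contMDiff_trivial_bilinear_section (contMDiff_conjForm e)

lemma contMDiff_dualPairing :
    ContMDiff (modelU H) ((modelU H).prod 𝓘(ℝ, L1ModU1 H →L[ℝ] SkewAdj (H →L[ℂ] H) →L[ℝ] ℝ)) ∞
      (fun g : UnitaryOp H => Bundle.TotalSpace.mk' (L1ModU1 H →L[ℝ] SkewAdj (H →L[ℂ] H) →L[ℝ] ℝ)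
        (E := fun g => Precotangent H g →L[ℝ] TangentSpace (modelU H) g →L[ℝ] ℝ) g
        (dualPairing e g)) := by
  -- `β g ξ a` pairs `ξ` with the skew-hermitian part of `a g⁻¹`, for an arbitrary operator `a`
  let β (g : UnitaryOp H) : L1ModU1 H →L[ℝ] (H →L[ℂ] H) →L[ℝ] ℝ :=
    ((skewPairing e).flip.comp ((skewPart (H →L[ℂ] H)).comp
      ((ContinuousLinearMap.mul ℝ (H →L[ℂ] H)).flip (star (g : H →L[ℂ] H))))).flip
  have hstar : ContMDiff (modelU H) 𝓘(ℝ, H →L[ℂ] H) ∞ fun g : UnitaryOp H => star (g : H →L[ℂ] H) :=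
    ((starL' ℝ : (H →L[ℂ] H) ≃L[ℝ] (H →L[ℂ] H)) : (H →L[ℂ] H) →L[ℝ] (H →L[ℂ] H)).contDiff.comp_contMDiff
      contMDiff_unitary_coe
  have hβ : ContMDiff (modelU H) 𝓘(ℝ, L1ModU1 H →L[ℝ] (H →L[ℂ] H) →L[ℝ] ℝ) ∞ β := by
    refine contDiff_flip.comp_contMDiff (contMDiff_const.clm_comp (contMDiff_const.clm_comp ?_))
    exact (ContinuousLinearMap.contDiff _).comp_contMDiff hstar
  refine contMDiff_trivial_pairing_section (contMDiff_unitary_coe (A := H →L[ℂ] H)) hβ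
    fun g ξ v => ?_
  rw [(hasMFDerivAt_unitary_coe g).mfderiv]
  rfl

end Duality

/-! ### The Poisson–Lie group structure -/

section PoissonLieGroup

variable {H : Type*} [NormedAddCommGroup H] [InnerProductSpace ℂ H] [CompleteSpace H]
  (e : HilbertBasis ℤ ℂ H)

lemma isDualityPairing_dualPairing : IsDualityPairing (modelU H) (L1ModU1 H) (dualPairing e) where
  smooth := contMDiff_dualPairing
  nondegenerate_left g α h := by
    refine skewPairing_left_nondegenerate (e := e) (ξ := α) fun v => ?_
    rw [← skewAd_star_skewAd g v]
    exact h (skewAd (star (g : H →L[ℂ] H)) v)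
  nondegenerate_right g v h := skewAd_injective g (skewPairing_right_nondegenerate (e := e) h)

lemma dualPairing_cls (g : UnitaryOp H) (x : L1 H) (v : SkewAdj (H →L[ℂ] H)) :
    dualPairing e g x.cls v = (opTrace e (x.op * tangentRightInv g v)).im := by
  have h : opTrace e (x.op * tangentRightInv g v) =
      opTrace e (x.op * (skewAd (g : H →L[ℂ] H) v : H →L[ℂ] H)) :=
    congrArg (fun a : H →L[ℂ] H => opTrace e (x.op * a)) (tangentRightInv_apply g v)
  rw [dualPairing_apply, skewPairing_cls, h]

lemma isPoissonTensor_rightTensor :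
    IsPoissonTensor (modelU H) (L1ModU1 H) (dualPairing e)
      (rightTensor fun g => conjForm e (HS.conj e (g : H →L[ℂ] H))) where
  smooth := contMDiff_rightTensor
  skew g α β := conjForm_skew g α β
  differential U hU α β hα hβ := by
    have hαs := isSmoothSection_iff.1 hα.smooth
    have hβs := isSmoothSection_iff.1 hβ.smooth
    refine ⟨sectionBracket e α β, isSmoothSection_iff.2 (contMDiffOn_sectionBracket hU hαs hβs),
      fun p hp v => ?_⟩
    exact (leftDeriv_conjForm_of_closed
      ((hαs.contMDiffAt (hU.mem_nhds hp)).mdifferentiableAt (by simp))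
      ((hβs.contMDiffAt (hU.mem_nhds hp)).mdifferentiableAt (by simp))
      (hα.closed p hp) (hβ.closed p hp) v).symm
  jacobi U hU α β γ δβγ δγα δαβ hα hβ hγ hβγ hγα hαβ p hp := by
    have hd {ξ : UnitaryOp H → L1ModU1 H}
        (h : IsClosedSection (V := Precotangent H) (modelU H) (L1ModU1 H) (dualPairing e) U ξ) :
        MDifferentiableAt (modelU H) 𝓘(ℝ, L1ModU1 H) ξ p :=
      ((isSmoothSection_iff.1 h.smooth).contMDiffAt (hU.mem_nhds hp)).mdifferentiableAt (by simp)
    have key {ξ η ζ δ : UnitaryOp H → L1ModU1 H}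
        (hη : IsClosedSection (V := Precotangent H) (modelU H) (L1ModU1 H) (dualPairing e) U η)
        (hζ : IsClosedSection (V := Precotangent H) (modelU H) (L1ModU1 H) (dualPairing e) U ζ)
        (hδ : IsDifferentialSection (V := Precotangent H) (modelU H) (L1ModU1 H) (dualPairing e) U
          (fun q => conjForm e (HS.conj e (q : H →L[ℂ] H)) (η q) (ζ q)) δ) :
        conjForm e (HS.conj e (p : H →L[ℂ] H)) (ξ p) (δ p) =
          -skewPairing e (sectionBracket e η ζ p)
            (skewAd (p : H →L[ℂ] H) (HS.toSkew e (sharp (p : H →L[ℂ] H) (ξ p)))) := by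
      rw [conjForm_skew p, conjForm_eq_skewPairing, ← leftDeriv_conjForm_of_closed (hd hη) (hd hζ)
        (hη.closed p hp) (hζ.closed p hp)]
      exact congrArg Neg.neg
        (hδ.eq_mfderiv p hp (HS.toSkew e (sharp (p : H →L[ℂ] H) (ξ p)) : SkewAdj (H →L[ℂ] H)))
    have h1 := key (ξ := α) hβ hγ hβγ
    have h2 := key (ξ := β) hγ hα hγα
    have h3 := key (ξ := γ) hα hβ hαβ
    have h4 := sum_skewPairing_sectionBracket (hd hα) (hd hβ) (hd hγ)
      (hα.closed p hp) (hβ.closed p hp) (hγ.closed p hp)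
    change conjForm e (HS.conj e (p : H →L[ℂ] H)) (α p) (δβγ p) +
      conjForm e (HS.conj e (p : H →L[ℂ] H)) (β p) (δγα p) +
      conjForm e (HS.conj e (p : H →L[ℂ] H)) (γ p) (δαβ p) = 0
    rw [h1, h2, h3]
    linear_combination -h4

/-- The derivative of the multiplication in the right trivialisation: the second factor is moved by
the adjoint action of the first one. -/
lemma skewAd_mfderiv_mul (z : UnitaryOp H × UnitaryOp H)
    (v : TangentSpace ((modelU H).prod (modelU H)) z) :
    skewAd ((z.1 * z.2 : UnitaryOp H) : H →L[ℂ] H)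
        (mfderiv ((modelU H).prod (modelU H)) (modelU H)
          (fun z : UnitaryOp H × UnitaryOp H => z.1 * z.2) z v) =
      skewAd (z.1 : H →L[ℂ] H) (mfderiv ((modelU H).prod (modelU H)) (modelU H) Prod.fst z v) +
        skewAd (z.1 : H →L[ℂ] H) (skewAd (z.2 : H →L[ℂ] H)
          (mfderiv ((modelU H).prod (modelU H)) (modelU H) Prod.snd z v)) := by
  have hd : MDifferentiableAt ((modelU H).prod (modelU H)) (modelU H)
      (fun z : UnitaryOp H × UnitaryOp H => z.1 * z.2) z :=
    (contMDiff_mul (modelU H) ∞).mdifferentiable (by simp) z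
  have h1 := (hasMFDerivAt_unitary_coe (z.1 * z.2)).comp z hd.hasMFDerivAt
  have h2 := ((hasMFDerivAt_unitary_coe z.1).comp z
    (mdifferentiableAt_fst (I := modelU H) (I' := modelU H)).hasMFDerivAt).mul'
    ((hasMFDerivAt_unitary_coe z.2).comp z
      (mdifferentiableAt_snd (I := modelU H) (I' := modelU H)).hasMFDerivAt)
  have h3 := hasMFDerivAt_unique h1 h2
  obtain ⟨m, hm⟩ : ∃ m : SkewAdj (H →L[ℂ] H), m = mfderiv ((modelU H).prod (modelU H)) (modelU H)
    (fun z : UnitaryOp H × UnitaryOp H => z.1 * z.2) z v := ⟨_, rfl⟩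
  obtain ⟨a, ha⟩ : ∃ a : SkewAdj (H →L[ℂ] H), a =
    mfderiv ((modelU H).prod (modelU H)) (modelU H) Prod.fst z v := ⟨_, rfl⟩
  obtain ⟨b, hb⟩ : ∃ b : SkewAdj (H →L[ℂ] H), b =
    mfderiv ((modelU H).prod (modelU H)) (modelU H) Prod.snd z v := ⟨_, rfl⟩
  have h4 : ((z.1 * z.2 : UnitaryOp H) : H →L[ℂ] H) * (m : H →L[ℂ] H) =
      (z.1 : H →L[ℂ] H) * ((z.2 : H →L[ℂ] H) * (b : H →L[ℂ] H)) +
        ((z.1 : H →L[ℂ] H) * (a : H →L[ℂ] H)) * (z.2 : H →L[ℂ] H) := by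
    rw [hm, ha, hb]
    exact congrArg (fun f : SkewAdj (H →L[ℂ] H) × SkewAdj (H →L[ℂ] H) →L[ℝ] (H →L[ℂ] H) => f v) h3
  rw [← hm, ← ha, ← hb]
  apply SkewAdj.val_injective
  rw [coe_skewAd, h4, map_add, coe_skewAd, coe_skewAd, coe_skewAd, Submonoid.coe_mul, star_mul]
  simp only [add_mul, mul_assoc, Unitary.mul_star_cancel_left]
  exact add_comm _ _

lemma isPoissonMap_mul :
    IsPoissonMap ((modelU H).prod (modelU H)) (modelU H)
      (prodPairing (modelU H) (modelU H) (dualPairing e) (dualPairing e))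
      (prodTensor (rightTensor fun g => conjForm e (HS.conj e (g : H →L[ℂ] H)))
        (rightTensor fun g => conjForm e (HS.conj e (g : H →L[ℂ] H))))
      (dualPairing e) (rightTensor fun g => conjForm e (HS.conj e (g : H →L[ℂ] H)))
      (fun z : UnitaryOp H × UnitaryOp H => z.1 * z.2) where
  smooth := contMDiff_mul (modelU H) ∞
  poisson z := by
    refine ⟨((ContinuousLinearMap.id ℝ (L1ModU1 H)).prod (coadj z.1) :
      L1ModU1 H →L[ℝ] L1ModU1 H × L1ModU1 H), fun α v => ?_, fun α β => ?_⟩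
    · refine Eq.trans ?_ (congrArg (skewPairing e α) (skewAd_mfderiv_mul z v)).symm
      rw [map_add, ← skewPairing_coadj]
      rfl
    · exact (conjForm_mul z.1 z.2 α β).symm

end PoissonLieGroup

end

theorem theorem4p1 {H : Type*} [NormedAddCommGroup H] [InnerProductSpace ℂ H] [CompleteSpace H]
    (e : HilbertBasis ℤ ℂ H) :
    ∃ (B : ∀ g : UnitaryOp H, Precotangent H g →L[ℝ] TangentSpace (modelU H) g →L[ℝ] ℝ)
      (P : UnitaryOp H → Precotangent H 1 →L[ℝ] Precotangent H 1 →L[ℝ] ℝ),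
      (∀ (g : UnitaryOp H) (x : L1 H) (v : TangentSpace (modelU H) g),
        B g x.cls v = (opTrace e (x.op * tangentRightInv g v)).im) ∧
      (∀ (g : UnitaryOp H) (α : Precotangent H g) (v : TangentSpace (modelU H) (1 : UnitaryOp H)),
        B 1 (rightPullback g α) v = B g α (tangentRight g v)) ∧
      (∀ (g : UnitaryOp H) (x₁ x₂ : L1 H),
        P g x₁.cls x₂.cls = poissonForm e g x₁ x₂) ∧
      IsBanachPoissonLieGroup (modelU H) (L1ModU1 H) B (rightTensor P) ∧
      ∀ U : Set (UnitaryOp H), IsOpen U → ∀ f h : UnitaryOp H → ℝ,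
        ContMDiffOn (modelU H) 𝓘(ℝ, ℝ) ∞ f U → ContMDiffOn (modelU H) 𝓘(ℝ, ℝ) ∞ h U →
        ∀ g ∈ U, ∀ α β : Precotangent H g,
          (∀ v, B g α v = mfderiv (modelU H) 𝓘(ℝ, ℝ) f g v) →
          (∀ v, B g β v = mfderiv (modelU H) 𝓘(ℝ, ℝ) h g v) →
          ∃ a b : Precotangent H 1,
            (∀ v, B 1 a v = mfderiv (modelU H) 𝓘(ℝ, ℝ) f g (tangentRight g v)) ∧
            (∀ v, B 1 b v = mfderiv (modelU H) 𝓘(ℝ, ℝ) h g (tangentRight g v)) ∧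
            rightTensor P g α β = P g a b := by
  have hR (g : UnitaryOp H) (α : Precotangent H g)
      (v : TangentSpace (modelU H) (1 : UnitaryOp H)) :
      dualPairing e 1 (rightPullback g α) v = dualPairing e g α (tangentRight g v) := by
    refine (congrArg (skewPairing e α) ?_).trans
      (congrArg (skewPairing e α) (skewAd_tangentRight g v)).symm
    apply SkewAdj.val_injective
    refine (coe_skewAd _ _).trans ?_
    simp
  refine ⟨dualPairing e, fun g => conjForm e (HS.conj e (g : H →L[ℂ] H)), dualPairing_cls e, hR,
    conjForm_cls, ⟨⟨isDualityPairing_dualPairing e, isPoissonTensor_rightTensor e⟩,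
      isPoissonMap_mul e⟩, fun U _ f h _ _ g _ α β hα hβ =>
      ⟨rightPullback g α, rightPullback g β, fun v => ?_, fun v => ?_, rfl⟩⟩
  · rw [hR, hα]
  · rw [hR, hβ]
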